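/- **Setting.** Let $\mathcal T\subset\mathbb R^2$ be a compact convex set with nonempty interior, let $\gamma$ be the counter-clockwise (ccw) arc-length parametrization of $\partial\mathcal T$, extended with period $L$ (the perimeter length); vertices are allowed. Write $[a\to b]=(b-a)\bmod L\in[0,L)$ for the ccw arc length from $a$ to $b$, and say that $s$ lies on the segment $[a,b]$ if $[a\to s]\le[a\to b]$. Let $0<\nu\le 1$. A defender moves on the perimeter, at $\gamma(s_D(t))$ with $|\dot s_D|\le1$; an intruder moves in the plane, $\|\dot{\mathbf x}_A\|\le\nu$, and starts outside $\mathcal T$. The intruder is captured when $\mathbf x_A=\gamma(s_D)$; it wins if it reaches $\mathcal T$ at a finite time without having been captured up to and including that time; otherwise the defender wins. Players use (possibly discontinuous) feedback of the current state $(s_D,\mathbf x_A)$. The motions generated by a feedback law are the locally uniform limits, as the sampling step tends to $0$, of step-by-step motions from the given initial state, in which the player keeps the control chosen at the last sampling time while the opponent moves arbitrarily within its speed limit. A state $(s_D,\mathbf x_A)$ with $\mathbf x_A\notin\mathcal T$ is winning for a player if some feedback law makes that player win along all motions generated by it from that state. The barrier is the set of states (with $\mathbf x_A\notin\mathcal T$)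 in the closure of both winning regions. **The function $V$.** For $\mathbf x\notin\mathcal T$ let $\mathcal S_d(\mathbf x)$ be the set of perimeter points $s$ for which the open segment from $\mathbf x$ to $\gamma(s)$ does not meet the interior of $\mathcal T$. Put $J_L(s;s_D,\mathbf x)=[s_D\to s]-\|\gamma(s)-\mathbf x\|/\nu$ and $J_R(s;s_D,\mathbf x)=[s\to s_D]-\|\gamma(s)-\mathbf x\|/\nu$. The left (right) breaching point $s_L(\mathbf x)$ ($s_R(\mathbf x)$) is a point of $\mathcal S_d(\mathbf x)$ that maximizes $J_L$ ($J_R$) over $\mathcal S_d(\mathbf x)$ for $s_D\notin\mathcal S_d(\mathbf x)$ (if $\nu=1$ and it is not unique, any choice). Let $J_L^*(s_D,\mathbf x)=J_L(s_L;s_D,\mathbf x)$ and $J_R^*(s_D,\mathbf x)=J_R(s_R;s_D,\mathbf x)$ for all $s_D$. The set $\{J_L^*=J_R^*\}$ consists of the afferent surface $\Gamma_{\rm aff}(s_D)$, where $s_D$ lies on the segment $[s_R,s_L]$, and the dispersal surface $\Gamma_{\rm dis}(s_D)$, where it does not. The left region $\Omega_L(s_D)$, to the left of the defender between these surfaces,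 is the set of $\mathbf x\notin\mathcal T$ such that either $s_D\in[s_R,s_L]$ and $J_L^*>J_R^*$, or $s_D\notin[s_R,s_L]$ and $J_L^*<J_R^*$. Finally $V=J_L^*$ if $\mathbf x\in\Omega_L(s_D)$ and $V=J_R^*$ otherwise. Let $\mathbf u_A^*$ be the velocity of norm $\nu$ straight towards $\gamma(s_L)$ if $\mathbf x_A\in\Omega_L(s_D)$ and towards $\gamma(s_R)$ otherwise, and let $\omega_D^*=1$ if $\mathbf x_A\in\Omega_L(s_D)$ and $\omega_D^*=-1$ otherwise. **Theorem.** 1. Breaching points exist for every $\mathbf x\notin\mathcal T$, and are unique modulo $L$ if $\nu<1$. For a tangent vector $v$ at $s$ let $\phi\in[0,\pi]$ be the angle between $\gamma(s)-\mathbf x$ and $v$. If $\gamma$ is differentiable at $s_L$ (at $s_R$), then $\phi=\arccos\nu$ ($\phi=\pi-\arccos\nu$) there. If $s_L$ ($s_R$) is interior to $\mathcal S_d(\mathbf x)$, then the angles $\phi^-,\phi^+$ for the left and right derivative of $\gamma$ (where these exist) satisfy $\phi^+\le\arccos\nu\le\phi^-$ ($\phi^+\le\pi-\arccos\nu\le\phi^-$).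 2. With $\mathcal S_L=[s_D,s_D+L/2]$ and $\mathcal S_R=[s_D+L/2,s_D]$: if $[s_R\to s_L]\le L/2$, then $\mathbf x\in\Omega_L(s_D)$ if and only if one of the following holds: $s_L\in\mathcal S_L$, $s_R\in\mathcal S_R$, $J_L^*>J_R^*$; or $s_L\in\mathcal S_L$, $s_R\notin\mathcal S_R$; or $s_L\notin\mathcal S_L$, $s_R\notin\mathcal S_R$, $J_L^*<J_R^*$. 3. $\mathbf u_A^*$ and $\omega_D^*$ are admissible feedback laws. Suppose that $V>0$ at the initial state. If $\nu<1$, the intruder wins along every motion generated by $\mathbf u_A^*$. If $\nu\le1$, then along every such motion either the intruder wins, or it stays outside $\mathcal T$ for all time, $V$ never falls below its initial value, and the distance from $\mathbf x_A$ to $\mathcal T$ tends to $0$. 4. Suppose that $V\le0$ at the initial state. Then the defender wins along every motion generated by $\omega_D^*$; if $\nu<1$, then along every such motion the intruder is captured or stays on $\Gamma_{\rm aff}(s_D)$ from some time on. For any initial state and $\nu\le 1$, once $\mathbf x_A\in\Gamma_{\rm aff}(s_D)$ under $\omega_D^*$, this remains so as long as the intruder has not reached $\mathcal T$. 5. The intruder-winning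 region is $\{V>0\}$, the defender-winning region is $\{V\le0\}$, and the barrier is exactly the zero level set $\{V=0\}$ (all with $\mathbf x_A\notin\mathcal T$). -/

import Mathlib

open Set Filter Topology

noncomputable section

namespace PerimeterDefense

/-- The Euclidean plane. -/
abbrev Plane : Type := EuclideanSpace ℝ (Fin 2)

/-- The planar cross product; it is nonnegative when `w` points to the left of `v`. -/
def cross (v w : Plane) : ℝ := v 0 * w 1 - v 1 * w 0

/-- A convex target region in the plane with its perimeter, parameterized counter-clockwise by
arc length. The curve is extended periodically to `ℝ`, so that `s` and `s + L` are the same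
point of the perimeter. Vertices are allowed. -/
structure Target where
  /-- the target region -/
  region : Set Plane
  /-- the perimeter curve -/
  γ : ℝ → Plane
  /-- the perimeter length -/
  L : ℝ
  convex_region : Convex ℝ region
  isCompact_region : IsCompact region
  interior_nonempty : (interior region).Nonempty
  L_pos : 0 < L
  periodic : Function.Periodic γ L
  injOn : InjOn γ (Ico 0 L)
  range_eq : range γ = frontier region
  unitSpeed : HasUnitSpeedOn γ univ
  /-- counter-clockwise: the region lies to the left of every tangent vector -/
  ccw : ∀ (s : ℝ) (v : Plane), HasDerivAt γ v s → ∀ p ∈ region, 0 ≤ cross v (p - γ s)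

namespace Target

variable (P : Target)

/-- `arc a b` is the counter-clockwise arc length from `a` to `b`, i.e. `(b - a) mod L`. -/
def arc (a b : ℝ) : ℝ := toIcoMod P.L_pos 0 (b - a)

/-- The perimeter segment from `a` counter-clockwise to `b`, end points included. -/
def segment (a b : ℝ) : Set ℝ := {s | P.arc a s ≤ P.arc a b}

/-- The perimeter points that can be reached from `x` on a straight line which does not run
through the inside of the target. -/
def visible (x : Plane) : Set ℝ :=
  {s | ∀ p ∈ openSegment ℝ x (P.γ s), p ∉ interior P.region}

/-- The approach angle at the perimeter point `s`, for a tangent vector `v`. -/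
def approachAngle (x : Plane) (s : ℝ) (v : Plane) : ℝ :=
  InnerProductGeometry.angle (P.γ s - x) v

variable (ν : ℝ)

/-- Travel time of the defender from `sD` counter-clockwise to `sB`, minus travel time of the
intruder from `x` straight to `sB`. -/
def JL (sB sD : ℝ) (x : Plane) : ℝ := P.arc sD sB - ‖P.γ sB - x‖ / ν

/-- Travel time of the defender from `sD` clockwise to `sB`, minus travel time of the
intruder from `x` straight to `sB`. -/
def JR (sB sD : ℝ) (x : Plane) : ℝ := P.arc sB sD - ‖P.γ sB - x‖ / ν

/-- `s` is a left breaching point for `x`: it maximizes `JL` over the visible perimeter points,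
for defender positions that are not visible from `x`. -/
def IsLeftBreachingPoint (x : Plane) (s : ℝ) : Prop :=
  s ∈ P.visible x ∧
    ∀ sD ∉ P.visible x, ∀ s' ∈ P.visible x, P.JL ν s' sD x ≤ P.JL ν s sD x

/-- `s` is a right breaching point for `x`. -/
def IsRightBreachingPoint (x : Plane) (s : ℝ) : Prop :=
  s ∈ P.visible x ∧
    ∀ sD ∉ P.visible x, ∀ s' ∈ P.visible x, P.JR ν s' sD x ≤ P.JR ν s sD x

/-- The left breaching point, as a number in `[0, L)`. -/
def sL (x : Plane) : ℝ :=
  Classical.epsilon fun s => s ∈ Ico 0 P.L ∧ P.IsLeftBreachingPoint ν x s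

/-- The right breaching point, as a number in `[0, L)`. -/
def sR (x : Plane) : ℝ :=
  Classical.epsilon fun s => s ∈ Ico 0 P.L ∧ P.IsRightBreachingPoint ν x s

/-- The critical value of `JL`. -/
def JLstar (sD : ℝ) (x : Plane) : ℝ := P.JL ν (P.sL ν x) sD x

/-- The critical value of `JR`. -/
def JRstar (sD : ℝ) (x : Plane) : ℝ := P.JR ν (P.sR ν x) sD x

/-- The afferent surface: the part of `{JLstar = JRstar}` that extends from the defender.
There the defender is on the segment from the right to the left breaching point. -/
def afferent (sD : ℝ) : Set Plane :=
  {x | x ∉ P.region ∧ sD ∈ P.segment (P.sR ν x) (P.sL ν x) ∧ P.JLstar ν sD x = P.JRstar ν sD x}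

/-- The dispersal surface: the part of `{JLstar = JRstar}` that extends from the point opposite
to the defender. There the defender is off the segment from the right to the left breaching
point. -/
def dispersal (sD : ℝ) : Set Plane :=
  {x | x ∉ P.region ∧ sD ∉ P.segment (P.sR ν x) (P.sL ν x) ∧ P.JLstar ν sD x = P.JRstar ν sD x}

/-- The left region: the side of the two singular surfaces that is to the left of the
defender. When the defender is between the breaching points, `JLstar - JRstar` is positive to
the left of the afferent surface; otherwise it is negative to the left of the dispersal
surface. -/
def leftRegion (sD : ℝ) : Set Plane :=
  {x | x ∉ P.region ∧
    ((sD ∈ P.segment (P.sR ν x) (P.sL ν x) ∧ P.JRstar ν sD x < P.JLstar ν sD x) ∨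
     (sD ∉ P.segment (P.sR ν x) (P.sL ν x) ∧ P.JLstar ν sD x < P.JRstar ν sD x))}

/-- The half of the perimeter to the left of the defender. -/
def leftHalf (sD : ℝ) : Set ℝ := P.segment sD (sD + P.L / 2)

/-- The half of the perimeter to the right of the defender. -/
def rightHalf (sD : ℝ) : Set ℝ := P.segment (sD + P.L / 2) sD

/-- The test for the left region through the position of the breaching points relative to the
two halves of the perimeter. -/
def LeftTest (sD : ℝ) (x : Plane) : Prop :=
  (P.sL ν x ∈ P.leftHalf sD ∧ P.sR ν x ∈ P.rightHalf sD ∧ P.JRstar ν sD x < P.JLstar ν sD x) ∨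
  (P.sL ν x ∈ P.leftHalf sD ∧ P.sR ν x ∉ P.rightHalf sD) ∨
  (P.sL ν x ∉ P.leftHalf sD ∧ P.sR ν x ∉ P.rightHalf sD ∧ P.JLstar ν sD x < P.JRstar ν sD x)

open Classical in
/-- The function whose zero level set is the barrier. -/
def V (sD : ℝ) (x : Plane) : ℝ :=
  if x ∈ P.leftRegion ν sD then P.JLstar ν sD x else P.JRstar ν sD x

open Classical in
/-- The intruder's feedback law: full speed straight to the left breaching point in the left
region, and straight to the right breaching point otherwise. -/
def uStar (sD : ℝ) (x : Plane) : Plane :=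
  if x ∈ P.leftRegion ν sD then (ν / ‖P.γ (P.sL ν x) - x‖) • (P.γ (P.sL ν x) - x)
  else (ν / ‖P.γ (P.sR ν x) - x‖) • (P.γ (P.sR ν x) - x)

open Classical in
/-- The defender's feedback law: counter-clockwise in the left region, clockwise otherwise. -/
def ωStar (sD : ℝ) (x : Plane) : ℝ := if x ∈ P.leftRegion ν sD then 1 else -1

/-- A feedback law for the intruder: a velocity of norm at most `ν`, for every state. -/
def IsIntruderLaw (U : ℝ → Plane → Plane) : Prop :=
  (∀ s x, ‖U s x‖ ≤ ν) ∧ ∀ s x, U (s + P.L) x = U s x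

/-- A feedback law for the defender: a signed speed of modulus at most 1, for every state. -/
def IsDefenderLaw (W : ℝ → Plane → ℝ) : Prop :=
  (∀ s x, |W s x| ≤ 1) ∧ ∀ s x, W (s + P.L) x = W s x

/-- The intruder has scored along the motion `(s, x)` of the two players: it reaches the target
at some time, and it has not been captured until then. -/
def Scores (s : ℝ → ℝ) (x : ℝ → Plane) : Prop :=
  ∃ t, 0 ≤ t ∧ x t ∈ P.region ∧ ∀ r ∈ Icc 0 t, x r ≠ P.γ (s r)

end Target

/-- The motions that a player of maximal speed `c` can produce: `‖y'‖ ≤ c` almost everywhere,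
i.e. `y` is Lipschitz with constant `c`. -/
def SpeedLE {F : Type*} [NormedAddCommGroup F] (c : ℝ) (y : ℝ → F) : Prop :=
  ∀ ⦃t⦄, 0 ≤ t → ∀ ⦃t'⦄, 0 ≤ t' → ‖y t' - y t‖ ≤ c * |t' - t|

/-- Sampling times, starting at 0, with steps of length at most `δ`. -/
def IsSampling (δ : ℝ) (τ : ℕ → ℝ) : Prop :=
  τ 0 = 0 ∧ (∀ i, τ i < τ (i + 1) ∧ τ (i + 1) ≤ τ i + δ) ∧ Tendsto τ atTop atTop

/-- A step-by-step motion of an intruder with feedback law `U`: between sampling times it keeps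
the velocity which `U` gives at the last sampling time. The defender's motion `s` is arbitrary
(subject to its speed limit). -/
def IsIntruderStepMotion (U : ℝ → Plane → Plane) (τ : ℕ → ℝ) (s : ℝ → ℝ) (x : ℝ → Plane) :
    Prop :=
  SpeedLE 1 s ∧
    ∀ i, ∀ t ∈ Icc (τ i) (τ (i + 1)), x t = x (τ i) + (t - τ i) • U (s (τ i)) (x (τ i))

/-- A step-by-step motion of a defender with feedback law `W`, against an arbitrary motion `x`
of an intruder of maximal speed `ν`. -/
def IsDefenderStepMotion (ν : ℝ) (W : ℝ → Plane → ℝ) (τ : ℕ → ℝ) (s : ℝ → ℝ) (x : ℝ → Plane) :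
    Prop :=
  SpeedLE ν x ∧
    ∀ i, ∀ t ∈ Icc (τ i) (τ (i + 1)), s t = s (τ i) + (t - τ i) * W (s (τ i)) (x (τ i))

/-- `(s, x)` is a limit of motions `(s n, x n)` from the same initial state which are
step-by-step motions in the sense of `Step`, with steps of length tending to 0. -/
def IsLimitMotion (Step : (ℕ → ℝ) → (ℝ → ℝ) → (ℝ → Plane) → Prop) (s₀ : ℝ) (x₀ : Plane)
    (s : ℝ → ℝ) (x : ℝ → Plane) : Prop :=
  ∃ (δ : ℕ → ℝ) (τ : ℕ → ℕ → ℝ) (sn : ℕ → ℝ → ℝ) (xn : ℕ → ℝ → Plane),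
    Tendsto δ atTop (𝓝 0) ∧
    (∀ n, IsSampling (δ n) (τ n) ∧ Step (τ n) (sn n) (xn n) ∧ sn n 0 = s₀ ∧ xn n 0 = x₀) ∧
    TendstoLocallyUniformlyOn sn s atTop (Ici 0) ∧
    TendstoLocallyUniformlyOn xn x atTop (Ici 0)

/-- The motions that can occur when the intruder uses the (possibly discontinuous) feedback law
`U` and the defender moves in any admissible way. -/
def IsIntruderMotion (U : ℝ → Plane → Plane) (s₀ : ℝ) (x₀ : Plane)
    (s : ℝ → ℝ) (x : ℝ → Plane) : Prop :=
  IsLimitMotion (IsIntruderStepMotion U) s₀ x₀ s x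

/-- The motions that can occur when the defender uses the (possibly discontinuous) feedback law
`W` and the intruder moves in any admissible way. -/
def IsDefenderMotion (ν : ℝ) (W : ℝ → Plane → ℝ) (s₀ : ℝ) (x₀ : Plane)
    (s : ℝ → ℝ) (x : ℝ → Plane) : Prop :=
  IsLimitMotion (IsDefenderStepMotion ν W) s₀ x₀ s x

namespace Target

variable (P : Target) (ν : ℝ)

/-- The initial states, with the intruder outside the target, from which some feedback law of
the intruder makes it score, whatever the defender does. -/
def intruderWinning : Set (ℝ × Plane) :=
  {z | z.2 ∉ P.region ∧ ∃ U, P.IsIntruderLaw ν U ∧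
    ∀ s x, IsIntruderMotion U z.1 z.2 s x → P.Scores s x}

/-- The initial states, with the intruder outside the target, from which some feedback law of
the defender keeps the intruder from scoring forever, whatever the intruder does. -/
def defenderWinning : Set (ℝ × Plane) :=
  {z | z.2 ∉ P.region ∧ ∃ W, P.IsDefenderLaw W ∧
    ∀ s x, IsDefenderMotion ν W z.1 z.2 s x → ¬ P.Scores s x}

/-- The barrier of the game of kind: the surface in the state space that separates the two
winning regions, i.e. the states in the closure of both. -/
def barrier : Set (ℝ × Plane) :=
  {z | z.2 ∉ P.region ∧ z ∈ closure (P.intruderWinning ν) ∧ z ∈ closure (P.defenderWinning ν)}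

end Target

end PerimeterDefense

end

open Set Filter Topology

namespace PerimeterDefense

open scoped RealInnerProductSpace NNReal ENNReal
open MeasureTheory

/-! ### Planar algebra -/

/-! Lift the part of the perimeter visible from the intruder to an interval of `ℝ`. Let `lo` be the
maximum of `s - ‖γ s - x‖ / ν` over it, attained at the left breaching point, and `hi` the minimum
of `s + ‖γ s - x‖ / ν`, attained at the right one. A defender at the lifted position `D` is in time
for every visible point, on either side, exactly when `lo ≤ D ≤ hi`. With `mid` and `rad` the
midpoint and half-length of this interval, `V` is the perimeter distance from the defender to `mid`,
minus `rad` (`V_eq`). The left region is where `mid` lies ahead counter-clockwise by less than half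
the perimeter (`mem_leftRegion_iff`); the afferent surface is where the defender is at `mid`
(`mem_afferent_iff`). All positions count modulo `L`, whence the integer shifts throughout.

The geometric core is that `lo` and `hi` change by at most `‖x - y‖ / ν` when the intruder moves
from `x` to `y` along a segment off the target (`exists_abs_sub_le`), that is, no faster than the
defender runs. If the breaching point for `y` is also visible from `x`, this is the triangle
inequality. Otherwise it lies beyond an end of the arc visible from `x`, and by convexity the way
around that end is no longer than the way through `y` (`VisArc.add_sub_le_of_right`). Such length
comparisons rest on the fact that the chords of a visible arc turn monotonically relative to the
line of sight (`VisArc.inner_mul_norm_le`).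

An intruder heading for the left breaching point moves `lo` away from the defender at full speed, so
`V` does not drop (`intruder_step`); its distance to the target decreases linearly if `ν < 1` and at
least exponentially if `ν ≤ 1`. A capture on arrival would force `V` to be small just before, which
is impossible if `V > 0` initially. A defender heading for `mid` keeps `V ≤ 0` (`V_defender_step`),
which puts it at the point where the intruder arrives. If `ν < 1`, it also reaches `mid` in bounded
time: the midpoint for speed ratio 1 stays within `L` of `mid` and moves only at speed `ν`
(`Approaching.step`). These estimates hold for sampled motions up to errors that do not accumulate,
and pass to the limit.

For `ν = 1` the intruder wins by using the law of a slightly smaller ratio, since `V` depends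
continuously on it (`abs_V_sub_V_one_le`). The winning regions are disjoint because the two laws can
be played against each other, by Arzelà–Ascoli (`exists_joint_motion`). Continuity of `V` and small
perturbations of states with `V = 0` identify the barrier. -/

lemma inner_eq (v w : Plane) : ⟪v, w⟫ = v 0 * w 0 + v 1 * w 1 := by
  simp [PiLp.inner_apply, Fin.sum_univ_two, mul_comm]

lemma norm_sq_eq (v : Plane) : ‖v‖ ^ 2 = v 0 ^ 2 + v 1 ^ 2 := by
  rw [← real_inner_self_eq_norm_sq, inner_eq]; ring

lemma cross_self (v : Plane) : cross v v = 0 := by simp only [cross]; ring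

lemma cross_swap (v w : Plane) : cross v w = -cross w v := by simp only [cross]; ring

lemma cross_add_right (v w z : Plane) : cross v (w + z) = cross v w + cross v z := by
  simp only [cross, PiLp.add_apply]; ring

lemma cross_sub_right (v w z : Plane) : cross v (w - z) = cross v w - cross v z := by
  simp only [cross, PiLp.sub_apply]; ring

lemma cross_sub_left (v w z : Plane) : cross (v - w) z = cross v z - cross w z := by
  simp only [cross, PiLp.sub_apply]; ring

lemma cross_smul_right (c : ℝ) (v w : Plane) : cross v (c • w) = c * cross v w := by
  simp only [cross, PiLp.smul_apply, smul_eq_mul]; ring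

lemma cross_smul_left (c : ℝ) (v w : Plane) : cross (c • v) w = c * cross v w := by
  simp only [cross, PiLp.smul_apply, smul_eq_mul]; ring

lemma cross_neg_right (v w : Plane) : cross v (-w) = -cross v w := by
  simp only [cross, PiLp.neg_apply]; ring

lemma cross_neg_left (v w : Plane) : cross (-v) w = -cross v w := by
  simp only [cross, PiLp.neg_apply]; ring

lemma inner_sq_add_cross_sq (v w : Plane) :
    ⟪v, w⟫ ^ 2 + cross v w ^ 2 = (‖v‖ * ‖w‖) ^ 2 := by
  rw [mul_pow, norm_sq_eq, norm_sq_eq, inner_eq, cross]; ring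

lemma abs_cross_le (v w : Plane) : |cross v w| ≤ ‖v‖ * ‖w‖ := by
  apply abs_le_of_sq_le_sq _ (by positivity)
  nlinarith [inner_sq_add_cross_sq v w, sq_nonneg ⟪v, w⟫]

/-- The linear functional `cross v`. -/
noncomputable def crossL (v : Plane) : Plane →L[ℝ] ℝ :=
  LinearMap.toContinuousLinearMap
    { toFun := cross v
      map_add' := cross_add_right v
      map_smul' := fun c w => cross_smul_right c v w }

lemma continuous_cross_right (v : Plane) : Continuous (cross v) := (crossL v).continuous

/-- If `w` lies between `v` and `u` (counter-clockwise), then `w` is closer to `u` than `v`. -/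
lemma norm_mul_inner_le_of_cross_nonneg {v w u : Plane} (hvw : 0 ≤ cross v w)
    (hwu : 0 ≤ cross w u) (hvu : 0 ≤ cross v u) (h : cross v w = 0 → 0 ≤ ⟪v, w⟫) :
    ‖w‖ * ⟪u, v⟫ ≤ ‖v‖ * ⟪u, w⟫ := by
  rcases eq_or_ne v 0 with rfl | hv
  · simp
  have ha : 0 < ‖v‖ := norm_pos_iff.2 hv
  have hb : 0 ≤ ‖w‖ := norm_nonneg w
  have h1 : ‖v‖ ^ 2 * ⟪u, w⟫ = ⟪v, w⟫ * ⟪u, v⟫ + cross v w * cross v u := by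
    simp only [norm_sq_eq, inner_eq, cross]; ring
  have h2 : ‖v‖ ^ 2 * cross w u = ⟪v, w⟫ * cross v u - cross v w * ⟪u, v⟫ := by
    simp only [norm_sq_eq, inner_eq, cross]; ring
  have h3 := inner_sq_add_cross_sq v w
  have hab : 0 ≤ ‖v‖ * ‖w‖ := by positivity
  have hc : ⟪v, w⟫ ≤ ‖v‖ * ‖w‖ := real_inner_le_norm v w
  have h2' : cross v w * ⟪u, v⟫ ≤ ⟪v, w⟫ * cross v u := by
    have : 0 ≤ ‖v‖ ^ 2 * cross w u := by positivity
    linarith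
  generalize ⟪v, w⟫ = c at *
  generalize ⟪u, v⟫ = u1 at *
  generalize cross v u = u2 at *
  generalize cross v w = s at *
  suffices hs : ‖v‖ * ‖w‖ * u1 ≤ c * u1 + s * u2 by
    have : ‖v‖ * (‖w‖ * u1) ≤ ‖v‖ * (‖v‖ * ⟪u, w⟫) := by nlinarith
    exact le_of_mul_le_mul_left this ha
  rcases hvw.eq_or_lt with h0 | h0
  · have hc0 := h h0.symm
    have : c = ‖v‖ * ‖w‖ := by
      have : c ^ 2 = (‖v‖ * ‖w‖) ^ 2 := by rw [← h3, ← h0]; ring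
      exact (pow_left_inj₀ hc0 hab two_ne_zero).1 this
    rw [← h0, this]; simp
  · rcases le_or_gt u1 0 with h4 | h4
    · have := mul_nonneg h0.le hvu
      nlinarith
    · have h5 : 0 < c * u2 := lt_of_lt_of_le (mul_pos h0 h4) h2'
      have h6 : 0 < c := by
        rcases lt_or_ge 0 c with h | h
        · exact h
        · exact absurd h5 (not_lt.2 (mul_nonpos_of_nonpos_of_nonneg h hvu))
      refine le_of_mul_le_mul_left ?_ h6
      have h7 : c * (c * u1 + s * u2) = (‖v‖ * ‖w‖) ^ 2 * u1 + s * (c * u2 - s * u1) := by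
        rw [← h3]; ring
      rw [h7]
      have h8 : 0 ≤ s * (c * u2 - s * u1) := mul_nonneg h0.le (by linarith)
      have h9 : c * (‖v‖ * ‖w‖ * u1) ≤ (‖v‖ * ‖w‖) ^ 2 * u1 := by
        have := mul_le_mul_of_nonneg_right hc (mul_nonneg hab h4.le)
        nlinarith
      linarith

/-! ### Lipschitz functions of one variable -/

/-- A Lipschitz function whose derivative is at least `c` almost everywhere grows at least at
rate `c`. -/
lemma mul_sub_le_of_ae_le_deriv {f : ℝ → ℝ} {K : ℝ≥0} (hf : LipschitzWith K f) {c s t : ℝ}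
    (hst : s ≤ t) (h : ∀ᵐ r, r ∈ Ioo s t → c ≤ deriv f r) : c * (t - s) ≤ f t - f s := by
  have hac : AbsolutelyContinuousOnInterval f s t :=
    (hf.lipschitzOnWith (s := uIcc s t)).absolutelyContinuousOnInterval
  rw [← hac.integral_deriv_eq_sub]
  have h1 : ∫ _ in s..t, c = c * (t - s) := by simp [mul_comm]
  rw [← h1]
  rw [intervalIntegral.integral_of_le hst, intervalIntegral.integral_of_le hst,
    integral_Ioc_eq_integral_Ioo, integral_Ioc_eq_integral_Ioo]
  refine setIntegral_mono_ae_restrict (by simp) ?_ ?_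
  · exact (hac.intervalIntegrable_deriv.1).mono_set Ioo_subset_Ioc_self
  · exact (ae_restrict_iff' measurableSet_Ioo).2 h

/-! ### The perimeter as a Lipschitz curve and its regular points. -/

namespace Target

variable (P : Target)

lemma lipschitz : LipschitzWith 1 P.γ := by
  have key : ∀ s t, s ≤ t → edist (P.γ s) (P.γ t) ≤ ENNReal.ofReal (t - s) := by
    intro s t hst
    have h := P.unitSpeed (mem_univ s) (mem_univ t)
    rw [NNReal.coe_one, one_mul] at h
    rw [← h]
    exact eVariationOn.edist_le _ ⟨mem_univ _, le_rfl, hst⟩ ⟨mem_univ _, hst, le_rfl⟩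
  refine LipschitzWith.of_dist_le_mul fun s t => ?_
  rw [NNReal.coe_one, one_mul]
  have key' : ∀ s t, s ≤ t → dist (P.γ s) (P.γ t) ≤ t - s := by
    intro s t hst
    have := key s t hst
    rwa [edist_dist, ENNReal.ofReal_le_ofReal_iff (by linarith)] at this
  rcases le_total s t with h | h
  · rw [Real.dist_eq, abs_sub_comm, abs_of_nonneg (by linarith)]
    exact key' s t h
  · rw [Real.dist_eq, dist_comm, abs_of_nonneg (by linarith)]
    exact key' t s h

lemma continuous_γ : Continuous P.γ := P.lipschitz.continuous

lemma norm_γ_sub_le (s t : ℝ) : ‖P.γ s - P.γ t‖ ≤ |s - t| := by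
  simpa [dist_eq_norm] using P.lipschitz.dist_le_mul s t

lemma γ_add_zsmul (s : ℝ) (k : ℤ) : P.γ (s + k * P.L) = P.γ s := by
  simpa using P.periodic.int_mul k s

lemma γ_eq_iff {s t : ℝ} : P.γ s = P.γ t ↔ ∃ k : ℤ, t = s + k * P.L := by
  constructor
  · intro h
    have h1 : ∀ r, P.γ (toIcoMod P.L_pos 0 r) = P.γ r := by
      intro r
      rw [toIcoMod, zsmul_eq_mul]
      exact P.periodic.sub_int_mul_eq _
    have h2 : toIcoMod P.L_pos 0 s = toIcoMod P.L_pos 0 t := by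
      refine P.injOn ?_ ?_ (by rw [h1, h1, h])
      · simpa using toIcoMod_mem_Ico P.L_pos 0 s
      · simpa using toIcoMod_mem_Ico P.L_pos 0 t
    rw [toIcoMod, toIcoMod, zsmul_eq_mul, zsmul_eq_mul] at h2
    refine ⟨toIcoDiv P.L_pos 0 t - toIcoDiv P.L_pos 0 s, ?_⟩
    push_cast
    linarith
  · rintro ⟨k, rfl⟩
    rw [P.γ_add_zsmul]

lemma γ_inj {s t : ℝ} (h : P.γ s = P.γ t) (hst : |s - t| < P.L) : s = t := by
  obtain ⟨k, rfl⟩ := P.γ_eq_iff.1 h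
  have hL := P.L_pos
  have : |(k : ℝ)| * P.L < 1 * P.L := by
    rw [one_mul]
    calc |(k : ℝ)| * P.L = |s - (s + k * P.L)| := by
          rw [sub_add_cancel_left, abs_neg, abs_mul, abs_of_pos hL]
      _ < P.L := hst
  have h1 : |(k : ℝ)| < 1 := lt_of_mul_lt_mul_right this hL.le
  have h2 : |k| < 1 := by exact_mod_cast h1
  have : k = 0 := Int.abs_lt_one_iff.1 h2
  simp [this]

lemma γ_mem_frontier (s : ℝ) : P.γ s ∈ frontier P.region := P.range_eq ▸ mem_range_self s

lemma γ_mem (s : ℝ) : P.γ s ∈ P.region :=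
  P.isCompact_region.isClosed.frontier_subset (P.γ_mem_frontier s)

lemma γ_notMem_interior (s : ℝ) : P.γ s ∉ interior P.region :=
  (P.γ_mem_frontier s).2

lemma exists_γ_eq {p : Plane} (hp : p ∈ P.region) (hi : p ∉ interior P.region) :
    ∃ s, P.γ s = p := by
  have : p ∈ range P.γ := by
    rw [P.range_eq]
    exact ⟨subset_closure hp, hi⟩
  exact this

/-- `s` is a regular point of the perimeter, with unit tangent vector `v`. -/
def Regular (s : ℝ) (v : Plane) : Prop := HasDerivAt P.γ v s ∧ ‖v‖ = 1

lemma ae_differentiableAt : ∀ᵐ s, DifferentiableAt ℝ P.γ s :=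
  P.lipschitz.ae_differentiableAt_real

lemma norm_deriv_le (s : ℝ) : ‖deriv P.γ s‖ ≤ 1 := by
  simpa using norm_deriv_le_of_lipschitz P.lipschitz (x₀ := s)

lemma lipschitz_inner (e : Plane) : LipschitzWith ‖e‖₊ fun s => ⟪e, P.γ s⟫ := by
  refine LipschitzWith.of_dist_le_mul fun s t => ?_
  rw [Real.dist_eq, ← inner_sub_right]
  refine (abs_real_inner_le_norm _ _).trans ?_
  rw [coe_nnnorm, Real.dist_eq]
  exact mul_le_mul_of_nonneg_left (P.norm_γ_sub_le s t) (norm_nonneg e)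

lemma hasDerivAt_inner (e : Plane) {s : ℝ} {v : Plane} (h : HasDerivAt P.γ v s) :
    HasDerivAt (fun r => ⟪e, P.γ r⟫) ⟪e, v⟫ s := by
  simpa using (hasDerivAt_const s e).inner ℝ h

/-- The length of an arc is at most the integral of `‖γ'‖`, which is at most the length of the
parameter interval because `‖γ'‖ ≤ 1`. Unit speed makes all three equal, which forces `‖γ'‖ = 1`
almost everywhere. -/
lemma ae_regular : ∀ᵐ s, ∃ v, P.Regular s v := by
  have hm : Measurable fun s => ‖deriv P.γ s‖ := (measurable_deriv P.γ).norm
  have hint : ∀ s t, IntervalIntegrable (fun r => ‖deriv P.γ r‖) volume s t := by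
    intro s t
    refine (intervalIntegrable_const (c := (1 : ℝ))).mono_fun hm.aestronglyMeasurable ?_
    exact Eventually.of_forall fun r => by simpa using P.norm_deriv_le r
  have h1 : ∀ s t, s ≤ t → ‖P.γ t - P.γ s‖ ≤ ∫ r in s..t, ‖deriv P.γ r‖ := by
    intro s t hst
    rcases eq_or_ne (P.γ t - P.γ s) 0 with h0 | h0
    · rw [h0, norm_zero]
      exact intervalIntegral.integral_nonneg hst fun _ _ => norm_nonneg _
    -- Projecting onto the direction of the chord reduces the bound to the scalar fundamental
    -- theorem of calculus.
    set e := ‖P.γ t - P.γ s‖⁻¹ • (P.γ t - P.γ s) with he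
    have hne : ‖P.γ t - P.γ s‖ ≠ 0 := norm_ne_zero_iff.2 h0
    have hen : ‖e‖ = 1 := by rw [he, norm_smul, norm_inv, norm_norm, inv_mul_cancel₀ hne]
    have hac : AbsolutelyContinuousOnInterval (fun r => ⟪e, P.γ r⟫) s t :=
      ((P.lipschitz_inner e).lipschitzOnWith (s := uIcc s t)).absolutelyContinuousOnInterval
    have h2 := hac.integral_deriv_eq_sub
    rw [← inner_sub_right, he, real_inner_smul_left, real_inner_self_eq_norm_sq, pow_two,
      ← mul_assoc, inv_mul_cancel₀ hne, one_mul, ← he] at h2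
    rw [← h2]
    refine intervalIntegral.integral_mono_ae hst hac.intervalIntegrable_deriv (hint s t) ?_
    filter_upwards [P.ae_differentiableAt] with r hr
    rw [(P.hasDerivAt_inner e hr.hasDerivAt).deriv]
    simpa [hen] using real_inner_le_norm e (deriv P.γ r)
  have h2 : ∀ s t, s ≤ t → t - s ≤ ∫ r in s..t, ‖deriv P.γ r‖ := by
    intro s t hst
    have h := P.unitSpeed (mem_univ s) (mem_univ t)
    rw [NNReal.coe_one, one_mul] at h
    have h0 : 0 ≤ ∫ r in s..t, ‖deriv P.γ r‖ :=
      intervalIntegral.integral_nonneg hst fun _ _ => norm_nonneg _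
    rw [← ENNReal.ofReal_le_ofReal_iff h0, ← h]
    refine iSup_le fun ⟨n, u, hu, hus⟩ => ?_
    have h3 : ∀ n, ∑ i ∈ Finset.range n, edist (P.γ (u (i + 1))) (P.γ (u i)) ≤
        ENNReal.ofReal (∫ r in u 0..u n, ‖deriv P.γ r‖) := by
      intro n
      induction n with
      | zero => simp
      | succ n ih =>
        rw [Finset.sum_range_succ, ← intervalIntegral.integral_add_adjacent_intervals
          (hint (u 0) (u n)) (hint (u n) (u (n + 1))), ENNReal.ofReal_add]
        · refine add_le_add ih ?_
          rw [edist_dist, dist_eq_norm]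
          exact ENNReal.ofReal_le_ofReal (h1 _ _ (hu n.le_succ))
        · exact intervalIntegral.integral_nonneg (hu n.zero_le) fun _ _ => norm_nonneg _
        · exact intervalIntegral.integral_nonneg (hu n.le_succ) fun _ _ => norm_nonneg _
    refine (h3 n).trans (ENNReal.ofReal_le_ofReal ?_)
    refine intervalIntegral.integral_mono_interval (hus 0).2.1 (hu n.zero_le) (hus n).2.2 ?_
      (hint s t)
    exact Eventually.of_forall fun _ => norm_nonneg _
  have h4 : ∀ n : ℕ, ∀ᵐ s, s ∈ Ioc (-(n : ℝ)) n → ‖deriv P.γ s‖ = 1 := by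
    intro n
    have hn : -(n : ℝ) ≤ n := by linarith [n.cast_nonneg (α := ℝ)]
    have h5 : ∫ r in (-(n : ℝ))..n, (1 - ‖deriv P.γ r‖) = 0 := by
      refine le_antisymm ?_ ?_
      · rw [intervalIntegral.integral_sub (by simp) (hint _ _)]
        have := h2 (-(n : ℝ)) n hn
        simp only [intervalIntegral.integral_const, smul_eq_mul, mul_one]
        linarith
      · exact intervalIntegral.integral_nonneg hn fun r _ => sub_nonneg.2 (P.norm_deriv_le r)
    rw [intervalIntegral.integral_of_le hn, setIntegral_eq_zero_iff_of_nonneg_ae] at h5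
    · rw [EventuallyEq, ae_restrict_iff' measurableSet_Ioc] at h5
      filter_upwards [h5] with s hs hsn
      have := hs hsn
      simp only [Pi.zero_apply] at this
      linarith
    · exact Eventually.of_forall fun r => sub_nonneg.2 (P.norm_deriv_le r)
    · exact ((intervalIntegrable_const (c := (1 : ℝ))).sub (hint _ _)).1
  filter_upwards [ae_all_iff.2 h4, P.ae_differentiableAt] with s hs hd
  obtain ⟨n, hn⟩ := exists_nat_gt |s|
  have := abs_lt.1 hn
  exact ⟨deriv P.γ s, hd.hasDerivAt, hs n ⟨this.1, this.2.le⟩⟩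

lemma exists_regular {s t : ℝ} (hst : s < t) : ∃ r ∈ Ioo s t, ∃ v, P.Regular r v := by
  have h : (volume.restrict (Ioo s t)) ≠ 0 := by
    rw [Ne, Measure.restrict_eq_zero, Real.volume_Ioo]
    simp [hst]
  have : NeZero (volume.restrict (Ioo s t)) := ⟨h⟩
  have h1 : ∀ᵐ r ∂(volume.restrict (Ioo s t)), r ∈ Ioo s t ∧ ∃ v, P.Regular r v := by
    filter_upwards [ae_restrict_of_ae P.ae_regular, ae_restrict_mem measurableSet_Ioo]
      with r h1 h2 using ⟨h2, h1⟩
  obtain ⟨r, h2, h3⟩ := h1.exists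
  exact ⟨r, h2, h3⟩

variable {P}

/-- Moving `z` by nearly `ε` to the right of the tangent stays within the ball, and the point so
obtained is still not to the right of the tangent line. -/
lemma Regular.le_cross_of_ball {s : ℝ} {v : Plane} (h : P.Regular s v) {z : Plane} {ε : ℝ}
    (hε : 0 < ε) (hb : Metric.ball z ε ⊆ P.region) : ε ≤ cross v (z - P.γ s) := by
  refine le_of_forall_lt_imp_le_of_dense fun η hη => ?_
  rcases le_or_gt η 0 with h0 | h0
  · exact h0.trans (P.ccw s v h.1 z (hb (Metric.mem_ball_self hε)))
  have hn : v 0 ^ 2 + v 1 ^ 2 = 1 := by rw [← norm_sq_eq, h.2, one_pow]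
  set J : Plane := !₂[-(v 1), v 0] with hJ
  have hJn : ‖J‖ = 1 := by
    have : ‖J‖ ^ 2 = 1 := by rw [norm_sq_eq, hJ]; simp; linarith
    rwa [pow_eq_one_iff_of_nonneg (norm_nonneg _) two_ne_zero] at this
  have h1 : z - η • J ∈ P.region := hb (by
    rw [Metric.mem_ball, dist_eq_norm, sub_sub_cancel_left, norm_neg, norm_smul, hJn, mul_one,
      Real.norm_of_nonneg h0.le]
    exact hη)
  have h2 := P.ccw s v h.1 _ h1
  have h3 : cross v (z - η • J - P.γ s) = cross v (z - P.γ s) - η := by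
    simp only [cross, hJ, PiLp.sub_apply, PiLp.smul_apply, smul_eq_mul]
    simp
    linear_combination (-η) * hn
  linarith

lemma Regular.cross_pos {s : ℝ} {v : Plane} (h : P.Regular s v) {w : Plane}
    (hw : w ∈ interior P.region) : 0 < cross v (w - P.γ s) := by
  obtain ⟨ε, hε, hb⟩ := Metric.isOpen_iff.1 isOpen_interior w hw
  exact hε.trans_le (h.le_cross_of_ball hε (hb.trans interior_subset))

end Target

/-! ### Reflection -/

/-- The reflection of the plane across the first axis. -/
noncomputable def mirror : Plane ≃ₗᵢ[ℝ] Plane where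
  toLinearEquiv := LinearEquiv.ofInvolutive
    { toFun := fun p => !₂[p 0, -p 1]
      map_add' := fun p q => by
        ext i; fin_cases i
        · simp
        · simp [add_comm]
      map_smul' := fun c p => by ext i; fin_cases i <;> simp }
    (fun p => by ext i; fin_cases i <;> simp)
  norm_map' := fun p => by
    have : ‖(!₂[p 0, -p 1] : Plane)‖ ^ 2 = ‖p‖ ^ 2 := by simp [norm_sq_eq]
    exact (pow_left_inj₀ (norm_nonneg _) (norm_nonneg _) two_ne_zero).1 this

@[simp] lemma mirror_zero (p : Plane) : mirror p 0 = p 0 := rfl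

@[simp] lemma mirror_one (p : Plane) : mirror p 1 = -p 1 := rfl

@[simp] lemma mirror_mirror (p : Plane) : mirror (mirror p) = p := by
  ext i; fin_cases i <;> simp

lemma cross_mirror (v w : Plane) : cross (mirror v) (mirror w) = -cross v w := by
  simp only [cross, mirror_zero, mirror_one]; ring

lemma hasDerivWithinAt_mirror {f : ℝ → Plane} {v : Plane} {S : Set ℝ} {s : ℝ}
    (h : HasDerivWithinAt f v S s) :
    HasDerivWithinAt (fun r => mirror (f (-r))) (-mirror v) (-S) (-s) := by
  have h0 : HasDerivWithinAt f v S (-(-s)) := by rwa [neg_neg]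
  have h1 : HasDerivWithinAt (f ∘ Neg.neg) ((-1 : ℝ) • v) (-S) (-s) :=
    HasDerivWithinAt.scomp (-s) h0 (hasDerivAt_neg (-s)).hasDerivWithinAt fun r hr => hr
  have h2 : HasDerivWithinAt (mirror ∘ (f ∘ Neg.neg)) (mirror ((-1 : ℝ) • v)) (-S) (-s) :=
    mirror.toContinuousLinearEquiv.toContinuousLinearMap.hasFDerivAt.comp_hasDerivWithinAt (-s) h1
  rw [neg_one_smul, map_neg] at h2
  exact h2

lemma hasDerivAt_mirror {f : ℝ → Plane} {v : Plane} {s : ℝ} (h : HasDerivAt f v s) :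
    HasDerivAt (fun r => mirror (f (-r))) (-mirror v) (-s) := by
  rw [← hasDerivWithinAt_univ] at h ⊢
  simpa using hasDerivWithinAt_mirror h

namespace Target

variable (P : Target)

/-- The reflected target, with the perimeter traversed in the opposite direction. -/
noncomputable def reflect : Target where
  region := mirror ⁻¹' P.region
  γ := fun s => mirror (P.γ (-s))
  L := P.L
  convex_region := P.convex_region.linear_preimage mirror.toLinearEquiv.toLinearMap
  isCompact_region := mirror.toHomeomorph.isCompact_preimage.2 P.isCompact_region
  interior_nonempty := by
    obtain ⟨p, hp⟩ := P.interior_nonempty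
    refine ⟨mirror p, ?_⟩
    rw [show (mirror ⁻¹' P.region) = mirror.toHomeomorph ⁻¹' P.region from rfl,
      ← mirror.toHomeomorph.preimage_interior]
    simpa using hp
  L_pos := P.L_pos
  periodic := fun s => by
    have := P.periodic (-s - P.L)
    simp only [sub_add_cancel] at this
    simp only [neg_add', ← this]
  injOn := fun s hs t ht h => by
    have h1 := P.γ_inj (mirror.injective h) (by
      rw [abs_lt]; constructor <;> linarith [hs.1, hs.2, ht.1, ht.2])
    exact neg_injective h1
  range_eq := by
    rw [show (mirror ⁻¹' P.region) = mirror.toHomeomorph ⁻¹' P.region from rfl,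
      ← mirror.toHomeomorph.preimage_frontier, ← P.range_eq]
    ext p
    constructor
    · rintro ⟨s, rfl⟩
      exact ⟨-s, by simp⟩
    · rintro ⟨s, hs⟩
      refine ⟨-s, ?_⟩
      have hs' : P.γ s = mirror p := hs
      simp [hs']
  unitSpeed := by
    intro s _ t _
    rw [univ_inter]
    have h1 : eVariationOn (fun s => mirror (P.γ (-s))) (Icc s t) =
        eVariationOn (P.γ ∘ fun s => -s) (Icc s t) := by
      unfold eVariationOn
      simp [mirror.isometry.edist_eq]
    have h2 := P.unitSpeed (mem_univ (-t)) (mem_univ (-s))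
    rw [univ_inter] at h2
    rw [h1, eVariationOn.comp_eq_of_antitoneOn _ _ (fun a _ b _ h => neg_le_neg h)]
    rw [show (fun s : ℝ => -s) '' Icc s t = Icc (-t) (-s) by simp, h2]
    congr 2; ring
  ccw := fun s v h p hp => by
    have h1 : HasDerivAt P.γ (-mirror v) (-s) := by
      simpa using hasDerivAt_mirror h
    have h2 := P.ccw _ _ h1 _ hp
    rw [cross_neg_left, ← cross_mirror] at h2
    simpa using h2

@[simp] lemma reflect_γ (s : ℝ) : P.reflect.γ s = mirror (P.γ (-s)) := rfl

@[simp] lemma reflect_L : P.reflect.L = P.L := rfl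

lemma mem_reflect_region {p : Plane} : p ∈ P.reflect.region ↔ mirror p ∈ P.region := Iff.rfl

lemma mem_interior_reflect_region {p : Plane} :
    p ∈ interior P.reflect.region ↔ mirror p ∈ interior P.region := by
  rw [show P.reflect.region = mirror.toHomeomorph ⁻¹' P.region from rfl,
      ← mirror.toHomeomorph.preimage_interior]
  rfl

variable {P}

lemma Regular.reflect {s : ℝ} {v : Plane} (h : P.Regular s v) :
    P.reflect.Regular (-s) (-mirror v) :=
  ⟨hasDerivAt_mirror h.1, by simpa using h.2⟩

variable (P)

lemma mem_visible_reflect {x : Plane} {s : ℝ} :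
    s ∈ P.reflect.visible (mirror x) ↔ -s ∈ P.visible x := by
  simp only [visible, mem_ofPred_eq, reflect_γ, mem_interior_reflect_region]
  have : openSegment ℝ (mirror x) (mirror (P.γ (-s))) = mirror '' openSegment ℝ x (P.γ (-s)) :=
    (image_openSegment ℝ mirror.toLinearEquiv.toLinearMap.toAffineMap x (P.γ (-s))).symm
  rw [this]
  simp

end Target

/-! ### The visible arc -/

/-- A continuous function that runs from its maximum to its minimum and takes intermediate values
only once is antitone. -/
lemma antitoneOn_of_intermediate_inj {K : ℝ → ℝ} {p q m M : ℝ} (hK : ContinuousOn K (Icc p q))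
    (hp : K p = M) (hr : ∀ s ∈ Icc p q, m ≤ K s ∧ K s ≤ M)
    (hinj : ∀ s ∈ Icc p q, ∀ t ∈ Icc p q, K s = K t → K s ∈ Ioo m M → s = t) :
    AntitoneOn K (Icc p q) := by
  intro s hs t ht hst
  by_contra! h
  -- If `K` rose from `s` to `t`, the level `c` would be taken both up to `s` and from `s` on;
  -- injectivity merges these points into `s` itself, where `K` is below `c`.
  obtain ⟨c, hc1, hc2⟩ := exists_between h
  have hcm : c ∈ Ioo m M := ⟨(hr s hs).1.trans_lt hc1, hc2.trans_le (hr t ht).2⟩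
  obtain ⟨u, hu, hu'⟩ := intermediate_value_Icc hst
    (hK.mono (Icc_subset_Icc hs.1 ht.2)) ⟨hc1.le, hc2.le⟩
  obtain ⟨w, hw, hw'⟩ := intermediate_value_Icc' hs.1
    (hK.mono (Icc_subset_Icc le_rfl hs.2)) ⟨hc1.le, by rw [hp]; exact hcm.2.le⟩
  have : u = w := hinj u ⟨hs.1.trans hu.1, hu.2.trans ht.2⟩ w ⟨hw.1, hw.2.trans hs.2⟩
    (by rw [hu', hw']) (by rwa [hu'])
  have h1 : u = s := le_antisymm (this ▸ hw.2) hu.1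
  rw [h1] at hu'
  linarith

lemma iff_of_not_iff {A B C : Prop} (h1 : ¬(A ↔ B)) (h2 : ¬(C ↔ A)) : C ↔ B := by tauto

namespace Target

variable (P : Target)

/-- The visible part of the perimeter from `x` is the arc from `a` to `b`. -/
structure VisArc (x : Plane) (a b : ℝ) : Prop where
  lt_add : b < a + P.L
  vis : ∀ s ∈ Icc a b, s ∈ P.visible x
  invis : ∀ s ∈ Ioo b (a + P.L), s ∉ P.visible x
  anti : ∀ s t, a ≤ s → s ≤ t → t ≤ b → cross (P.γ s - x) (P.γ t - x) ≤ 0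
  neg : cross (P.γ a - x) (P.γ b - x) < 0
  le : a ≤ b
  right : ∀ p ∈ P.region, 0 ≤ cross (P.γ b - x) (p - x)
  left : ∀ p ∈ P.region, cross (P.γ a - x) (p - x) ≤ 0
  right_pos : ∀ s ∈ Ioo b (a + P.L), 0 < cross (P.γ b - x) (P.γ s - x)
  left_neg : ∀ s ∈ Ioo b (a + P.L), cross (P.γ a - x) (P.γ s - x) < 0

variable {P}

lemma VisArc.lt {x : Plane} {a b : ℝ} (h : P.VisArc x a b) : a < b := by
  rcases h.le.eq_or_lt with h' | h'
  · have := h.neg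
    rw [h', cross_self] at this
    exact absurd this (lt_irrefl _)
  · exact h'

lemma visible_add_zsmul {x : Plane} {s : ℝ} (k : ℤ) :
    s + k * P.L ∈ P.visible x ↔ s ∈ P.visible x := by
  simp only [visible, mem_ofPred_eq, γ_add_zsmul]

lemma VisArc.shift {x : Plane} {a b : ℝ} (h : P.VisArc x a b) (k : ℤ) :
    P.VisArc x (a + k * P.L) (b + k * P.L) := by
  have key : ∀ s, P.γ s = P.γ (s - k * P.L) := fun s => by
    conv_lhs => rw [show s = (s - k * P.L) + k * P.L by ring, P.γ_add_zsmul]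
  have keyv : ∀ s, s ∈ P.visible x ↔ s - k * P.L ∈ P.visible x := fun s => by
    rw [← visible_add_zsmul (P := P) k (s := s - k * P.L), sub_add_cancel]
  constructor
  · linarith [h.lt_add]
  · intro s hs
    rw [keyv]
    exact h.vis _ ⟨by linarith [hs.1], by linarith [hs.2]⟩
  · intro s hs
    rw [keyv]
    exact h.invis _ ⟨by linarith [hs.1], by linarith [hs.2]⟩
  · intro s t h1 h2 h3
    rw [key s, key t]
    exact h.anti _ _ (by linarith) (by linarith) (by linarith)
  · rw [P.γ_add_zsmul, P.γ_add_zsmul]; exact h.neg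
  · linarith [h.le]
  · rw [P.γ_add_zsmul]; exact h.right
  · rw [P.γ_add_zsmul]; exact h.left
  · intro s hs
    rw [P.γ_add_zsmul, key s]
    exact h.right_pos _ ⟨by linarith [hs.1], by linarith [hs.2]⟩
  · intro s hs
    rw [P.γ_add_zsmul, key s]
    exact h.left_neg _ ⟨by linarith [hs.1], by linarith [hs.2]⟩

lemma VisArc.reflect {x : Plane} {a b : ℝ} (h : P.VisArc x a b) :
    P.reflect.VisArc (mirror x) (-b) (-a) := by
  have hP : ∀ s, -s + P.L = -(s - P.L) := fun s => by ring
  have hg : ∀ s, P.γ s = P.γ (s + P.L) := fun s => (P.periodic s).symm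
  have hv : ∀ s, s ∈ P.visible x ↔ s + P.L ∈ P.visible x := fun s => by
    simpa using (visible_add_zsmul (P := P) (x := x) (s := s) 1).symm
  constructor
  · rw [reflect_L]; linarith [h.lt_add]
  · intro s hs
    rw [mem_visible_reflect]
    exact h.vis _ ⟨by linarith [hs.2], by linarith [hs.1]⟩
  · intro s hs
    rw [mem_visible_reflect, hv]
    rw [reflect_L] at hs
    exact h.invis _ ⟨by linarith [hs.2], by linarith [hs.1]⟩
  · intro s t h1 h2 h3
    rw [reflect_γ, reflect_γ, ← map_sub, ← map_sub, cross_mirror, cross_swap, neg_neg]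
    exact h.anti _ _ (by linarith) (by linarith) (by linarith)
  · rw [reflect_γ, reflect_γ, ← map_sub, ← map_sub, cross_mirror, cross_swap, neg_neg, neg_neg,
      neg_neg]
    exact h.neg
  · linarith [h.le]
  · intro p hp
    have := h.left _ hp
    rw [← mirror_mirror p, reflect_γ, ← map_sub, ← map_sub, cross_mirror, neg_neg]
    linarith
  · intro p hp
    have := h.right _ hp
    rw [← mirror_mirror p, reflect_γ, ← map_sub, ← map_sub, cross_mirror, neg_neg]
    linarith
  · intro s hs
    rw [reflect_L] at hs
    have := h.left_neg (-s + P.L) ⟨by linarith [hs.2], by linarith [hs.1]⟩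
    rw [← hg] at this
    rw [reflect_γ, reflect_γ, ← map_sub, ← map_sub, cross_mirror, neg_neg]
    linarith
  · intro s hs
    rw [reflect_L] at hs
    have := h.right_pos (-s + P.L) ⟨by linarith [hs.2], by linarith [hs.1]⟩
    rw [← hg] at this
    rw [reflect_γ, reflect_γ, ← map_sub, ← map_sub, cross_mirror, neg_neg]
    linarith

lemma isOpen_compl_visible (x : Plane) : IsOpen (P.visible x)ᶜ := by
  rw [isOpen_iff_mem_nhds]
  intro s hs
  simp only [visible, mem_compl_iff, mem_ofPred_eq, not_forall, not_not] at hs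
  obtain ⟨p, ⟨α, β, hα, hβ, hαβ, rfl⟩, hp⟩ := hs
  have hc : Continuous fun t => α • x + β • P.γ t := by
    have := P.continuous_γ
    fun_prop
  filter_upwards [hc.continuousAt.preimage_mem_nhds (isOpen_interior.mem_nhds hp)] with t ht
  simp only [visible, mem_compl_iff, mem_ofPred_eq, not_forall, not_not]
  exact ⟨_, ⟨α, β, hα, hβ, hαβ, rfl⟩, ht⟩

lemma Regular.cross_pos_of_notMem_visible {s : ℝ} {v x : Plane} (h : P.Regular s v)
    (hs : s ∉ P.visible x) : 0 < cross v (x - P.γ s) := by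
  simp only [visible, mem_ofPred_eq, not_forall, not_not] at hs
  obtain ⟨p, ⟨α, β, hα, hβ, hαβ, rfl⟩, hp⟩ := hs
  have h1 := h.cross_pos hp
  have h2 : α • x + β • P.γ s - P.γ s = α • (x - P.γ s) := by
    rw [show β = 1 - α by linarith]; module
  rw [h2, cross_smul_right] at h1
  exact (mul_pos_iff_of_pos_left hα).1 h1

/-- At a point hidden behind the target the line of sight turns counter-clockwise as the point
advances, against its sense on the front. In `exists_visArc_of_inner_pos` this shows that the front
arc is visible. -/
lemma Regular.exists_cross_pos {τ c : ℝ} {v x : Plane} (h : P.Regular τ v)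
    (hτ : τ ∉ P.visible x) (hc : τ < c) :
    ∃ r ∈ Ioo τ c, 0 < cross (P.γ τ - x) (P.γ r - x) := by
  have hpos := h.cross_pos_of_notMem_visible hτ
  have hd : Tendsto (fun r => (r - τ)⁻¹ • (P.γ r - P.γ τ)) (𝓝[>] τ) (𝓝 v) :=
    (hasDerivAt_iff_tendsto_slope.1 h.1).mono_left
      (nhdsWithin_mono _ fun r hr => ne_of_gt hr)
  have hd2 := ((continuous_cross_right (P.γ τ - x)).tendsto v).comp hd
  have hlim : 0 < cross (P.γ τ - x) v := by
    rw [cross_swap, ← cross_neg_right, neg_sub]; exact hpos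
  have hmem : ∀ᶠ r in 𝓝[>] τ, r ∈ Ioo τ c := Ioo_mem_nhdsGT hc
  obtain ⟨r, hr1, hr2⟩ := ((hd2.eventually_const_lt hlim).and hmem).exists
  refine ⟨r, hr2, ?_⟩
  simp only [Function.comp, cross_smul_right] at hr1
  have h1 : 0 < cross (P.γ τ - x) (P.γ r - P.γ τ) :=
    (mul_pos_iff_of_pos_left (inv_pos.2 (by linarith [hr2.1]))).1 hr1
  have : P.γ r - x = (P.γ r - P.γ τ) + (P.γ τ - x) := by abel
  rw [this, cross_add_right, cross_self, add_zero]
  exact h1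

lemma closure_interior_region : closure (interior P.region) = P.region := by
  rw [P.convex_region.closure_interior_eq_closure_of_nonempty_interior P.interior_nonempty,
    P.isCompact_region.isClosed.closure_eq]

/-- The cotangent of the direction from `x` to `p`, relative to `e`. -/
noncomputable def _root_.PerimeterDefense.viewSlope (e x p : Plane) : ℝ := cross e (p - x) / ⟪e, p - x⟫

lemma _root_.PerimeterDefense.cross_eq_slope_sub {e x p q : Plane} (hp : 0 < ⟪e, p - x⟫)
    (hq : 0 < ⟪e, q - x⟫) : cross (p - x) (q - x) * ‖e‖ ^ 2 =
      ⟪e, p - x⟫ * ⟪e, q - x⟫ * (viewSlope e x q - viewSlope e x p) := by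
  have : cross (p - x) (q - x) * ‖e‖ ^ 2 =
      ⟪e, p - x⟫ * cross e (q - x) - cross e (p - x) * ⟪e, q - x⟫ := by
    simp only [norm_sq_eq, inner_eq, cross]; ring
  rw [this, viewSlope, viewSlope]
  field_simp

section slope

variable {e x : Plane} (he : ∀ p ∈ P.region, 0 < ⟪e, p - x⟫)

include he

lemma norm_pos_of_forall_inner_pos : 0 < ‖e‖ := by
  rw [norm_pos_iff]
  rintro rfl
  have := he _ (P.γ_mem 0)
  simp at this

lemma cross_pos_iff_slope_lt {p q : Plane} (hp : p ∈ P.region) (hq : q ∈ P.region) :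
    0 < cross (p - x) (q - x) ↔ viewSlope e x p < viewSlope e x q := by
  have hpos := norm_pos_of_forall_inner_pos he
  have h := cross_eq_slope_sub (he p hp) (he q hq)
  have h2 := mul_pos (he p hp) (he q hq)
  rw [← mul_pos_iff_of_pos_right (pow_pos hpos 2), h, mul_pos_iff_of_pos_left h2, sub_pos]

lemma cross_nonpos_iff_slope_le {p q : Plane} (hp : p ∈ P.region) (hq : q ∈ P.region) :
    cross (p - x) (q - x) ≤ 0 ↔ viewSlope e x q ≤ viewSlope e x p := by
  rw [← not_lt, ← not_lt, cross_pos_iff_slope_lt he hp hq]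

lemma slope_eq_line {c : ℝ} {p q : Plane} (hp : p ∈ P.region) (hq : q ∈ P.region)
    (h1 : viewSlope e x p = c) (h2 : viewSlope e x q = c) :
    p = x + ⟪e, p - x⟫ • (⟪e, q - x⟫⁻¹ • (q - x)) := by
  have hpos := norm_pos_of_forall_inner_pos he
  have hc : cross (p - x) (q - x) = 0 := by
    have h := cross_eq_slope_sub (he p hp) (he q hq)
    rw [h1, h2, sub_self, mul_zero] at h
    exact (mul_eq_zero.1 h).resolve_right (by positivity)
  have hq' := he q hq
  have h3 : ⟪e, q - x⟫ • (p - x) = ⟪e, p - x⟫ • (q - x) := by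
    simp only [cross] at hc
    ext i
    fin_cases i
    · simp only [inner_eq, PiLp.smul_apply, smul_eq_mul, Fin.zero_eta]
      linear_combination (-e 1) * -hc
    · simp only [inner_eq, PiLp.smul_apply, smul_eq_mul, Fin.mk_one]
      linear_combination (e 0) * -hc
  rw [smul_smul, mul_comm, ← smul_smul, ← h3, smul_smul, inv_mul_cancel₀ hq'.ne', one_smul]
  abel

omit he in
lemma _root_.PerimeterDefense.mem_openSegment_of_lt {x d : Plane} {α β δ : ℝ} (h1 : α < β)
    (h2 : β < δ) : x + β • d ∈ openSegment ℝ (x + α • d) (x + δ • d) := by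
  have h3 : 0 < δ - α := by linarith
  refine ⟨(δ - β) / (δ - α), (β - α) / (δ - α), div_pos (by linarith) h3,
    div_pos (by linarith) h3, by field_simp; ring, ?_⟩
  have h4 : (δ - β) / (δ - α) = 1 - (β - α) / (δ - α) := by field_simp; ring
  have h5 : β = α + (β - α) / (δ - α) * (δ - α) := by field_simp; ring
  rw [h4]
  generalize (β - α) / (δ - α) = θ at *
  rw [h5]
  module

lemma exists_slope_gt {w : Plane} (hw : w ∈ interior P.region) :
    ∃ p ∈ P.region, viewSlope e x w < viewSlope e x p := by
  obtain ⟨ε, hε, hb⟩ := Metric.isOpen_iff.1 isOpen_interior w hw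
  have hwx : 0 < ‖w - x‖ := by
    rw [norm_pos_iff]
    intro h
    have := he w (interior_subset hw)
    simp [h] at this
  set J : Plane := !₂[-((w - x) 1), (w - x) 0] with hJ
  have hJn : ‖J‖ = ‖w - x‖ := by
    have : ‖J‖ ^ 2 = ‖w - x‖ ^ 2 := by rw [norm_sq_eq, norm_sq_eq, hJ]; simp; ring
    exact (pow_left_inj₀ (norm_nonneg _) (norm_nonneg _) two_ne_zero).1 this
  have hη : 0 < ε / (2 * ‖w - x‖) := by positivity
  set η := ε / (2 * ‖w - x‖) with hηd
  have hp : w + η • J ∈ P.region := interior_subset (hb (by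
    rw [Metric.mem_ball, dist_eq_norm, add_sub_cancel_left, norm_smul, hJn,
      Real.norm_of_nonneg hη.le, hηd]
    field_simp
    linarith))
  refine ⟨_, hp, ?_⟩
  rw [← cross_pos_iff_slope_lt he (interior_subset hw) hp]
  have : cross (w - x) (w + η • J - x) = η * ‖w - x‖ ^ 2 := by
    rw [norm_sq_eq, hJ]
    simp only [cross, PiLp.sub_apply, PiLp.add_apply, PiLp.smul_apply, smul_eq_mul]
    simp
    ring
  rw [this]
  positivity

lemma exists_slope_lt {w : Plane} (hw : w ∈ interior P.region) :
    ∃ p ∈ P.region, viewSlope e x p < viewSlope e x w := by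
  have he' : ∀ p ∈ P.reflect.region, 0 < ⟪mirror e, p - mirror x⟫ := by
    intro p hp
    rw [← mirror_mirror p, ← map_sub, LinearIsometryEquiv.inner_map_map]
    exact he _ hp
  have hm : ∀ p, viewSlope (mirror e) (mirror x) (mirror p) =
      -viewSlope e x p := by
    intro p
    rw [viewSlope, ← map_sub, LinearIsometryEquiv.inner_map_map, cross_mirror,
      neg_div, viewSlope]
  obtain ⟨p, hp, h⟩ := exists_slope_gt (P := P.reflect) he' (w := mirror w)
    (by rw [mem_interior_reflect_region, mirror_mirror]; exact hw)
  refine ⟨mirror p, hp, ?_⟩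
  rw [← mirror_mirror p, hm, hm] at h
  linarith

lemma continuousOn_slope : ContinuousOn (viewSlope e x) P.region := by
  unfold viewSlope
  refine ContinuousOn.div ?_ ?_ fun p hp => (he p hp).ne'
  · exact ((continuous_cross_right e).comp (continuous_id.sub continuous_const)).continuousOn
  · exact (Continuous.inner continuous_const (continuous_id.sub continuous_const)).continuousOn

/-- The interior is dense in the region, so slopes below and above `c` occur in it; it is connected,
so `c` occurs too. -/
lemma exists_interior_slope_eq {m M c : ℝ} (hm : ∃ p ∈ P.region, viewSlope e x p = m)
    (hM : ∃ p ∈ P.region, viewSlope e x p = M) (hc : c ∈ Ioo m M) :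
    ∃ w ∈ interior P.region, viewSlope e x w = c := by
  obtain ⟨p, hp, rfl⟩ := hm
  obtain ⟨q, hq, rfl⟩ := hM
  have hcont := continuousOn_slope he
  have key : ∀ z ∈ P.region, ∀ U ∈ 𝓝 (viewSlope e x z), ∃ w ∈ interior P.region, viewSlope e x w ∈ U := by
    intro z hz U hU
    have hz' : z ∈ closure (interior P.region) := by rw [closure_interior_region]; exact hz
    have h1 : Tendsto (viewSlope e x) (𝓝[interior P.region] z) (𝓝 (viewSlope e x z)) :=
      ((hcont z hz).mono interior_subset).tendsto
    have : (𝓝[interior P.region] z).NeBot := mem_closure_iff_nhdsWithin_neBot.1 hz'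
    obtain ⟨w, hw1, hw2⟩ := ((h1.eventually_mem hU).and self_mem_nhdsWithin).exists
    exact ⟨w, hw2, hw1⟩
  obtain ⟨w1, hw1, h1⟩ := key p hp _ (Iio_mem_nhds hc.1)
  obtain ⟨w2, hw2, h2⟩ := key q hq _ (Ioi_mem_nhds hc.2)
  obtain ⟨w, hw, h⟩ := P.convex_region.interior.isPreconnected.intermediate_value hw1 hw2
    (hcont.mono interior_subset) ⟨h1.le, h2.le⟩
  exact ⟨w, hw, h⟩

/-- On a ray from `x` through the interior, exactly the front point is visible. -/
lemma mem_visible_iff_of_slope_eq {w : Plane} (hw : w ∈ interior P.region) {s : ℝ}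
    (hs : viewSlope e x (P.γ s) = viewSlope e x w) :
    s ∈ P.visible x ↔ ⟪e, P.γ s - x⟫ < ⟪e, w - x⟫ := by
  have hl := slope_eq_line he (P.γ_mem s) (interior_subset hw) hs rfl
  have hlw := slope_eq_line he (interior_subset hw) (interior_subset hw) rfl rfl
  have hx0 : ∀ d : Plane, x = x + (0 : ℝ) • d := by simp
  have h0 := he _ (P.γ_mem s)
  have hw0 := he _ (interior_subset hw)
  set d := ⟪e, w - x⟫⁻¹ • (w - x) with hd
  constructor
  · intro hv
    by_contra! hle
    rcases hle.eq_or_lt with h | h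
    · rw [← h, ← hlw] at hl
      exact P.γ_notMem_interior s (hl ▸ hw)
    · refine hv w ?_ hw
      have := mem_openSegment_of_lt (x := x) (d := d) hw0 h
      rwa [← hx0, ← hl, ← hlw] at this
  · intro h p hp hpi
    refine P.γ_notMem_interior s (P.convex_region.interior.openSegment_subset hpi hw ?_)
    rw [openSegment_eq_image] at hp
    obtain ⟨θ, ⟨hθ0, hθ1⟩, rfl⟩ := hp
    have h3 : (1 - θ) • x + θ • P.γ s = x + (θ * ⟪e, P.γ s - x⟫) • d := by
      nth_rewrite 1 [hl]
      module
    have := mem_openSegment_of_lt (x := x) (d := d)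
      (show θ * ⟪e, P.γ s - x⟫ < ⟪e, P.γ s - x⟫ by nlinarith) h
    rwa [← h3, ← hl, ← hlw] at this

/-- A ray through the interior point `w` meets the perimeter at most once before `w` and at most
once after it: of two points on the same side, the one nearer to `w` would be interior. Visibility
tells the sides apart. -/
lemma eq_of_slope_eq {w : Plane} (hw : w ∈ interior P.region) {s t : ℝ}
    (hs : viewSlope e x (P.γ s) = viewSlope e x w) (ht : viewSlope e x (P.γ t) = viewSlope e x w)
    (hst : s ∈ P.visible x ↔ t ∈ P.visible x) : P.γ s = P.γ t := by
  have hl := slope_eq_line he (P.γ_mem s) (interior_subset hw) hs rfl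
  have hl' := slope_eq_line he (P.γ_mem t) (interior_subset hw) ht rfl
  have hlw := slope_eq_line he (interior_subset hw) (interior_subset hw) rfl rfl
  rw [mem_visible_iff_of_slope_eq he hw hs, mem_visible_iff_of_slope_eq he hw ht] at hst
  set d := ⟪e, w - x⟫⁻¹ • (w - x) with hd
  have hsw : ⟪e, P.γ s - x⟫ ≠ ⟪e, w - x⟫ := fun h => by
    rw [h, ← hlw] at hl
    exact P.γ_notMem_interior s (hl ▸ hw)
  have htw : ⟪e, P.γ t - x⟫ ≠ ⟪e, w - x⟫ := fun h => by
    rw [h, ← hlw] at hl'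
    exact P.γ_notMem_interior t (hl' ▸ hw)
  have key : ∀ r r', P.γ r = x + ⟪e, P.γ r - x⟫ • d → P.γ r' = x + ⟪e, P.γ r' - x⟫ • d →
      ⟪e, P.γ r - x⟫ < ⟪e, P.γ r' - x⟫ → ⟪e, P.γ r' - x⟫ < ⟪e, w - x⟫ → False := by
    intro r r' h1 h2 h3 h4
    refine P.γ_notMem_interior r' (P.convex_region.openSegment_self_interior_subset_interior
      (P.γ_mem r) hw ?_)
    have := mem_openSegment_of_lt (x := x) (d := d) h3 h4
    rwa [← h1, ← h2, ← hlw] at this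
  have key' : ∀ r r', P.γ r = x + ⟪e, P.γ r - x⟫ • d → P.γ r' = x + ⟪e, P.γ r' - x⟫ • d →
      ⟪e, P.γ r - x⟫ < ⟪e, P.γ r' - x⟫ → ⟪e, w - x⟫ < ⟪e, P.γ r - x⟫ → False := by
    intro r r' h1 h2 h3 h4
    refine P.γ_notMem_interior r (P.convex_region.openSegment_interior_self_subset_interior
      hw (P.γ_mem r') ?_)
    have := mem_openSegment_of_lt (x := x) (d := d) h4 h3
    rwa [← h1, ← h2, ← hlw] at this
  have : ⟪e, P.γ s - x⟫ = ⟪e, P.γ t - x⟫ := by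
    rcases lt_trichotomy ⟪e, P.γ s - x⟫ ⟪e, P.γ t - x⟫ with h | h | h
    · rcases lt_or_gt_of_ne htw with h' | h'
      · exact (key s t hl hl' h h').elim
      · rcases lt_or_gt_of_ne hsw with h'' | h''
        · exact absurd (hst.1 h'') h'.not_gt
        · exact (key' s t hl hl' h h'').elim
    · exact h
    · rcases lt_or_gt_of_ne hsw with h' | h'
      · exact (key t s hl' hl h h').elim
      · rcases lt_or_gt_of_ne htw with h'' | h''
        · exact absurd (hst.2 h'') h'.not_gt
        · exact (key' t s hl' hl h h'').elim
  rw [hl, hl', this]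

/-- A line of sight of extreme slope cannot pass through the interior, since near an interior point
both larger and smaller slopes occur. -/
lemma mem_visible_of_extreme {s : ℝ}
    (h : (∀ p ∈ P.region, viewSlope e x p ≤ viewSlope e x (P.γ s)) ∨
      ∀ p ∈ P.region, viewSlope e x (P.γ s) ≤ viewSlope e x p) : s ∈ P.visible x := by
  intro w hw hwi
  have hws : viewSlope e x w = viewSlope e x (P.γ s) := by
    obtain ⟨α, β, hα, hβ, hαβ, rfl⟩ := hw
    have : α • x + β • P.γ s - x = β • (P.γ s - x) := by
      rw [show α = 1 - β by linarith]; module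
    rw [viewSlope, this, cross_smul_right, inner_smul_right,
      mul_div_mul_left _ _ hβ.ne', viewSlope]
  rcases h with h | h
  · obtain ⟨p, hp, hlt⟩ := exists_slope_gt he hwi
    linarith [h p hp]
  · obtain ⟨p, hp, hlt⟩ := exists_slope_lt he hwi
    linarith [h p hp]

set_option maxHeartbeats 400000 in
-- The slope `K` of the line of sight runs between its maximum at `sM` and its minimum at `sm`. An
-- intermediate level is taken at most twice on the perimeter, once visibly and once invisibly, and
-- at least once on each of the two arcs between `sM` and `sm`; hence `K` is monotone on each. The
-- arc on which it decreases is the front. Adding the plateaus at the extreme values gives the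
-- visible arc.
lemma exists_visArc_of_inner_pos : ∃ a b, P.VisArc x a b := by
  have hcont : Continuous fun s => viewSlope e x (P.γ s) :=
    (continuousOn_slope he).comp_continuous P.continuous_γ P.γ_mem
  obtain ⟨q0, hq0⟩ := P.interior_nonempty
  have hne : P.region.Nonempty := ⟨q0, interior_subset hq0⟩
  obtain ⟨pM, hpM, hM⟩ := P.isCompact_region.exists_isMaxOn hne (continuousOn_slope he)
  obtain ⟨pm, hpm, hm⟩ := P.isCompact_region.exists_isMinOn hne (continuousOn_slope he)
  obtain ⟨sM, rfl⟩ := P.exists_γ_eq hpM fun hi => by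
    obtain ⟨p, hp, h⟩ := exists_slope_gt he hi
    exact absurd (hM hp) (not_le.2 h)
  obtain ⟨sm₀, rfl⟩ := P.exists_γ_eq hpm fun hi => by
    obtain ⟨p, hp, h⟩ := exists_slope_lt he hi
    exact absurd (hm hp) (not_le.2 h)
  set K : ℝ → ℝ := fun s => viewSlope e x (P.γ s) with hK
  have hMm : K sm₀ < K sM := by
    obtain ⟨p, hp, h⟩ := exists_slope_gt he hq0
    obtain ⟨p', hp', h'⟩ := exists_slope_lt he hq0
    have h1 : viewSlope e x p ≤ K sM := hM hp
    have h2 : K sm₀ ≤ viewSlope e x p' := hm hp'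
    linarith
  have hKper : ∀ s (k : ℤ), K (s + k * P.L) = K s := fun s k => by simp only [hK, P.γ_add_zsmul]
  have hL := P.L_pos
  obtain ⟨sm, hsm, hKsm⟩ : ∃ sm ∈ Ioo sM (sM + P.L), K sm = K sm₀ := by
    refine ⟨toIcoMod hL sM sm₀, ?_, ?_⟩
    · have h1 := toIcoMod_mem_Ico hL sM sm₀
      refine ⟨h1.1.lt_of_ne fun h => ?_, h1.2⟩
      have : K (toIcoMod hL sM sm₀) = K sm₀ := by
        rw [toIcoMod, zsmul_eq_mul, sub_eq_add_neg, ← neg_mul]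
        exact_mod_cast hKper sm₀ (-toIcoDiv hL sM sm₀)
      rw [← h] at this
      exact hMm.ne' this
    · rw [toIcoMod, zsmul_eq_mul, sub_eq_add_neg, ← neg_mul]
      exact_mod_cast hKper sm₀ (-toIcoDiv hL sM sm₀)
  set m := K sm₀
  set M := K sM
  have hr : ∀ s, m ≤ K s ∧ K s ≤ M := fun s => ⟨hm (P.γ_mem s), hM (P.γ_mem s)⟩
  have hML : K (sM + P.L) = M := by simpa using hKper sM 1
  have hint : ∀ {c}, c ∈ Ioo m M → ∃ w ∈ interior P.region, viewSlope e x w = c := fun hc =>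
    exists_interior_slope_eq he ⟨_, hpm, rfl⟩ ⟨_, hpM, rfl⟩ hc
  have huniq : ∀ s t, K s = K t → K s ∈ Ioo m M → |s - t| < P.L →
      (s ∈ P.visible x ↔ t ∈ P.visible x) → s = t := by
    intro s t h1 h2 h3 h4
    obtain ⟨w, hw, hwc⟩ := hint h2
    exact P.γ_inj (eq_of_slope_eq he hw hwc.symm (by rw [hwc]; exact h1.symm) h4) h3
  -- Of three points at one intermediate level, two agree in visibility and therefore coincide.
  have hthree : ∀ s t u, K s = K t → K u = K s → K s ∈ Ioo m M → |s - t| < P.L → |u - s| < P.L →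
      |u - t| < P.L → u ≠ s → u ≠ t → s = t := by
    intro s t u h1 h2 h3 h4 h5 h6 h7 h8
    by_cases hst : s ∈ P.visible x ↔ t ∈ P.visible x
    · exact huniq s t h1 h3 h4 hst
    · by_cases hus : u ∈ P.visible x ↔ s ∈ P.visible x
      · exact absurd (huniq u s h2 (by rwa [h2]) h5 hus) h7
      · exact absurd (huniq u t (h2.trans h1) (by rwa [h2]) h6 (iff_of_not_iff hst hus)) h8
  have hI : AntitoneOn K (Icc sM sm) := by
    refine antitoneOn_of_intermediate_inj hcont.continuousOn rfl (fun s _ => hr s) ?_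
    intro s hs t ht hst hc
    -- The complementary arc takes the same level and supplies the third point for `hthree`.
    obtain ⟨u, hu, hu'⟩ := intermediate_value_Ioo hsm.2.le (hcont.continuousOn (s := Icc sm (sM + P.L)))
      (show K s ∈ Ioo (K sm) (K (sM + P.L)) by rwa [hKsm, hML])
    have hsM : sM < s := hs.1.lt_of_ne fun h => hc.2.ne (by rw [← h])
    have htM : sM < t := ht.1.lt_of_ne fun h => hc.2.ne (by rw [hst, ← h])
    refine hthree s t u hst hu' hc ?_ ?_ ?_ ?_ ?_
    all_goals first
      | (rw [abs_lt]; constructor <;> linarith [hs.2, ht.2, hu.1, hu.2, hsm.1, hsm.2])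
      | (intro h; linarith [hs.2, ht.2, hu.1])
  have hJ : MonotoneOn K (Icc sm (sM + P.L)) := by
    have : AntitoneOn (fun s => -K s) (Icc sm (sM + P.L)) := by
      refine antitoneOn_of_intermediate_inj (m := -M) (M := -m) hcont.neg.continuousOn
        (by rw [hKsm]) (fun s _ => ⟨neg_le_neg (hr s).2, neg_le_neg (hr s).1⟩) ?_
      intro s hs t ht hst hc
      have hst := neg_injective hst
      have hc : K s ∈ Ioo m M := ⟨neg_lt_neg_iff.1 hc.2, neg_lt_neg_iff.1 hc.1⟩
      obtain ⟨u, hu, hu'⟩ := intermediate_value_Ioo' hsm.1.le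
        (hcont.continuousOn (s := Icc sM sm)) (show K s ∈ Ioo (K sm) (K sM) by rwa [hKsm])
      have hsM : s < sM + P.L := hs.2.lt_of_ne fun h => hc.2.ne (by rw [h, hML])
      have htM : t < sM + P.L := ht.2.lt_of_ne fun h => hc.2.ne (by rw [hst, h, hML])
      refine hthree s t u hst hu' hc ?_ ?_ ?_ ?_ ?_
      all_goals first
        | (rw [abs_lt]; constructor <;> linarith [hs.1, ht.1, hu.1, hu.2, hsm.1, hsm.2])
        | (intro h; linarith [hs.1, ht.1, hu.2])
    intro s hs t ht hst
    exact neg_le_neg_iff.1 (this hs ht hst)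
  have hvis_ext : ∀ s, K s = M ∨ K s = m → s ∈ P.visible x := by
    rintro s (h | h)
    · exact mem_visible_of_extreme he (Or.inl fun p hp => (hM hp).trans_eq h.symm)
    · exact mem_visible_of_extreme he (Or.inr fun p hp => h.trans_le (hm hp))
  have hvisI : ∀ s ∈ Icc sM sm, s ∈ P.visible x := by
    intro s hs
    by_contra hv
    have hsm' : s < sm := hs.2.lt_of_ne fun h => hv (hvis_ext s (Or.inr (by rw [h, hKsm])))
    obtain ⟨ε, hε, hb⟩ := Metric.isOpen_iff.1 (isOpen_compl_visible (P := P) x) s hv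
    -- Invisibility is an open condition, so it persists at a regular point nearby, where the view
    -- turns against the monotonicity `hI`.
    obtain ⟨τ, hτ, v, hreg⟩ := P.exists_regular (show s < min (s + ε) sm by
      exact lt_min (by linarith) hsm')
    have hτ' := lt_min_iff.1 hτ.2
    have hτv : τ ∉ P.visible x := hb (by
      rw [Metric.mem_ball, Real.dist_eq, abs_lt]; constructor <;> linarith [hτ.1])
    obtain ⟨r, ⟨hr3, hr2⟩, h2⟩ := hreg.exists_cross_pos hτv hτ'.2
    rw [cross_pos_iff_slope_lt he (P.γ_mem _) (P.γ_mem _)] at h2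
    exact absurd (hI ⟨by linarith [hs.1, hτ.1], hτ'.2.le⟩ ⟨by linarith [hs.1, hτ.1], hr2.le⟩ hr3.le)
      (not_le.2 h2)
  -- Edges seen end-on are plateaus of `K` at its extreme values and are visible. So the visible arc
  -- ends at the last minimum `b`, and starts one period before the first maximum `a'` that follows.
  obtain ⟨b, ⟨hbJ, hbm⟩, hbmax⟩ : ∃ b, IsGreatest (Icc sm (sM + P.L) ∩ K ⁻¹' {m}) b :=
    (isCompact_Icc.inter_right (isClosed_singleton.preimage hcont)).exists_isGreatest
      ⟨sm, ⟨le_rfl, hsm.2.le⟩, hKsm⟩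
  obtain ⟨a', ⟨haJ, haM⟩, hamin⟩ : ∃ a', IsLeast (Icc sm (sM + P.L) ∩ K ⁻¹' {M}) a' :=
    (isCompact_Icc.inter_right (isClosed_singleton.preimage hcont)).exists_isLeast
      ⟨sM + P.L, ⟨hsm.2.le, le_rfl⟩, hML⟩
  have hbm : K b = m := hbm
  have haM : K a' = M := haM
  have hba : b < a' := by
    by_contra! h
    have := hJ haJ hbJ h
    linarith
  have hKa : ∀ s, K (s - P.L) = K s := fun s => by
    have := hKper s (-1)
    simpa [sub_eq_add_neg] using this
  have hleft : ∀ s ∈ Icc (a' - P.L) sM, K s = M := by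
    intro s hs
    refine le_antisymm (hr s).2 ?_
    have h1 := hJ haJ (show s + P.L ∈ Icc sm (sM + P.L) from
      ⟨by linarith [haJ.1, hs.1], by linarith [hs.2]⟩) (by linarith [hs.1])
    rwa [← hKa (s + P.L), add_sub_cancel_right, haM] at h1
  have hright : ∀ s ∈ Icc sm b, K s = m := by
    intro s hs
    refine le_antisymm ?_ (hr s).1
    rw [← hbm]
    exact hJ ⟨hs.1, hs.2.trans hbJ.2⟩ hbJ hs.2
  have hmid : ∀ s ∈ Ioo b a', K s ∈ Ioo m M := by
    intro s hs
    have hsJ : s ∈ Icc sm (sM + P.L) := ⟨by linarith [hs.1, hbJ.1], by linarith [hs.2, haJ.2]⟩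
    refine ⟨(hr s).1.lt_of_ne fun h => ?_, (hr s).2.lt_of_ne fun h => ?_⟩
    · exact absurd (hbmax ⟨hsJ, h.symm⟩) (not_le.2 hs.1)
    · exact absurd (hamin ⟨hsJ, h⟩) (not_le.2 hs.2)
  have hanti : AntitoneOn K (Icc (a' - P.L) b) := by
    intro s hs t ht hst
    rcases le_total s sM with h1 | h1
    · rw [hleft s ⟨hs.1, h1⟩]; exact (hr t).2
    · rcases le_total sm t with h2 | h2
      · rw [hright t ⟨h2, ht.2⟩]; exact (hr s).1
      · exact hI ⟨h1, hst.trans h2⟩ ⟨h1.trans hst, h2⟩ hst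
  refine ⟨a' - P.L, b, ?_, ?_, ?_, ?_, ?_, ?_, ?_, ?_, ?_, ?_⟩
  · linarith
  · intro s hs
    rcases le_total s sM with h1 | h1
    · exact hvis_ext s (Or.inl (hleft s ⟨hs.1, h1⟩))
    · rcases le_total sm s with h2 | h2
      · exact hvis_ext s (Or.inr (hright s ⟨h2, hs.2⟩))
      · exact hvisI s ⟨h1, h2⟩
  · intro s hs hv
    rw [sub_add_cancel] at hs
    have hc := hmid s hs
    obtain ⟨u, hu, hu'⟩ := intermediate_value_Ioo' hsm.1.le
        (hcont.continuousOn (s := Icc sM sm)) (show K s ∈ Ioo (K sm) (K sM) by rwa [hKsm])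
    have := huniq s u hu'.symm hc (by
      rw [abs_lt]; constructor <;> linarith [hs.1, hs.2, hu.1, hu.2, hbJ.1, haJ.2])
      (iff_of_true hv (hvisI u ⟨hu.1.le, hu.2.le⟩))
    linarith [hs.1, hu.2, hbJ.1]
  · intro s t h1 h2 h3
    rw [cross_nonpos_iff_slope_le he (P.γ_mem _) (P.γ_mem _)]
    exact hanti ⟨h1, h2.trans h3⟩ ⟨h1.trans h2, h3⟩ h2
  · have : cross (P.γ b - x) (P.γ (a' - P.L) - x) > 0 := by
      rw [gt_iff_lt, cross_pos_iff_slope_lt he (P.γ_mem _) (P.γ_mem _)]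
      change K b < K (a' - P.L)
      rw [hKa, hbm, haM]
      exact hMm
    rw [cross_swap]; linarith
  · linarith [haJ.2, hbJ.1, hsm.1]
  · intro p hp
    rw [cross_swap, neg_nonneg, cross_nonpos_iff_slope_le he hp (P.γ_mem _)]
    exact hbm.trans_le (hm hp)
  · intro p hp
    rw [cross_nonpos_iff_slope_le he (P.γ_mem _) hp]
    change _ ≤ K _
    rw [hKa, haM]
    exact hM hp
  · intro s hs
    rw [sub_add_cancel] at hs
    rw [cross_pos_iff_slope_lt he (P.γ_mem _) (P.γ_mem _)]
    exact hbm.trans_lt (hmid s hs).1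
  · intro s hs
    rw [sub_add_cancel] at hs
    rw [cross_swap, neg_lt_zero, cross_pos_iff_slope_lt he (P.γ_mem _) (P.γ_mem _)]
    change _ < K _
    rw [hKa, haM]
    exact (hmid s hs).2

end slope

lemma exists_inner_pos {x : Plane} (hx : x ∉ P.region) :
    ∃ e : Plane, ∀ p ∈ P.region, 0 < ⟪e, p - x⟫ := by
  obtain ⟨f, u, h1, h2⟩ := geometric_hahn_banach_point_closed P.convex_region
    P.isCompact_region.isClosed hx
  refine ⟨(InnerProductSpace.toDual ℝ Plane).symm f, fun p hp => ?_⟩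
  rw [InnerProductSpace.toDual_symm_apply, map_sub]
  linarith [h2 p hp]

lemma exists_visArc {x : Plane} (hx : x ∉ P.region) : ∃ a b, P.VisArc x a b := by
  obtain ⟨e, he⟩ := exists_inner_pos hx
  exact exists_visArc_of_inner_pos he

lemma VisArc.exists_shift {x : Plane} {a b s : ℝ} (h : P.VisArc x a b) (hs : s ∈ P.visible x) :
    ∃ k : ℤ, s + k * P.L ∈ Icc a b := by
  refine ⟨-toIcoDiv P.L_pos a s, ?_⟩
  have h1 : s + (-toIcoDiv P.L_pos a s : ℤ) * P.L = toIcoMod P.L_pos a s := by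
    rw [toIcoMod, zsmul_eq_mul]; push_cast; ring
  have h2 := toIcoMod_mem_Ico P.L_pos a s
  rw [← h1] at h2
  refine ⟨h2.1, not_lt.1 fun h3 => ?_⟩
  exact h.invis _ ⟨h3, h2.2⟩ ((visible_add_zsmul _).2 hs)

lemma exists_visArc_mem {x : Plane} (hx : x ∉ P.region) {s : ℝ} (hs : s ∈ P.visible x) :
    ∃ a b, P.VisArc x a b ∧ s ∈ Icc a b := by
  obtain ⟨a, b, h⟩ := exists_visArc hx
  obtain ⟨k, hk⟩ := h.exists_shift hs
  refine ⟨_, _, h.shift (-k), ?_, ?_⟩ <;> push_cast <;> linarith [hk.1, hk.2]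

/-- The tangent vector of a visible perimeter point points to the right of the line of sight. -/
lemma VisArc.cross_nonneg {x : Plane} {a b τ : ℝ} (h : P.VisArc x a b) (hτ : τ ∈ Icc a b)
    {v : Plane} (hv : HasDerivAt P.γ v τ) : 0 ≤ cross v (P.γ τ - x) := by
  rcases hτ.1.eq_or_lt with h0 | h0
  · have hlt : τ < b := h0 ▸ h.lt
    have hd : Tendsto (fun r => (r - τ)⁻¹ • (P.γ r - P.γ τ)) (𝓝[>] τ) (𝓝 v) :=
      (hasDerivAt_iff_tendsto_slope.1 hv).mono_left
        (nhdsWithin_mono _ fun r hr => ne_of_gt hr)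
    have hd2 := ((continuous_cross_right (P.γ τ - x)).tendsto v).comp hd
    rw [cross_swap, neg_nonneg]
    refine le_of_tendsto hd2 ?_
    filter_upwards [self_mem_nhdsWithin,
      eventually_nhdsWithin_of_eventually_nhds (gt_mem_nhds hlt)] with r hr1 hr2
    have hr1 : τ < r := hr1
    simp only [Function.comp, cross_smul_right]
    refine mul_nonpos_of_nonneg_of_nonpos (inv_nonneg.2 (by linarith)) ?_
    have : P.γ r - P.γ τ = (P.γ r - x) - (P.γ τ - x) := by abel
    rw [this, cross_sub_right, cross_self, sub_zero]
    exact h.anti _ _ hτ.1 hr1.le hr2.le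
  · have hd : Tendsto (fun r => (r - τ)⁻¹ • (P.γ r - P.γ τ)) (𝓝[<] τ) (𝓝 v) :=
      (hasDerivAt_iff_tendsto_slope.1 hv).mono_left
        (nhdsWithin_mono _ fun r hr => ne_of_lt hr)
    have hd2 := ((continuous_cross_right (P.γ τ - x)).tendsto v).comp hd
    rw [cross_swap, neg_nonneg]
    refine le_of_tendsto hd2 ?_
    filter_upwards [self_mem_nhdsWithin,
      eventually_nhdsWithin_of_eventually_nhds (lt_mem_nhds h0)] with r hr1 hr2
    have hr1 : r < τ := hr1
    simp only [Function.comp, cross_smul_right]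
    refine mul_nonpos_of_nonpos_of_nonneg (inv_nonpos.2 (by linarith)) ?_
    have : P.γ r - P.γ τ = (P.γ r - x) - (P.γ τ - x) := by abel
    rw [this, cross_sub_right, cross_self, sub_zero, cross_swap, neg_nonneg]
    exact h.anti _ _ hr2.le hr1.le hτ.2

end Target

/-! ### Convexity of the visible arc -/

/-- Of two vectors to the right of `u`, one that makes a smaller angle with `u` is on the same
side of `e` as the other one. -/
lemma false_of_inner_mul_norm_le {e u w w' : Plane} (heu : 0 < ⟪e, u⟫) (hp : 0 ≤ cross w u)
    (hq : 0 ≤ cross w' u) (hew : 0 ≤ ⟪e, w⟫) (hew' : ⟪e, w'⟫ < 0) (hw : w ≠ 0)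
    (h : ⟪u, w⟫ * ‖w'‖ ≤ ‖w‖ * ⟪u, w'⟫) : False := by
  have i1 : ‖u‖ ^ 2 * ⟪e, w⟫ = ⟪u, w⟫ * ⟪e, u⟫ - cross w u * cross u e := by
    simp only [norm_sq_eq, inner_eq, cross]; ring
  have i2 : ‖u‖ ^ 2 * ⟪e, w'⟫ = ⟪u, w'⟫ * ⟪e, u⟫ - cross w' u * cross u e := by
    simp only [norm_sq_eq, inner_eq, cross]; ring
  have i3 := inner_sq_add_cross_sq u w
  have i4 := inner_sq_add_cross_sq u w'
  have hu : 0 < ‖u‖ := norm_pos_iff.2 fun h => by simp [h] at heu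
  have hwp : 0 < ‖w‖ := norm_pos_iff.2 hw
  have hwp' := norm_nonneg w'
  rw [cross_swap u w] at i3
  rw [cross_swap u w'] at i4
  have j1 : 0 ≤ ⟪u, w⟫ * ⟪e, u⟫ - cross w u * cross u e := by rw [← i1]; positivity
  have j2 : ⟪u, w'⟫ * ⟪e, u⟫ - cross w' u * cross u e < 0 := by
    rw [← i2]; exact mul_neg_of_pos_of_neg (by positivity) hew'
  generalize hC : ⟪u, w⟫ * ‖w'‖ = C at *
  generalize hC' : ‖w‖ * ⟪u, w'⟫ = C' at *
  have hP0 : 0 ≤ cross w u * ‖w'‖ := by positivity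
  have hQ0 : 0 ≤ cross w' u * ‖w‖ := by positivity
  generalize hP : cross w u * ‖w'‖ = Pp at *
  generalize hQ : cross w' u * ‖w‖ = Q at *
  have k1 : C ^ 2 + Pp ^ 2 = C' ^ 2 + Q ^ 2 := by
    rw [← hC, ← hP, ← hC', ← hQ]
    linear_combination ‖w'‖ ^ 2 * i3 - ‖w‖ ^ 2 * i4
  have k2 : Pp * cross u e ≤ C * ⟪e, u⟫ := by
    rw [← hC, ← hP]; nlinarith
  have k3 : C' * ⟪e, u⟫ < Q * cross u e := by
    rw [← hC', ← hQ]; nlinarith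
  rcases le_or_gt (cross u e) 0 with h0 | h0
  · have h1 : C' < 0 := by
      have : C' * ⟪e, u⟫ < 0 := k3.trans_le (mul_nonpos_of_nonneg_of_nonpos hQ0 h0)
      by_contra! h2
      exact absurd this (not_lt.2 (mul_nonneg h2 heu.le))
    have h2 : Pp ≤ Q := by
      apply le_of_sq_le_sq _ hQ0
      have : C' ^ 2 ≤ C ^ 2 := by
        have := pow_le_pow_left₀ (neg_pos.2 h1).le (neg_le_neg h) 2
        rwa [neg_sq, neg_sq] at this
      linarith
    have h3 := mul_le_mul_of_nonpos_right h2 h0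
    have h4 := mul_le_mul_of_nonneg_right h heu.le
    linarith
  · have h1 : 0 ≤ C := by
      by_contra! h2
      have := mul_nonneg hP0 h0.le
      have := mul_neg_of_neg_of_pos h2 heu
      linarith
    have h2 : Q ≤ Pp := by
      apply le_of_sq_le_sq _ hP0
      have := pow_le_pow_left₀ h1 h 2
      linarith
    have h3 := mul_le_mul_of_nonneg_right h2 h0.le
    have h4 := mul_le_mul_of_nonneg_right h heu.le
    linarith

lemma hasDerivAt_norm_sub {f : ℝ → Plane} {v x : Plane} {τ : ℝ} (h : HasDerivAt f v τ)
    (hx : f τ ≠ x) : HasDerivAt (fun s => ‖f s - x‖) (⟪f τ - x, v⟫ / ‖f τ - x‖) τ := by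
  have hne : f τ - x ≠ 0 := sub_ne_zero.2 hx
  have h1 := ((h.sub_const x).norm_sq).sqrt (by simpa using hne)
  simp only [Real.sqrt_sq (norm_nonneg _)] at h1
  convert! h1 using 1
  rw [mul_div_mul_left _ _ two_ne_zero]

namespace Target

variable {P : Target}

lemma γ_ne {x : Plane} (hx : x ∉ P.region) (s : ℝ) : P.γ s ≠ x := fun h => hx (h ▸ P.γ_mem s)

lemma norm_γ_sub_pos {x : Plane} (hx : x ∉ P.region) (s : ℝ) : 0 < ‖P.γ s - x‖ :=
  norm_pos_iff.2 (sub_ne_zero.2 (γ_ne hx s))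

lemma norm_γ_sub_γ_pos {s t : ℝ} (h1 : s < t) (h2 : t - s < P.L) : 0 < ‖P.γ t - P.γ s‖ := by
  rw [norm_pos_iff, sub_ne_zero]
  intro h
  have := P.γ_inj h (by rw [abs_of_pos (by linarith)]; exact h2)
  exact h1.ne' this

lemma lipschitz_dist (x : Plane) : LipschitzWith 1 fun s => ‖P.γ s - x‖ := by
  refine LipschitzWith.of_dist_le_mul fun s t => ?_
  rw [Real.dist_eq, NNReal.coe_one, one_mul, Real.dist_eq]
  refine (abs_norm_sub_norm_le _ _).trans ?_
  rw [sub_sub_sub_cancel_right]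
  exact P.norm_γ_sub_le s t

/-- On an edge seen end-on, the perimeter runs towards the observer. -/
lemma VisArc.inner_pos_of_cross_eq_zero {x v : Plane} {a b s τ : ℝ} (h : P.VisArc x a b)
    (hs : a ≤ s) (hsτ : s < τ) (hτ : τ ≤ b) (hv : P.Regular τ v) (h0 : cross v (P.γ τ - x) = 0)
    (h1 : ⟪P.γ τ - x, v⟫ < 0) : 0 < ⟪v, P.γ τ - P.γ s⟫ := by
  have hvv : ⟪v, v⟫ = 1 := by rw [real_inner_self_eq_norm_sq, hv.2, one_pow]
  have hu : ∀ z, cross (P.γ τ - x) z = ⟪P.γ τ - x, v⟫ * cross v z := by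
    intro z
    have hv2 : v 0 ^ 2 + v 1 ^ 2 = 1 := by rw [← norm_sq_eq, hv.2, one_pow]
    rw [inner_eq]
    simp only [cross] at h0 ⊢
    linear_combination -(v 0 * z 0 + v 1 * z 1) * h0 -
      ((P.γ τ - x) 0 * z 1 - (P.γ τ - x) 1 * z 0) * hv2
  have hcol : ∀ ρ ∈ Icc s τ, cross v (P.γ ρ - P.γ τ) = 0 := by
    intro ρ hρ
    have h2 := P.ccw τ v hv.1 _ (P.γ_mem ρ)
    have h3 := h.anti ρ τ (hs.trans hρ.1) hρ.2 hτ
    rw [cross_swap, hu] at h3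
    have h4 : cross v (P.γ ρ - x) = cross v (P.γ ρ - P.γ τ) := by
      rw [show P.γ ρ - x = (P.γ ρ - P.γ τ) + (P.γ τ - x) by abel, cross_add_right, h0, add_zero]
    rw [h4] at h3
    nlinarith
  have hinj : InjOn (fun ρ => ⟪v, P.γ ρ⟫) (Icc s τ) := by
    intro ρ hρ ρ' hρ' heq
    have heq : ⟪v, P.γ ρ⟫ = ⟪v, P.γ ρ'⟫ := heq
    have h2 : cross v (P.γ ρ - P.γ ρ') = 0 := by
      rw [show P.γ ρ - P.γ ρ' = (P.γ ρ - P.γ τ) - (P.γ ρ' - P.γ τ) by abel, cross_sub_right,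
        hcol ρ hρ, hcol ρ' hρ', sub_zero]
    have h3 : ⟪v, P.γ ρ - P.γ ρ'⟫ = 0 := by rw [inner_sub_right, heq, sub_self]
    have h4 := inner_sq_add_cross_sq v (P.γ ρ - P.γ ρ')
    rw [h2, h3, hv.2] at h4
    have h5 : ‖P.γ ρ - P.γ ρ'‖ = 0 := by
      have : (1 * ‖P.γ ρ - P.γ ρ'‖) ^ 2 = 0 := by rw [← h4]; ring
      simpa using this
    refine P.γ_inj (sub_eq_zero.1 (norm_eq_zero.1 h5)) ?_
    rw [abs_lt]
    constructor <;> linarith [hρ.1, hρ.2, hρ'.1, hρ'.2, h.lt_add]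
  have hcont : ContinuousOn (fun ρ => ⟪v, P.γ ρ⟫) (Icc s τ) :=
    (P.lipschitz_inner v).continuous.continuousOn
  rcases hcont.strictMonoOn_of_injOn_Icc' hsτ.le hinj with hm | hm
  · have := hm (left_mem_Icc.2 hsτ.le) (right_mem_Icc.2 hsτ.le) hsτ
    rw [inner_sub_right]
    simp only at this
    linarith
  · exfalso
    have hd := P.hasDerivAt_inner v hv.1
    rw [hvv] at hd
    have hd2 : Tendsto (fun r => (r - τ)⁻¹ • (⟪v, P.γ r⟫ - ⟪v, P.γ τ⟫)) (𝓝[<] τ) (𝓝 1) :=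
      (hasDerivAt_iff_tendsto_slope.1 hd).mono_left
        (nhdsWithin_mono _ fun r hr => ne_of_lt hr)
    obtain ⟨r, hr1, hr2⟩ := ((hd2.eventually_const_lt zero_lt_one).and (Ioo_mem_nhdsLT hsτ)).exists
    have := hm ⟨hr2.1.le, hr2.2.le⟩ (right_mem_Icc.2 hsτ.le) hr2.2
    simp only [smul_eq_mul] at hr1 this
    have h6 : (r - τ)⁻¹ ≤ 0 := inv_nonpos.2 (by linarith [hr2.2])
    nlinarith

/-- The chord from `s`, the tangent at `τ` and the line of sight to `τ` follow one another
counter-clockwise, so the tangent makes the smaller angle with the line of sight. If the tangent is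
opposite to the chord, the inequality is trivial unless the edge is seen end-on with the perimeter
running towards `x`, and then `inner_pos_of_cross_eq_zero` gives a contradiction. -/
lemma VisArc.inner_le_norm_mul_inner {x v : Plane} {a b s τ : ℝ} (h : P.VisArc x a b)
    (hs : a ≤ s) (hsτ : s < τ) (hτ : τ ≤ b) (hv : P.Regular τ v) :
    ⟪P.γ τ - x, P.γ τ - P.γ s⟫ ≤ ‖P.γ τ - P.γ s‖ * ⟪P.γ τ - x, v⟫ := by
  have h1 : 0 ≤ cross (P.γ τ - P.γ s) v := by
    have := P.ccw τ v hv.1 _ (P.γ_mem s)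
    rwa [cross_swap, ← cross_neg_left, neg_sub] at this
  have h2 : 0 ≤ cross v (P.γ τ - x) := h.cross_nonneg ⟨hs.trans hsτ.le, hτ⟩ hv.1
  have h3 : 0 ≤ cross (P.γ τ - P.γ s) (P.γ τ - x) := by
    have := h.anti s τ hs hsτ.le hτ
    rw [show P.γ τ - P.γ s = (P.γ τ - x) - (P.γ s - x) by abel, cross_sub_left, cross_self]
    linarith
  by_cases hdeg : cross (P.γ τ - P.γ s) v = 0 → 0 ≤ ⟪P.γ τ - P.γ s, v⟫
  · have := norm_mul_inner_le_of_cross_nonneg h1 h2 h3 hdeg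
    rwa [hv.2, one_mul] at this
  · push Not at hdeg
    obtain ⟨hd1, hd2⟩ := hdeg
    have hw : P.γ τ - P.γ s = ⟪P.γ τ - P.γ s, v⟫ • v := by
      have hv2 : v 0 ^ 2 + v 1 ^ 2 = 1 := by rw [← norm_sq_eq, hv.2, one_pow]
      simp only [cross] at hd1
      ext i
      fin_cases i
      · simp only [inner_eq, PiLp.smul_apply, smul_eq_mul, Fin.zero_eta]
        linear_combination v 1 * hd1 - (P.γ τ - P.γ s) 0 * hv2
      · simp only [inner_eq, PiLp.smul_apply, smul_eq_mul, Fin.mk_one]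
        linear_combination -v 0 * hd1 - (P.γ τ - P.γ s) 1 * hv2
    rcases le_or_gt 0 ⟪P.γ τ - x, v⟫ with h4 | h4
    · have h5 : ⟪P.γ τ - x, P.γ τ - P.γ s⟫ = ⟪P.γ τ - P.γ s, v⟫ * ⟪P.γ τ - x, v⟫ := by
        conv_lhs => rw [hw, real_inner_smul_right]
      rw [h5]
      exact (mul_nonpos_of_nonpos_of_nonneg hd2.le h4).trans (by positivity)
    · exfalso
      have h5 : cross v (P.γ τ - x) = 0 := by
        rw [hw, cross_smul_left] at h3
        nlinarith
      have := h.inner_pos_of_cross_eq_zero hs hsτ hτ hv h5 h4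
      rw [real_inner_comm] at this
      linarith

lemma VisArc.norm_mul_inner_le_inner {x v : Plane} {a b s τ : ℝ} (h : P.VisArc x a b)
    (hτ : a ≤ τ) (hsτ : τ < s) (hs : s ≤ b) (hv : P.Regular τ v) :
    ‖P.γ s - P.γ τ‖ * ⟪P.γ τ - x, v⟫ ≤ ⟪P.γ τ - x, P.γ s - P.γ τ⟫ := by
  have := h.reflect.inner_le_norm_mul_inner (s := -s) (τ := -τ) (by linarith) (by linarith)
    (by linarith) hv.reflect
  simp only [reflect_γ, neg_neg, ← map_sub, inner_neg_right, LinearIsometryEquiv.inner_map_map,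
    LinearIsometryEquiv.norm_map] at this
  rw [← neg_sub (P.γ s), inner_neg_right, norm_neg] at this
  linarith

/-- The chords to earlier and to later points of the visible arc turn away from the observer. -/
lemma VisArc.inner_mul_norm_le {x : Plane} {a b s τ s' : ℝ} (h : P.VisArc x a b)
    (hs : a ≤ s) (hsτ : s < τ) (hτ : τ < s') (hs' : s' ≤ b) :
    ⟪P.γ τ - x, P.γ τ - P.γ s⟫ * ‖P.γ s' - P.γ τ‖ ≤
      ‖P.γ τ - P.γ s‖ * ⟪P.γ τ - x, P.γ s' - P.γ τ⟫ := by
  by_contra! hlt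
  have hγ := P.continuous_γ
  have hU : {τ | ‖P.γ τ - P.γ s‖ * ⟪P.γ τ - x, P.γ s' - P.γ τ⟫ <
      ⟪P.γ τ - x, P.γ τ - P.γ s⟫ * ‖P.γ s' - P.γ τ‖} ∈ 𝓝 τ :=
    (isOpen_lt (by fun_prop) (by fun_prop)).mem_nhds hlt
  obtain ⟨ε, hε, hb⟩ := Metric.mem_nhds_iff.1 hU
  -- The strict violation persists at a regular point just after `τ`, where the tangent can be
  -- compared with both chords.
  obtain ⟨r, hr, v, hv⟩ := P.exists_regular (show τ < min (τ + ε) s' from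
    lt_min (by linarith) hτ)
  have hr' := lt_min_iff.1 hr.2
  have h1 := hb (show r ∈ Metric.ball τ ε by
    rw [Metric.mem_ball, Real.dist_eq, abs_lt]; constructor <;> linarith [hr.1])
  have h2 := h.inner_le_norm_mul_inner hs (hsτ.trans hr.1) (hr'.2.le.trans hs') hv
  have h3 := h.norm_mul_inner_le_inner (by linarith [hr.1]) hr'.2 hs' hv
  have h4 : ‖P.γ r - P.γ s‖ * ⟪P.γ r - x, P.γ s' - P.γ r⟫ <
      ⟪P.γ r - x, P.γ r - P.γ s⟫ * ‖P.γ s' - P.γ r‖ := h1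
  have h5 := mul_le_mul_of_nonneg_right h2 (norm_nonneg (P.γ s' - P.γ r))
  have h6 := mul_le_mul_of_nonneg_left h3 (norm_nonneg (P.γ r - P.γ s))
  nlinarith

/-- If `s'` maximizes `σ - ‖γ σ - x‖ / ν` from `s` to `s'`, then the chord from `s` approaches
the line of sight of `s'` at an angle of cosine at most `ν`. -/
lemma VisArc.inner_le_of_isMax {x : Plane} {a b s s' ν : ℝ} (h : P.VisArc x a b)
    (hx : x ∉ P.region) (hν : 0 < ν) (hs : a ≤ s) (hss' : s < s') (hs' : s' ≤ b)
    (hmax : ∀ σ ∈ Icc s s', σ - ‖P.γ σ - x‖ / ν ≤ s' - ‖P.γ s' - x‖ / ν) :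
    ⟪P.γ s' - x, P.γ s' - P.γ s⟫ ≤ ν * (‖P.γ s' - x‖ * ‖P.γ s' - P.γ s‖) := by
  by_contra! hlt
  have hγ := P.continuous_γ
  -- A violation holds with a margin `ε` on a neighbourhood of `s'`. The tangent is closer to the
  -- line of sight than the chord, so there the distance from `x` grows at rate at least `ν + ε`,
  -- and a slightly smaller parameter would give a larger value.
  obtain ⟨ε, hε, hlt'⟩ : ∃ ε, 0 < ε ∧ (ν + ε) * (‖P.γ s' - x‖ * ‖P.γ s' - P.γ s‖) <
      ⟪P.γ s' - x, P.γ s' - P.γ s⟫ := by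
    have hM : 0 ≤ ‖P.γ s' - x‖ * ‖P.γ s' - P.γ s‖ := by positivity
    generalize ‖P.γ s' - x‖ * ‖P.γ s' - P.γ s‖ = M at *
    generalize ⟪P.γ s' - x, P.γ s' - P.γ s⟫ = D at *
    refine ⟨(D - ν * M) / (2 * (M + 1)), div_pos (by linarith) (by linarith), ?_⟩
    have : (D - ν * M) / (2 * (M + 1)) * M ≤ (D - ν * M) / 2 := by
      rw [div_mul_eq_mul_div, div_le_div_iff₀ (by linarith) (by norm_num)]
      nlinarith
    linarith
  have hU : {τ | (ν + ε) * (‖P.γ τ - x‖ * ‖P.γ τ - P.γ s‖) <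
      ⟪P.γ τ - x, P.γ τ - P.γ s⟫} ∈ 𝓝 s' :=
    (isOpen_lt (by fun_prop) (by fun_prop)).mem_nhds hlt'
  obtain ⟨η, hη, hb⟩ := Metric.mem_nhds_iff.1 hU
  set r := max s (s' - η / 2) with hr
  have hrs' : r < s' := max_lt hss' (by linarith)
  have hgrow : (ν + ε) * (s' - r) ≤ ‖P.γ s' - x‖ - ‖P.γ r - x‖ := by
    refine mul_sub_le_of_ae_le_deriv (lipschitz_dist x) hrs'.le ?_
    filter_upwards [P.ae_regular] with τ hτ hτm
    obtain ⟨v, hv⟩ := hτ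
    rw [(hasDerivAt_norm_sub hv.1 (γ_ne hx τ)).deriv, le_div_iff₀ (norm_γ_sub_pos hx τ)]
    have hsτ : s < τ := (le_max_left _ _).trans_lt hτm.1
    have h1 : (ν + ε) * (‖P.γ τ - x‖ * ‖P.γ τ - P.γ s‖) < ⟪P.γ τ - x, P.γ τ - P.γ s⟫ :=
      hb (show τ ∈ Metric.ball s' η by
        have := (le_max_right s (s' - η / 2)).trans_lt hτm.1
        rw [Metric.mem_ball, Real.dist_eq, abs_lt]
        constructor <;> linarith [hτm.2])
    have h2 := h.inner_le_norm_mul_inner hs hsτ (hτm.2.le.trans hs') hv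
    have h3 := norm_γ_sub_γ_pos (P := P) hsτ (by linarith [hτm.2, h.lt_add])
    refine le_of_mul_le_mul_left ?_ h3
    nlinarith
  have h1 := hmax r ⟨le_max_left _ _, hrs'.le⟩
  have h2 : (‖P.γ s' - x‖ - ‖P.γ r - x‖) / ν ≤ s' - r := by rw [sub_div]; linarith
  rw [div_le_iff₀ hν] at h2
  nlinarith

/-- One step of the comparison of the perimeter with a path through `y`. -/
lemma VisArc.exists_step {y : Plane} {a b p q s' : ℝ} (h : P.VisArc y a b) (hp : a ≤ p)
    (hpq : p ≤ q) (hqs' : q ≤ s') (hs' : s' ≤ b) {w : Plane} (hw : ‖w‖ ≤ 1)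
    (hwσ : ∀ σ ∈ Ioc p s', ⟪P.γ p - y, w⟫ * ‖P.γ σ - P.γ p‖ ≤ ⟪P.γ p - y, P.γ σ - P.γ p⟫) :
    ∃ w', ‖w'‖ ≤ 1 ∧ ‖P.γ q - P.γ p‖ + ⟪P.γ p - y, w⟫ ≤ ⟪P.γ q - y, w'⟫ ∧
      ∀ σ ∈ Ioc q s', ⟪P.γ q - y, w'⟫ * ‖P.γ σ - P.γ q‖ ≤ ⟪P.γ q - y, P.γ σ - P.γ q⟫ := by
  rcases hpq.eq_or_lt with rfl | hlt
  · exact ⟨w, hw, by simp, hwσ⟩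
  have hn : 0 < ‖P.γ q - P.γ p‖ := norm_γ_sub_γ_pos hlt (by linarith [h.lt_add])
  -- The new vector is the direction of the chord. Turning to it does not decrease the component of
  -- `γ p - y`, by `hwσ`, and walking along the chord adds its length.
  refine ⟨‖P.γ q - P.γ p‖⁻¹ • (P.γ q - P.γ p), ?_, ?_, ?_⟩
  · rw [norm_smul, norm_inv, norm_norm, inv_mul_cancel₀ hn.ne']
  · have h1 := hwσ q ⟨hlt, hqs'⟩
    rw [real_inner_smul_right, show P.γ q - y = (P.γ q - P.γ p) + (P.γ p - y) by abel,
      inner_add_left, real_inner_self_eq_norm_sq, inv_mul_eq_div, le_div_iff₀ hn]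
    nlinarith
  · intro σ hσ
    have h1 := h.inner_mul_norm_le hp hlt hσ.1 (hσ.2.trans hs')
    rw [real_inner_smul_right, inv_mul_eq_div, div_mul_eq_mul_div, div_le_iff₀ hn]
    linarith

/-- Let `w` run through the directions of the successive chords of an inscribed polygon. The
component of `γ - y` along `w` grows by the chord length on each chord and does not drop when the
direction changes, and at the end it is at most `‖γ s' - y‖`. This bounds all polygon lengths, hence
the arc length. -/
lemma VisArc.sub_le {y : Plane} {a b s s' : ℝ} (h : P.VisArc y a b) (hs : a ≤ s)
    (hss' : s < s') (hs' : s' ≤ b) {w : Plane} (hw : ‖w‖ ≤ 1)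
    (hwσ : ∀ σ ∈ Ioc s s', ⟪P.γ s - y, w⟫ * ‖P.γ σ - P.γ s‖ ≤ ⟪P.γ s - y, P.γ σ - P.γ s⟫) :
    s' - s ≤ ‖P.γ s' - y‖ - ⟪P.γ s - y, w⟫ := by
  have hvar := P.unitSpeed (mem_univ s) (mem_univ s')
  rw [NNReal.coe_one, one_mul] at hvar
  suffices hle : eVariationOn P.γ (univ ∩ Icc s s') ≤
      ENNReal.ofReal (‖P.γ s' - y‖ - ⟪P.γ s - y, w⟫) by
    rw [hvar, ENNReal.ofReal_le_ofReal_iff'] at hle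
    exact hle.resolve_right (by linarith)
  refine iSup_le fun ⟨n, u, hu, hus⟩ => ?_
  have key : ∀ n, ∃ w', ‖w'‖ ≤ 1 ∧ (∑ i ∈ Finset.range n, ‖P.γ (u (i + 1)) - P.γ (u i)‖) +
      ⟪P.γ s - y, w⟫ ≤ ⟪P.γ (u n) - y, w'⟫ ∧
      ∀ σ ∈ Ioc (u n) s', ⟪P.γ (u n) - y, w'⟫ * ‖P.γ σ - P.γ (u n)‖ ≤
        ⟪P.γ (u n) - y, P.γ σ - P.γ (u n)⟫ := by
    intro n
    induction n with
    | zero =>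
      obtain ⟨w', h1, h2, h3⟩ := h.exists_step hs (hus 0).2.1 (hus 0).2.2 hs' hw hwσ
      refine ⟨w', h1, ?_, h3⟩
      simp only [Finset.range_zero, Finset.sum_empty]
      linarith [norm_nonneg (P.γ (u 0) - P.γ s)]
    | succ n ih =>
      obtain ⟨w', h1, h2, h3⟩ := ih
      obtain ⟨w'', h1', h2', h3'⟩ := h.exists_step (hs.trans (hus n).2.1) (hu n.le_succ)
        (hus (n + 1)).2.2 hs' h1 h3
      refine ⟨w'', h1', ?_, h3'⟩
      rw [Finset.sum_range_succ]
      linarith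
  obtain ⟨w', h1, h2, h3⟩ := key n
  obtain ⟨w'', h1', h2', -⟩ := h.exists_step (hs.trans (hus n).2.1) (hus n).2.2 le_rfl hs' h1 h3
  have h4 : ∑ i ∈ Finset.range n, edist (P.γ (u (i + 1))) (P.γ (u i)) =
      ENNReal.ofReal (∑ i ∈ Finset.range n, ‖P.γ (u (i + 1)) - P.γ (u i)‖) := by
    rw [ENNReal.ofReal_sum_of_nonneg fun _ _ => norm_nonneg _]
    exact Finset.sum_congr rfl fun i _ => by rw [edist_dist, dist_eq_norm]
  simp only
  rw [h4]
  refine ENNReal.ofReal_le_ofReal ?_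
  have h5 := real_inner_le_norm (P.γ s' - y) w''
  have h6 : ‖P.γ s' - y‖ * ‖w''‖ ≤ ‖P.γ s' - y‖ * 1 :=
    mul_le_mul_of_nonneg_left h1' (norm_nonneg _)
  linarith [norm_nonneg (P.γ s' - P.γ (u n))]

/-- A visible arc is not longer than the path through the observer. -/
lemma VisArc.sub_le_add {y : Plane} {a b s s' : ℝ} (h : P.VisArc y a b) (hy : y ∉ P.region)
    (hs : a ≤ s) (hss' : s ≤ s') (hs' : s' ≤ b) : s' - s ≤ ‖P.γ s - y‖ + ‖P.γ s' - y‖ := by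
  rcases hss'.eq_or_lt with rfl | hlt
  · rw [sub_self]; positivity
  have hn := norm_γ_sub_pos hy s
  -- With the initial vector pointing from `γ s` back to `y`, the condition of `sub_le` is just
  -- Cauchy–Schwarz.
  have h0 : ⟪P.γ s - y, -(‖P.γ s - y‖⁻¹ • (P.γ s - y))⟫ = -‖P.γ s - y‖ := by
    rw [inner_neg_right, real_inner_smul_right, real_inner_self_eq_norm_sq]
    field_simp
  have := h.sub_le hs hlt hs' (w := -(‖P.γ s - y‖⁻¹ • (P.γ s - y))) (by
    rw [norm_neg, norm_smul, norm_inv, norm_norm, inv_mul_cancel₀ hn.ne']) (fun σ _ => by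
      rw [h0, neg_mul]
      exact neg_le_of_abs_le (abs_real_inner_le_norm _ _))
  rw [h0] at this
  linarith

/-- A path around the right end of the visible arc is not longer than one through `y`. -/
lemma VisArc.add_sub_le_of_right {x y e : Plane} {a b a' b' s₀ s₁ : ℝ} (hx : P.VisArc x a b)
    (hy : P.VisArc y a' b') (hxT : x ∉ P.region) (he : ∀ p ∈ P.region, ⟪e, P.γ s₀⟫ ≤ ⟪e, p⟫)
    (hex : ⟪e, x⟫ < ⟪e, P.γ s₀⟫) (hey : ⟪e, y⟫ < ⟪e, P.γ s₀⟫) (hs₀ : s₀ ∈ Icc a b)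
    (hs₀' : s₀ ∈ Icc a' b') (hb : b < s₁) (hs₁ : s₁ ≤ b') :
    ‖P.γ b - x‖ + (s₁ - b) ≤ ‖x - y‖ + ‖P.γ s₁ - y‖ := by
  have hab' : a' ≤ b := hs₀'.1.trans hs₀.2
  -- Slightly beyond `b` the chord from `b` to `σ` provides a direction for `sub_le`; afterwards `σ`
  -- tends to `b`.
  have key : ∀ σ ∈ Ioo b (min s₁ (a + P.L)),
      ‖P.γ b - x‖ + (s₁ - σ) ≤ ‖x - y‖ + ‖P.γ s₁ - y‖ := by
    intro σ hσ
    have hσ' := lt_min_iff.1 hσ.2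
    have hn : 0 < ‖P.γ σ - P.γ b‖ := norm_γ_sub_γ_pos hσ.1 (by linarith [hs₀.1, hs₀.2])
    have hnx := norm_γ_sub_pos hxT b
    have c1 : 0 < cross (P.γ b - x) (P.γ σ - P.γ b) := by
      have := hx.right_pos σ ⟨hσ.1, hσ'.2⟩
      rwa [show P.γ σ - x = (P.γ σ - P.γ b) + (P.γ b - x) by abel, cross_add_right, cross_self,
        add_zero] at this
    have c2 : 0 ≤ cross (P.γ σ - P.γ b) (P.γ b - y) := by
      have := hy.anti b σ hab' hσ.1.le (hσ'.1.le.trans hs₁)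
      rw [show P.γ σ - y = (P.γ σ - P.γ b) + (P.γ b - y) by abel, cross_add_right, cross_self,
        add_zero] at this
      rw [cross_swap]; linarith
    have eb : 0 < ⟪e, P.γ b - y⟫ := by
      rw [inner_sub_right]; linarith [he _ (P.γ_mem b)]
    have ebx : 0 < ⟪e, P.γ b - x⟫ := by
      rw [inner_sub_right]; linarith [he _ (P.γ_mem b)]
    -- Otherwise the chord from `b` to `σ` would descend relative to `e`. But the chord from the
    -- lowest point `s₀` to `b` does not descend, and the later chord makes no larger angle with the
    -- line of sight from `y`.
    have c3 : 0 ≤ cross (P.γ b - x) (P.γ b - y) := by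
      by_contra! hneg
      have i1 : ⟪e, P.γ σ - P.γ b⟫ * cross (P.γ b - y) (P.γ b - x) =
          ⟪e, P.γ b - y⟫ * cross (P.γ σ - P.γ b) (P.γ b - x) +
          ⟪e, P.γ b - x⟫ * cross (P.γ b - y) (P.γ σ - P.γ b) := by
        simp only [inner_eq, cross]; ring
      rw [cross_swap (P.γ b - y) (P.γ b - x), cross_swap (P.γ σ - P.γ b) (P.γ b - x),
        cross_swap (P.γ b - y) (P.γ σ - P.γ b)] at i1
      have e1 : ⟪e, P.γ σ - P.γ b⟫ < 0 := by
        by_contra! h0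
        have := mul_pos eb c1
        have := mul_nonneg ebx.le c2
        have := mul_nonneg h0 (neg_pos.2 hneg).le
        linarith
      rcases hs₀.2.eq_or_lt with h0 | h0
      · rw [inner_sub_right, ← h0] at e1
        linarith [he _ (P.γ_mem σ)]
      · have hn0 : 0 < ‖P.γ b - P.γ s₀‖ := norm_γ_sub_γ_pos h0 (by linarith [hs₀.1, hx.lt_add])
        refine false_of_inner_mul_norm_le (w := P.γ b - P.γ s₀) eb ?_ c2 ?_ e1
          (norm_pos_iff.1 hn0) (hy.inner_mul_norm_le hs₀'.1 h0 hσ.1 (hσ'.1.le.trans hs₁))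
        · have := hy.anti s₀ b hs₀'.1 h0.le (by linarith)
          rw [show P.γ b - P.γ s₀ = (P.γ b - y) - (P.γ s₀ - y) by abel, cross_sub_left,
            cross_self]
          linarith
        · rw [inner_sub_right]; linarith [he _ (P.γ_mem b)]
    -- The chord lies between the two lines of sight to `γ b`, so it is at least as close to the
    -- direction `γ b - y` as `γ b - x` is.
    have c4 := norm_mul_inner_le_of_cross_nonneg c1.le c2 c3 fun h => absurd h c1.ne'
    have h1 := hy.sub_le (s := σ) (by linarith [hσ.1]) hσ'.1 hs₁
      (w := ‖P.γ σ - P.γ b‖⁻¹ • (P.γ σ - P.γ b)) (by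
        rw [norm_smul, norm_inv, norm_norm, inv_mul_cancel₀ hn.ne']) (fun r hr => by
        have := hy.inner_mul_norm_le hab' hσ.1 hr.1 (hr.2.trans hs₁)
        rw [real_inner_smul_right, inv_mul_eq_div, div_mul_eq_mul_div, div_le_iff₀ hn]
        linarith)
    have h2 : ‖P.γ b - x‖ - ‖x - y‖ ≤
        ⟪P.γ σ - y, ‖P.γ σ - P.γ b‖⁻¹ • (P.γ σ - P.γ b)⟫ := by
      rw [real_inner_smul_right, inv_mul_eq_div, le_div_iff₀ hn,
        show P.γ σ - y = (P.γ σ - P.γ b) + (P.γ b - y) by abel, inner_add_left,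
        real_inner_self_eq_norm_sq]
      have h3 : ⟪P.γ b - y, P.γ b - x⟫ = ‖P.γ b - x‖ ^ 2 + ⟪x - y, P.γ b - x⟫ := by
        rw [show P.γ b - y = (P.γ b - x) + (x - y) by abel, inner_add_left,
          real_inner_self_eq_norm_sq]
      have h4 := neg_le_of_abs_le (abs_real_inner_le_norm (x - y) (P.γ b - x))
      have h5 : ‖P.γ σ - P.γ b‖ * (‖P.γ b - x‖ * (‖P.γ b - x‖ - ‖x - y‖)) ≤
          ‖P.γ b - x‖ * ⟪P.γ b - y, P.γ σ - P.γ b⟫ := by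
        refine le_trans (mul_le_mul_of_nonneg_left ?_ hn.le) c4
        rw [h3]; nlinarith
      have h6 : ‖P.γ σ - P.γ b‖ * (‖P.γ b - x‖ - ‖x - y‖) ≤ ⟪P.γ b - y, P.γ σ - P.γ b⟫ := by
        refine le_of_mul_le_mul_left ?_ hnx
        linarith
      nlinarith [sq_nonneg ‖P.γ σ - P.γ b‖]
    linarith
  have hlim : Tendsto (fun σ => ‖P.γ b - x‖ + (s₁ - σ)) (𝓝[>] b) (𝓝 (‖P.γ b - x‖ + (s₁ - b))) :=
    (Continuous.tendsto (by fun_prop) b).mono_left nhdsWithin_le_nhds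
  refine le_of_tendsto hlim ?_
  filter_upwards [Ioo_mem_nhdsGT (lt_min hb hx.lt_add)] with σ hσ using key σ hσ

lemma VisArc.add_sub_le_of_left {x y e : Plane} {a b a' b' s₀ s₁ : ℝ} (hx : P.VisArc x a b)
    (hy : P.VisArc y a' b') (hxT : x ∉ P.region) (he : ∀ p ∈ P.region, ⟪e, P.γ s₀⟫ ≤ ⟪e, p⟫)
    (hex : ⟪e, x⟫ < ⟪e, P.γ s₀⟫) (hey : ⟪e, y⟫ < ⟪e, P.γ s₀⟫) (hs₀ : s₀ ∈ Icc a b)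
    (hs₀' : s₀ ∈ Icc a' b') (ha : s₁ < a) (hs₁ : a' ≤ s₁) :
    ‖P.γ a - x‖ + (a - s₁) ≤ ‖x - y‖ + ‖P.γ s₁ - y‖ := by
  have := hx.reflect.add_sub_le_of_right hy.reflect (e := mirror e) (s₀ := -s₀) (s₁ := -s₁)
    (by rw [mem_reflect_region, mirror_mirror]; exact hxT)
    (fun p hp => by
      have := he _ hp
      rw [← mirror_mirror p, reflect_γ, neg_neg, LinearIsometryEquiv.inner_map_map,
        LinearIsometryEquiv.inner_map_map]
      exact this)
    (by rw [reflect_γ, neg_neg, LinearIsometryEquiv.inner_map_map,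
        LinearIsometryEquiv.inner_map_map]; exact hex)
    (by rw [reflect_γ, neg_neg, LinearIsometryEquiv.inner_map_map,
        LinearIsometryEquiv.inner_map_map]; exact hey)
    ⟨by linarith [hs₀.2], by linarith [hs₀.1]⟩ ⟨by linarith [hs₀'.2], by linarith [hs₀'.1]⟩
    (by linarith) (by linarith)
  simp only [reflect_γ, neg_neg, ← map_sub, LinearIsometryEquiv.norm_map] at this
  linarith

end Target

namespace Target

variable {P : Target}

/-! ### Arc lengths and breaching points -/

lemma arc_eq {s t r : ℝ} {k : ℤ} (h0 : 0 ≤ r) (h1 : r < P.L) (h : t - s = r + k * P.L) :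
    P.arc s t = r := by
  rw [arc, toIcoMod_eq_iff]
  exact ⟨⟨h0, by linarith⟩, k, by simp [h]⟩

lemma exists_arc_eq (P : Target) (s t : ℝ) :
    0 ≤ P.arc s t ∧ P.arc s t < P.L ∧ ∃ k : ℤ, t - s = P.arc s t + k * P.L := by
  have h := toIcoMod_mem_Ico P.L_pos 0 (t - s)
  have h' := (toIcoMod_eq_iff P.L_pos (a := 0) (b := t - s) (c := P.arc s t)).1 rfl
  simp only [zero_add, zsmul_eq_mul] at h h'
  exact ⟨h.1, h.2, h'.2⟩

lemma arc_add_left (s t : ℝ) (k : ℤ) : P.arc (s + k * P.L) t = P.arc s t := by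
  obtain ⟨h0, h1, j, hj⟩ := P.exists_arc_eq s t
  exact arc_eq (k := j - k) h0 h1 (by push_cast; linarith)

lemma arc_add_right (s t : ℝ) (k : ℤ) : P.arc s (t + k * P.L) = P.arc s t := by
  obtain ⟨h0, h1, j, hj⟩ := P.exists_arc_eq s t
  exact arc_eq (k := j + k) h0 h1 (by push_cast; linarith)

lemma exists_notMem_visible {x : Plane} {a b s : ℝ} (h : P.VisArc x a b) (hs : s ∉ P.visible x) :
    ∃ k : ℤ, s + k * P.L ∈ Ioo b (a + P.L) := by
  refine ⟨-toIcoDiv P.L_pos a s, ?_⟩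
  have h1 : s + (-toIcoDiv P.L_pos a s : ℤ) * P.L = toIcoMod P.L_pos a s := by
    rw [toIcoMod, zsmul_eq_mul]; push_cast; ring
  have h2 := toIcoMod_mem_Ico P.L_pos a s
  rw [← visible_add_zsmul (-toIcoDiv P.L_pos a s), h1] at hs
  rw [h1]
  refine ⟨?_, h2.2⟩
  by_contra hb
  exact hs (h.vis _ ⟨h2.1, not_lt.1 hb⟩)

lemma VisArc.exists_notMem {x : Plane} {a b : ℝ} (h : P.VisArc x a b) :
    ∃ s ∈ Ioo b (a + P.L), s ∉ P.visible x :=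
  ⟨(b + (a + P.L)) / 2, ⟨by linarith [h.lt_add], by linarith [h.lt_add]⟩,
    h.invis _ ⟨by linarith [h.lt_add], by linarith [h.lt_add]⟩⟩

/-- For a defender in the hidden gap, the way to a visible `s` is `s` plus a constant. So the
maximizer does not depend on which hidden position is taken, and the circular problem becomes one on
an interval. -/
lemma VisArc.isLeftBreachingPoint_iff {x : Plane} {a b q ν : ℝ} (h : P.VisArc x a b)
    (hq : q ∈ Icc a b) : P.IsLeftBreachingPoint ν x q ↔
      ∀ s ∈ Icc a b, s - ‖P.γ s - x‖ / ν ≤ q - ‖P.γ q - x‖ / ν := by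
  have key : ∀ D ∈ Ioo b (a + P.L), ∀ s ∈ Icc a b, P.arc D s = s - D + P.L := fun D hD s hs =>
    arc_eq (k := -1) (by linarith [hD.2, hs.1]) (by linarith [hD.1, hs.2]) (by push_cast; ring)
  constructor
  · rintro ⟨-, hm⟩ s hs
    obtain ⟨D, hD, hDv⟩ := h.exists_notMem
    have := hm D hDv s (h.vis s hs)
    simp only [JL, key D hD s hs, key D hD q hq] at this
    linarith
  · refine fun hm => ⟨h.vis q hq, fun D hD s hs => ?_⟩
    obtain ⟨k, hk⟩ := exists_notMem_visible h hD
    obtain ⟨j, hj⟩ := h.exists_shift hs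
    have := hm _ hj
    rw [JL, JL, ← arc_add_left D s k, ← arc_add_left D q k, ← arc_add_right _ s j, key _ hk _ hj,
      key _ hk _ hq]
    rw [γ_add_zsmul] at this
    linarith

lemma VisArc.isRightBreachingPoint_iff {x : Plane} {a b q ν : ℝ} (h : P.VisArc x a b)
    (hq : q ∈ Icc a b) : P.IsRightBreachingPoint ν x q ↔
      ∀ s ∈ Icc a b, q + ‖P.γ q - x‖ / ν ≤ s + ‖P.γ s - x‖ / ν := by
  have key : ∀ D ∈ Ioo b (a + P.L), ∀ s ∈ Icc a b, P.arc s D = D - s := fun D hD s hs =>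
    arc_eq (k := 0) (by linarith [hD.1, hs.2]) (by linarith [hD.2, hs.1]) (by push_cast; ring)
  constructor
  · rintro ⟨-, hm⟩ s hs
    obtain ⟨D, hD, hDv⟩ := h.exists_notMem
    have := hm D hDv s (h.vis s hs)
    simp only [JR, key D hD s hs, key D hD q hq] at this
    linarith
  · refine fun hm => ⟨h.vis q hq, fun D hD s hs => ?_⟩
    obtain ⟨k, hk⟩ := exists_notMem_visible h hD
    obtain ⟨j, hj⟩ := h.exists_shift hs
    have := hm _ hj
    rw [JR, JR, ← arc_add_right s D k, ← arc_add_right q D k, ← arc_add_left s _ j, key _ hk _ hj,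
      key _ hk _ hq]
    rw [γ_add_zsmul] at this
    linarith

lemma isLeftBreachingPoint_add_zsmul {x : Plane} {s ν : ℝ} (k : ℤ) :
    P.IsLeftBreachingPoint ν x (s + k * P.L) ↔ P.IsLeftBreachingPoint ν x s := by
  simp only [IsLeftBreachingPoint, visible_add_zsmul, JL, arc_add_right, γ_add_zsmul]

lemma isRightBreachingPoint_add_zsmul {x : Plane} {s ν : ℝ} (k : ℤ) :
    P.IsRightBreachingPoint ν x (s + k * P.L) ↔ P.IsRightBreachingPoint ν x s := by
  simp only [IsRightBreachingPoint, visible_add_zsmul, JR, arc_add_left, γ_add_zsmul]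

lemma exists_add_zsmul_mem_Ico (P : Target) (c s : ℝ) : ∃ k : ℤ, s + k * P.L ∈ Ico c (c + P.L) := by
  refine ⟨-toIcoDiv P.L_pos c s, ?_⟩
  have h1 : s + (-toIcoDiv P.L_pos c s : ℤ) * P.L = toIcoMod P.L_pos c s := by
    rw [toIcoMod, zsmul_eq_mul]; push_cast; ring
  exact h1 ▸ toIcoMod_mem_Ico P.L_pos c s

lemma sL_spec {x : Plane} (hx : x ∉ P.region) (ν : ℝ) :
    P.sL ν x ∈ Ico 0 P.L ∧ P.IsLeftBreachingPoint ν x (P.sL ν x) := by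
  refine Classical.epsilon_spec (p := fun s => s ∈ Ico 0 P.L ∧ P.IsLeftBreachingPoint ν x s) ?_
  obtain ⟨a, b, h⟩ := exists_visArc hx
  have hc : Continuous fun s => s - ‖P.γ s - x‖ / ν :=
    continuous_id.sub ((P.continuous_γ.sub continuous_const).norm.div_const _)
  obtain ⟨q, hq, hm⟩ := isCompact_Icc.exists_isMaxOn ⟨a, left_mem_Icc.2 h.le⟩ hc.continuousOn
  obtain ⟨k, hk⟩ := P.exists_add_zsmul_mem_Ico 0 q
  rw [zero_add] at hk
  exact ⟨_, hk, (isLeftBreachingPoint_add_zsmul k).2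
    ((h.isLeftBreachingPoint_iff hq).2 fun s hs => hm hs)⟩

lemma sR_spec {x : Plane} (hx : x ∉ P.region) (ν : ℝ) :
    P.sR ν x ∈ Ico 0 P.L ∧ P.IsRightBreachingPoint ν x (P.sR ν x) := by
  refine Classical.epsilon_spec (p := fun s => s ∈ Ico 0 P.L ∧ P.IsRightBreachingPoint ν x s) ?_
  obtain ⟨a, b, h⟩ := exists_visArc hx
  have hc : Continuous fun s => s + ‖P.γ s - x‖ / ν :=
    continuous_id.add ((P.continuous_γ.sub continuous_const).norm.div_const _)
  obtain ⟨q, hq, hm⟩ := isCompact_Icc.exists_isMinOn ⟨a, left_mem_Icc.2 h.le⟩ hc.continuousOn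
  obtain ⟨k, hk⟩ := P.exists_add_zsmul_mem_Ico 0 q
  rw [zero_add] at hk
  exact ⟨_, hk, (isRightBreachingPoint_add_zsmul k).2
    ((h.isRightBreachingPoint_iff hq).2 fun s hs => hm hs)⟩

/-! ### The interval of safe defender positions -/

variable (P) in
/-- The first point of a visible arc of `x`. -/
noncomputable def va (x : Plane) : ℝ := Classical.epsilon fun a => ∃ b, P.VisArc x a b

variable (P) in
/-- The last point of the visible arc of `x` that starts at `va x`. -/
noncomputable def vb (x : Plane) : ℝ := Classical.epsilon fun b => P.VisArc x (P.va x) b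

lemma visArc {x : Plane} (hx : x ∉ P.region) : P.VisArc x (P.va x) (P.vb x) :=
  Classical.epsilon_spec (p := fun b => P.VisArc x (P.va x) b)
    (Classical.epsilon_spec (p := fun a => ∃ b, P.VisArc x a b) (exists_visArc hx))

variable (P) in
/-- The left breaching point on the visible arc from `va x` to `vb x`. -/
noncomputable def qL (ν : ℝ) (x : Plane) : ℝ := toIcoMod P.L_pos (P.va x) (P.sL ν x)

variable (P) in
/-- The right breaching point on the visible arc from `va x` to `vb x`. -/
noncomputable def qR (ν : ℝ) (x : Plane) : ℝ := toIcoMod P.L_pos (P.va x) (P.sR ν x)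

variable (P) in
/-- The largest lead of the defender's way to the left over the intruder's way. -/
noncomputable def lo (ν : ℝ) (x : Plane) : ℝ := P.qL ν x - ‖P.γ (P.qL ν x) - x‖ / ν

variable (P) in
/-- The counterpart of `lo` for the way to the right. -/
noncomputable def hi (ν : ℝ) (x : Plane) : ℝ := P.qR ν x + ‖P.γ (P.qR ν x) - x‖ / ν

variable (P) in
/-- The defender position on the afferent surface. -/
noncomputable def mid (ν : ℝ) (x : Plane) : ℝ := (P.lo ν x + P.hi ν x) / 2

variable (P) in
/-- The largest distance from `mid` at which the defender still holds the intruder. -/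
noncomputable def rad (ν : ℝ) (x : Plane) : ℝ := (P.hi ν x - P.lo ν x) / 2

lemma exists_qL_eq (P : Target) (ν : ℝ) (x : Plane) : ∃ k : ℤ, P.qL ν x = P.sL ν x + k * P.L :=
  ⟨-toIcoDiv P.L_pos (P.va x) (P.sL ν x), by rw [qL, toIcoMod, zsmul_eq_mul]; push_cast; ring⟩

lemma exists_qR_eq (P : Target) (ν : ℝ) (x : Plane) : ∃ k : ℤ, P.qR ν x = P.sR ν x + k * P.L :=
  ⟨-toIcoDiv P.L_pos (P.va x) (P.sR ν x), by rw [qR, toIcoMod, zsmul_eq_mul]; push_cast; ring⟩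

lemma γ_qL (ν : ℝ) (x : Plane) : P.γ (P.qL ν x) = P.γ (P.sL ν x) := by
  obtain ⟨k, hk⟩ := P.exists_qL_eq ν x
  rw [hk, γ_add_zsmul]

lemma γ_qR (ν : ℝ) (x : Plane) : P.γ (P.qR ν x) = P.γ (P.sR ν x) := by
  obtain ⟨k, hk⟩ := P.exists_qR_eq ν x
  rw [hk, γ_add_zsmul]

lemma VisArc.mem_of_visible {x : Plane} {a b s : ℝ} (h : P.VisArc x a b) (hs : s ∈ P.visible x)
    (hs' : s ∈ Ico a (a + P.L)) : s ∈ Icc a b :=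
  ⟨hs'.1, not_lt.1 fun hb => h.invis s ⟨hb, hs'.2⟩ hs⟩

variable {x : Plane} (hx : x ∉ P.region) {ν : ℝ}
include hx

lemma qL_mem (ν : ℝ) : P.qL ν x ∈ Icc (P.va x) (P.vb x) := by
  refine (visArc hx).mem_of_visible ?_ (toIcoMod_mem_Ico _ _ _)
  obtain ⟨k, hk⟩ := P.exists_qL_eq ν x
  rw [hk, visible_add_zsmul]
  exact (sL_spec hx ν).2.1

lemma qR_mem (ν : ℝ) : P.qR ν x ∈ Icc (P.va x) (P.vb x) := by
  refine (visArc hx).mem_of_visible ?_ (toIcoMod_mem_Ico _ _ _)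
  obtain ⟨k, hk⟩ := P.exists_qR_eq ν x
  rw [hk, visible_add_zsmul]
  exact (sR_spec hx ν).2.1

lemma sub_le_lo {s : ℝ} (hs : s ∈ Icc (P.va x) (P.vb x)) : s - ‖P.γ s - x‖ / ν ≤ P.lo ν x := by
  refine ((visArc hx).isLeftBreachingPoint_iff (qL_mem hx ν)).1 ?_ s hs
  obtain ⟨k, hk⟩ := P.exists_qL_eq ν x
  rw [hk, isLeftBreachingPoint_add_zsmul]
  exact (sL_spec hx ν).2

lemma hi_le_add {s : ℝ} (hs : s ∈ Icc (P.va x) (P.vb x)) : P.hi ν x ≤ s + ‖P.γ s - x‖ / ν := by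
  refine ((visArc hx).isRightBreachingPoint_iff (qR_mem hx ν)).1 ?_ s hs
  obtain ⟨k, hk⟩ := P.exists_qR_eq ν x
  rw [hk, isRightBreachingPoint_add_zsmul]
  exact (sR_spec hx ν).2

/-- Add the two optimality conditions, each tested at the other breaching point. -/
lemma qR_le_qL : P.qR ν x ≤ P.qL ν x := by
  have h1 := sub_le_lo (ν := ν) hx (qR_mem hx ν)
  have h2 := hi_le_add (ν := ν) hx (qL_mem hx ν)
  rw [lo] at h1
  rw [hi] at h2
  linarith

lemma qL_lt_qR_add : P.qL ν x < P.qR ν x + P.L := by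
  linarith [(qL_mem hx ν).2, (qR_mem hx ν).1, (visArc hx).lt_add]

variable (hν : 0 < ν) (hν1 : ν ≤ 1)
include hν hν1

/-- The arc between the breaching points is at most as long as the path through `x`
(`VisArc.sub_le_add`), and `1 ≤ 1 / ν`. -/
lemma rad_nonneg : 0 ≤ P.rad ν x := by
  have h := (visArc hx).sub_le_add hx (qR_mem hx ν).1 (qR_le_qL hx) (qL_mem hx ν).2
  have h1 : ∀ d : ℝ, 0 ≤ d → d ≤ d / ν := fun d hd => le_div_self hd hν hν1
  have h2 := h1 _ (norm_nonneg (P.γ (P.qR ν x) - x))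
  have h3 := h1 _ (norm_nonneg (P.γ (P.qL ν x) - x))
  rw [rad, hi, lo]
  linarith

lemma lo_le_hi : P.lo ν x ≤ P.hi ν x := by
  have := rad_nonneg hx hν hν1
  rw [rad] at this
  linarith

lemma abs_lo_sub_le {s : ℝ} (hs : s ∈ Icc (P.va x) (P.vb x)) :
    |P.lo ν x - s| ≤ ‖P.γ s - x‖ / ν ∧ |P.hi ν x - s| ≤ ‖P.γ s - x‖ / ν := by
  have h1 := sub_le_lo (ν := ν) hx hs
  have h2 := hi_le_add (ν := ν) hx hs
  have h3 := lo_le_hi hx hν hν1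
  constructor <;> rw [abs_le] <;> constructor <;> linarith

end Target

/-! ### Collinear vectors -/

lemma cross_eq_zero_trans {u w z : Plane} (hw : w ≠ 0) (h1 : cross u w = 0) (h2 : cross w z = 0) :
    cross u z = 0 := by
  have : w 0 ≠ 0 ∨ w 1 ≠ 0 := by
    by_contra! h
    exact hw (by ext i; fin_cases i <;> simp [h.1, h.2])
  simp only [cross] at h1 h2 ⊢
  rcases this with h | h
  · refine mul_left_cancel₀ h ?_
    linear_combination u 0 * h2 + z 0 * h1
  · refine mul_left_cancel₀ h ?_
    linear_combination u 1 * h2 + z 1 * h1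

lemma cross_eq_zero_of_inner_eq {u w : Plane} (h : ⟪u, w⟫ = ‖u‖ * ‖w‖) : cross u w = 0 := by
  have := inner_sq_add_cross_sq u w
  rw [h] at this
  exact pow_eq_zero_iff two_ne_zero |>.1 (by linarith [mul_pow ‖u‖ ‖w‖ 2])

lemma cross_eq_zero_of_norm_add_le {u e : Plane} (h : ‖u‖ + ‖e‖ ≤ ‖u + e‖) : cross u (u + e) = 0 := by
  have h1 := norm_add_sq_real u e
  have h2 := real_inner_le_norm u e
  have h3 := norm_nonneg u
  have h4 := norm_nonneg e
  rw [cross_add_right, cross_self, zero_add]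
  exact cross_eq_zero_of_inner_eq (le_antisymm h2 (by nlinarith))

/-- By Cauchy–Schwarz `‖w‖ (‖w‖ - ‖u‖) ≤ ⟪w, w - u⟫`. Equality throughout forces `u` and `w` to have
the same direction, and then `‖w - u‖ = ν ‖w - u‖`. -/
lemma norm_sub_norm_lt_or {u w : Plane} {ν : ℝ} (hν1 : ν ≤ 1) (hν : 0 < ν) (hw : w ≠ 0)
    (huw : u ≠ w) (h : ⟪w, w - u⟫ ≤ ν * (‖w‖ * ‖w - u‖)) :
    ‖w‖ - ‖u‖ < ν * ‖w - u‖ ∨ (ν = 1 ∧ cross u w = 0) := by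
  rw [or_iff_not_imp_left, not_lt]
  intro h1
  have hw' := norm_pos_iff.2 hw
  have he := norm_pos_iff.2 (sub_ne_zero.2 huw.symm)
  have h2 := real_inner_le_norm u w
  rw [inner_sub_right, real_inner_self_eq_norm_sq, real_inner_comm] at h
  have h3 : ‖w‖ * (‖w‖ - ‖u‖ - ν * ‖w - u‖) ≤ 0 := by nlinarith
  have h4 : ‖w‖ - ‖u‖ = ν * ‖w - u‖ := by
    have : 0 ≤ ‖w‖ * (‖w‖ - ‖u‖ - ν * ‖w - u‖) := mul_nonneg hw'.le (by linarith)
    have := (mul_eq_zero.1 (le_antisymm h3 this)).resolve_left hw'.ne'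
    linarith
  have h5 : ⟪u, w⟫ = ‖u‖ * ‖w‖ := by
    refine le_antisymm h2 ?_
    have : ‖w‖ * (‖w‖ - ‖u‖) = ‖w‖ * (ν * ‖w - u‖) := by rw [h4]
    nlinarith
  refine ⟨?_, cross_eq_zero_of_inner_eq h5⟩
  have h6 := norm_sub_sq_real w u
  rw [real_inner_comm, h5] at h6
  have h7 : ‖w - u‖ ^ 2 = (ν * ‖w - u‖) ^ 2 := by rw [h6, ← h4]; ring
  have h8 := abs_eq_abs.2 (sq_eq_sq_iff_eq_or_eq_neg.1 h7)
  rw [abs_of_pos he, abs_of_pos (mul_pos hν he)] at h8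
  nlinarith

namespace Target

variable {P : Target}

/-! ### The midpoint of the interval of safe positions -/

lemma VisArc.inner_le_of_isMin {x : Plane} {a b s s' ν : ℝ} (h : P.VisArc x a b)
    (hx : x ∉ P.region) (hν : 0 < ν) (hs : a ≤ s) (hss' : s < s') (hs' : s' ≤ b)
    (hmin : ∀ σ ∈ Icc s s', s + ‖P.γ s - x‖ / ν ≤ σ + ‖P.γ σ - x‖ / ν) :
    ⟪P.γ s - x, P.γ s - P.γ s'⟫ ≤ ν * (‖P.γ s - x‖ * ‖P.γ s - P.γ s'‖) := by
  have := h.reflect.inner_le_of_isMax (s := -s') (s' := -s) (ν := ν)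
    (by simpa [mem_reflect_region] using hx) hν
    (by linarith) (by linarith) (by linarith) (fun σ hσ => by
      have := hmin (-σ) ⟨by linarith [hσ.2], by linarith [hσ.1]⟩
      simp only [reflect_γ, neg_neg, ← map_sub, LinearIsometryEquiv.norm_map]
      linarith)
  simpa only [reflect_γ, neg_neg, ← map_sub, LinearIsometryEquiv.inner_map_map,
    LinearIsometryEquiv.norm_map] using this

section

variable {x : Plane} (hx : x ∉ P.region) {ν : ℝ} (hν : 0 < ν) (hν1 : ν ≤ 1)
include hx hν hν1

/-- The angle bounds at the two breaching points give this inequality; its strictness keeps `mid`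
off the breaching points and off the points opposite to them. -/
lemma abs_norm_sub_norm_lt (hlt : P.qR ν x < P.qL ν x) :
    |‖P.γ (P.qL ν x) - x‖ - ‖P.γ (P.qR ν x) - x‖| < ν * ‖P.γ (P.qL ν x) - P.γ (P.qR ν x)‖ := by
  have ha := visArc hx
  have hp := qR_mem hx ν
  have hq := qL_mem hx ν
  have hu : ∀ s, P.γ s - x ≠ 0 := fun s => sub_ne_zero.2 (P.γ_ne hx s)
  have hne : P.γ (P.qR ν x) ≠ P.γ (P.qL ν x) := fun h => hlt.ne (P.γ_inj h (by
    rw [abs_lt]; constructor <;> linarith [qL_lt_qR_add (ν := ν) hx, P.L_pos]))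
  have cl := ha.inner_le_of_isMax hx hν hp.1 hlt hq.2
    fun σ hσ => sub_le_lo hx ⟨hp.1.trans hσ.1, hσ.2.trans hq.2⟩
  have cr := ha.inner_le_of_isMin hx hν hp.1 hlt hq.2
    fun σ hσ => hi_le_add hx ⟨hp.1.trans hσ.1, hσ.2.trans hq.2⟩
  -- For `ν = 1`, optimality against the ends of the visible arc turns the triangle inequality into
  -- an equality: `vb` is in line with `qL`, and `va` with `qR`, as seen from `x`. If `qR` and `qL`
  -- were in line too, so would be the two ends, contrary to `neg`.
  have key : ν = 1 → cross (P.γ (P.qR ν x) - x) (P.γ (P.qL ν x) - x) ≠ 0 := by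
    intro hν2 hcr
    have h1 := sub_le_lo (ν := ν) hx (right_mem_Icc.2 ha.le)
    have h2 := hi_le_add (ν := ν) hx (left_mem_Icc.2 ha.le)
    rw [lo, hν2, div_one, div_one, ← hν2] at h1
    rw [hi, hν2, div_one, div_one, ← hν2] at h2
    have e1 : cross (P.γ (P.qL ν x) - x) (P.γ (P.vb x) - x) = 0 := by
      have := P.norm_γ_sub_le (P.vb x) (P.qL ν x)
      rw [abs_of_nonneg (by linarith [hq.2])] at this
      have := cross_eq_zero_of_norm_add_le (u := P.γ (P.qL ν x) - x)
        (e := P.γ (P.vb x) - P.γ (P.qL ν x)) (by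
          rw [sub_add_sub_cancel']; linarith)
      rwa [sub_add_sub_cancel'] at this
    have e2 : cross (P.γ (P.qR ν x) - x) (P.γ (P.va x) - x) = 0 := by
      have := P.norm_γ_sub_le (P.va x) (P.qR ν x)
      rw [abs_sub_comm, abs_of_nonneg (by linarith [hp.1])] at this
      have := cross_eq_zero_of_norm_add_le (u := P.γ (P.qR ν x) - x)
        (e := P.γ (P.va x) - P.γ (P.qR ν x)) (by
          rw [sub_add_sub_cancel']; linarith)
      rwa [sub_add_sub_cancel'] at this
    rw [cross_swap, neg_eq_zero] at e2
    exact ha.neg.ne (cross_eq_zero_trans (hu _) (cross_eq_zero_trans (hu _) e2 hcr) e1)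
  rw [abs_lt]
  constructor
  · rcases norm_sub_norm_lt_or (u := P.γ (P.qL ν x) - x) (w := P.γ (P.qR ν x) - x) hν1 hν (hu _)
      (by simpa using hne.symm) (by simpa using cr) with h | ⟨h, h'⟩
    · rw [sub_sub_sub_cancel_right, norm_sub_rev (P.γ _) (P.γ _)] at h
      linarith
    · rw [cross_swap, neg_eq_zero] at h'
      exact absurd h' (key h)
  · rcases norm_sub_norm_lt_or (u := P.γ (P.qR ν x) - x) (w := P.γ (P.qL ν x) - x) hν1 hν (hu _)
      (by simpa using hne) (by simpa using cl) with h | ⟨h, h'⟩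
    · rwa [sub_sub_sub_cancel_right] at h
    · exact absurd h' (key h)

/-- `mid` is the middle of the arc from `qR` to `qL`, displaced by half the difference of the
distances divided by `ν`. That quotient is smaller in modulus than the chord, and the chord is at
most as long as either perimeter arc between the two points. -/
lemma mid_bounds : P.mid ν x < P.qR ν x + P.L / 2 ∧ P.qL ν x - P.L / 2 < P.mid ν x ∧
    (P.qR ν x < P.qL ν x → P.qR ν x < P.mid ν x ∧ P.mid ν x < P.qL ν x) := by
  rcases (qR_le_qL (ν := ν) hx).lt_or_eq with hlt | heq
  · have h := abs_norm_sub_norm_lt hx hν hν1 hlt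
    have h1 := P.norm_γ_sub_le (P.qL ν x) (P.qR ν x)
    have h2 := P.norm_γ_sub_le (P.qR ν x + P.L) (P.qL ν x)
    rw [P.periodic, norm_sub_rev] at h2
    rw [abs_of_pos (by linarith)] at h1
    rw [abs_of_pos (by linarith [qL_lt_qR_add (ν := ν) hx])] at h2
    have h3 : |‖P.γ (P.qL ν x) - x‖ - ‖P.γ (P.qR ν x) - x‖| / ν <
        ‖P.γ (P.qL ν x) - P.γ (P.qR ν x)‖ := by rw [div_lt_iff₀ hν]; linarith
    rw [← abs_of_pos hν, ← abs_div, abs_of_pos hν, sub_div, abs_lt] at h3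
    rw [mid, lo, hi]
    exact ⟨by linarith, by linarith, fun _ => ⟨by linarith, by linarith⟩⟩
  · have : P.mid ν x = P.qL ν x := by rw [mid, lo, hi, heq]; ring
    exact ⟨by linarith [P.L_pos], by linarith [P.L_pos], fun h => absurd h heq.not_lt⟩

lemma mid_mem_Icc : P.mid ν x ∈ Icc (P.qR ν x) (P.qL ν x) := by
  rcases (qR_le_qL (ν := ν) hx).lt_or_eq with hlt | heq
  · have := (mid_bounds hx hν hν1).2.2 hlt
    exact ⟨this.1.le, this.2.le⟩
  · have : P.mid ν x = P.qL ν x := by rw [mid, lo, hi, heq]; ring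
    exact ⟨by linarith, by linarith⟩

end

/-! ### The distance along the perimeter -/

/-- The length of the shorter perimeter arc between `s` and `t`. -/
noncomputable def cdist (P : Target) (s t : ℝ) : ℝ := ‖((s - t : ℝ) : AddCircle P.L)‖

lemma coe_add_zsmul (s : ℝ) (k : ℤ) : ((s + k * P.L : ℝ) : AddCircle P.L) = s := by
  rw [AddCircle.coe_add, ← zsmul_eq_mul, AddCircle.coe_zsmul, AddCircle.coe_period, smul_zero,
    add_zero]

lemma cdist_eq_abs {s t : ℝ} {k : ℤ} (h : |s - t + k * P.L| ≤ P.L / 2) :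
    P.cdist s t = |s - t + k * P.L| := by
  rw [cdist, ← coe_add_zsmul (s - t) k]
  exact (AddCircle.norm_coe_eq_abs_iff _ P.L_pos.ne').2 (by rwa [abs_of_pos P.L_pos])

lemma exists_cdist_eq (P : Target) (s t : ℝ) : ∃ k : ℤ, P.cdist s t = |s - t + k * P.L| ∧
    s - t + k * P.L ∈ Ico (-(P.L / 2)) (P.L / 2) := by
  obtain ⟨k, hk⟩ := P.exists_add_zsmul_mem_Ico (-(P.L / 2)) (s - t)
  have : s - t + k * P.L < P.L / 2 := by linarith [hk.2]
  exact ⟨k, cdist_eq_abs (abs_le.2 ⟨hk.1, this.le⟩), hk.1, this⟩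

lemma cdist_le_half (s t : ℝ) : P.cdist s t ≤ P.L / 2 := by
  obtain ⟨k, h, h'⟩ := P.exists_cdist_eq s t
  rw [h, abs_le]
  exact ⟨h'.1, h'.2.le⟩

lemma cdist_nonneg (s t : ℝ) : 0 ≤ P.cdist s t := norm_nonneg _

lemma norm_coe_le (r : ℝ) (k : ℤ) : ‖((r : ℝ) : AddCircle P.L)‖ ≤ |r + k * P.L| := by
  obtain ⟨j, h, h'⟩ := P.exists_cdist_eq r 0
  rw [cdist, sub_zero] at h
  rw [sub_zero] at h'
  rcases eq_or_ne j k with rfl | hne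
  · exact h.le
  · have h1 : (1 : ℝ) ≤ |((k - j : ℤ) : ℝ)| := by
      exact_mod_cast Int.one_le_abs (sub_ne_zero.2 hne.symm)
    have h2 : P.L ≤ |((k - j : ℤ) : ℝ) * P.L| := by
      rw [abs_mul, abs_of_pos P.L_pos]
      nlinarith [P.L_pos]
    have h3 : |r + j * P.L| ≤ P.L / 2 := abs_le.2 ⟨h'.1, h'.2.le⟩
    have h4 := abs_sub_abs_le_abs_sub (((k - j : ℤ) : ℝ) * P.L) (-(r + j * P.L))
    rw [abs_neg] at h4
    rw [h]
    have h5 : ((k - j : ℤ) : ℝ) * P.L - -(r + j * P.L) = r + k * P.L := by push_cast; ring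
    rw [h5] at h4
    linarith

lemma cdist_le (s t : ℝ) (k : ℤ) : P.cdist s t ≤ |s - t + k * P.L| := norm_coe_le _ k

lemma cdist_le_abs (s t : ℝ) : P.cdist s t ≤ |s - t| := by simpa using P.cdist_le s t 0

lemma cdist_comm (s t : ℝ) : P.cdist s t = P.cdist t s := by
  rw [cdist, cdist, ← neg_sub, AddCircle.coe_neg, norm_neg]

lemma cdist_triangle (s t r : ℝ) : P.cdist s r ≤ P.cdist s t + P.cdist t r := by
  rw [cdist, cdist, cdist, ← sub_add_sub_cancel s t r, AddCircle.coe_add]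
  exact norm_add_le _ _

lemma cdist_add_left (s t : ℝ) (k : ℤ) : P.cdist (s + k * P.L) t = P.cdist s t := by
  rw [cdist, cdist, add_sub_right_comm, coe_add_zsmul]

lemma cdist_add_right (s t : ℝ) (k : ℤ) : P.cdist s (t + k * P.L) = P.cdist s t := by
  rw [cdist_comm, cdist_add_left, cdist_comm]

lemma continuous_cdist : Continuous fun z : ℝ × ℝ => P.cdist z.1 z.2 := by
  have : Continuous fun r : ℝ => (r : AddCircle P.L) := AddCircle.continuous_mk' _
  exact (this.comp (continuous_fst.sub continuous_snd)).norm

/-! ### The function `V` in terms of the midpoint -/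

section

variable {x : Plane} (hx : x ∉ P.region) {ν : ℝ} (hν : 0 < ν) (hν1 : ν ≤ 1)
include hx

/-- The defender's position is normalized to `[qR, qR + L)`. There both critical values are affine
in it, except that the way to the left breaching point jumps by `L` once the defender is past `qL`.
-/
lemma star_eq (sD : ℝ) : ∃ k : ℤ, sD + k * P.L ∈ Ico (P.qR ν x) (P.qR ν x + P.L) ∧
    (sD ∈ P.segment (P.sR ν x) (P.sL ν x) ↔ sD + k * P.L ≤ P.qL ν x) ∧
    P.JRstar ν sD x = sD + k * P.L - P.hi ν x ∧
    P.JLstar ν sD x = P.lo ν x - (sD + k * P.L) + if sD + k * P.L ≤ P.qL ν x then 0 else P.L := by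
  obtain ⟨k, hk⟩ := P.exists_add_zsmul_mem_Ico (P.qR ν x) sD
  obtain ⟨jL, hL⟩ := P.exists_qL_eq ν x
  obtain ⟨jR, hR⟩ := P.exists_qR_eq ν x
  have h1 := qR_le_qL (ν := ν) hx
  have h2 := qL_lt_qR_add (ν := ν) hx
  have e1 : P.arc (P.sR ν x) (P.sL ν x) = P.qL ν x - P.qR ν x := by
    rw [← arc_add_left _ _ jR, ← arc_add_right _ _ jL, ← hL, ← hR]
    exact arc_eq (k := 0) (by linarith) (by linarith) (by push_cast; ring)
  have e2 : P.arc (P.sR ν x) sD = sD + k * P.L - P.qR ν x := by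
    rw [← arc_add_left _ _ jR, ← arc_add_right _ _ k, ← hR]
    exact arc_eq (k := 0) (by linarith [hk.1]) (by linarith [hk.2]) (by push_cast; ring)
  refine ⟨k, hk, ?_, ?_, ?_⟩
  · rw [segment, mem_ofPred_eq, e1, e2]
    constructor <;> intro h <;> linarith
  · rw [JRstar, JR, e2, ← γ_qR, hi]; ring
  · rw [JLstar, JL, ← γ_qL, lo]
    have e3 : P.arc sD (P.sL ν x) =
        P.qL ν x - (sD + k * P.L) + if sD + k * P.L ≤ P.qL ν x then 0 else P.L := by
      rw [← arc_add_left _ _ k, ← arc_add_right _ _ jL, ← hL]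
      split_ifs with h
      · exact arc_eq (k := 0) (by linarith) (by linarith [hk.1]) (by push_cast; ring)
      · exact arc_eq (k := -1) (by linarith [hk.2]) (by linarith) (by push_cast; ring)
    rw [e3]; ring

include hν hν1

/-- For the normalized position `D`, `JLstar - JRstar` is `2 (mid - D)` up to `qL` and `2 (mid - D)
+ L` beyond. So the two clauses of the definition, with their opposite signs, express one condition
on the gap from the defender to `mid`. -/
lemma mem_leftRegion_iff (sD : ℝ) :
    x ∈ P.leftRegion ν sD ↔ ∃ k : ℤ, P.mid ν x - sD + k * P.L ∈ Ioo 0 (P.L / 2) := by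
  obtain ⟨k, hk, hs, hR, hL⟩ := star_eq hx (ν := ν) sD
  obtain ⟨h1, h2, -⟩ := mid_bounds hx hν hν1
  obtain ⟨h3, h4⟩ := mid_mem_Icc hx hν hν1
  have hLp := P.L_pos
  have hm : P.lo ν x + P.hi ν x = 2 * P.mid ν x := by rw [mid]; ring
  have uniq : ∀ j : ℤ, |(j : ℝ) * P.L| < P.L → j = 0 := fun j hj => by
    rw [abs_mul, abs_of_pos hLp] at hj
    have h5 : |(j : ℝ)| < 1 := by nlinarith
    exact Int.abs_lt_one_iff.1 (by exact_mod_cast h5)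
  rw [leftRegion, mem_ofPred_eq, hs, hR, hL]
  constructor
  · rintro ⟨-, ⟨h, h'⟩ | ⟨h, h'⟩⟩
    · rw [if_pos h] at h'
      refine ⟨-k, ?_, ?_⟩ <;> push_cast <;> linarith [hk.1]
    · rw [if_neg h] at h'
      refine ⟨-k + 1, ?_, ?_⟩ <;> push_cast <;> linarith [hk.2]
  · rintro ⟨j, hj⟩
    refine ⟨hx, ?_⟩
    by_cases h : sD + k * P.L ≤ P.qL ν x
    · refine Or.inl ⟨h, ?_⟩
      rw [if_pos h]
      have : j + k = 0 := uniq _ (by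
        push_cast; rw [abs_lt]; constructor <;> linarith [hj.1, hj.2, hk.1])
      have : (j : ℝ) = -k := by exact_mod_cast eq_neg_of_add_eq_zero_left this
      rw [this] at hj
      linarith [hj.1]
    · refine Or.inr ⟨h, ?_⟩
      rw [if_neg h]
      have : j + k - 1 = 0 := uniq _ (by
        push_cast; rw [abs_lt]; constructor <;> linarith [hj.1, hj.2, hk.1, hk.2])
      have : (j : ℝ) = -k + 1 := by exact_mod_cast (by linarith : j = -k + 1)
      rw [this] at hj
      linarith [hj.2]

/-- `lo - D` and `D - hi` measure how far the defender misses the interval of radius `rad` around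
`mid` on either side, and the test for the left region selects the shorter way round to `mid`. -/
lemma V_eq (sD : ℝ) : P.V ν sD x = P.cdist sD (P.mid ν x) - P.rad ν x := by
  obtain ⟨k, hk, hs, hR, hL⟩ := star_eq hx (ν := ν) sD
  obtain ⟨h1, h2, -⟩ := mid_bounds hx hν hν1
  obtain ⟨h3, h4⟩ := mid_mem_Icc hx hν hν1
  have hLp := P.L_pos
  have hm : P.lo ν x + P.hi ν x = 2 * P.mid ν x := by rw [mid]; ring
  have hr : P.hi ν x - P.lo ν x = 2 * P.rad ν x := by rw [rad]; ring
  rw [V]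
  split_ifs with h
  · obtain ⟨-, ⟨h, h'⟩ | ⟨h, h'⟩⟩ := h
    · rw [hs] at h
      rw [hR, hL, if_pos h] at h'
      rw [hL, if_pos h, cdist_eq_abs (k := k), abs_of_neg] <;> [linarith; linarith; skip]
      rw [abs_of_neg] <;> linarith [hk.1]
    · rw [hs] at h
      rw [hR, hL, if_neg h] at h'
      have : |sD - P.mid ν x + ((k - 1 : ℤ) : ℝ) * P.L| = P.mid ν x + P.L - (sD + k * P.L) := by
        rw [abs_of_nonpos] <;> push_cast <;> linarith [hk.2]
      rw [hL, if_neg h, cdist_eq_abs (k := k - 1), this]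
      · linarith
      · rw [this]; linarith
  · rw [leftRegion, mem_ofPred_eq, hs, hR, hL] at h
    rw [hR, cdist_eq_abs (k := k), abs_of_nonneg]
    · linarith
    · by_contra! hlt
      exact h ⟨hx, Or.inl ⟨by linarith, by rw [if_pos (by linarith)]; linarith⟩⟩
    · by_cases h' : sD + k * P.L ≤ P.qL ν x
      · rw [abs_le]; constructor <;> linarith [hk.1]
      · have : ¬ P.mid ν x + P.L / 2 < sD + k * P.L := fun hlt =>
          h ⟨hx, Or.inr ⟨h', by rw [if_neg h']; linarith⟩⟩
        rw [abs_le]; constructor <;> linarith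

lemma mem_afferent_iff (sD : ℝ) : x ∈ P.afferent ν sD ↔ P.cdist sD (P.mid ν x) = 0 := by
  obtain ⟨k, hk, hs, hR, hL⟩ := star_eq hx (ν := ν) sD
  obtain ⟨h3, h4⟩ := mid_mem_Icc hx hν hν1
  obtain ⟨h1, h2, -⟩ := mid_bounds hx hν hν1
  have hm : P.lo ν x + P.hi ν x = 2 * P.mid ν x := by rw [mid]; ring
  rw [afferent, mem_ofPred_eq, hs, hR, hL]
  constructor
  · rintro ⟨-, h, h'⟩
    rw [if_pos h] at h'
    have : sD - P.mid ν x + k * P.L = 0 := by linarith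
    have := cdist_eq_abs (P := P) (s := sD) (t := P.mid ν x) (k := k)
      (by rw [this, abs_zero]; linarith [P.L_pos])
    rw [this, abs_eq_zero]; linarith
  · intro h
    obtain ⟨j, hj, -⟩ := P.exists_cdist_eq sD (P.mid ν x)
    rw [h, eq_comm, abs_eq_zero] at hj
    have h5 : |((j - k : ℤ) : ℝ)| < 1 := by
      have : |((j - k : ℤ) : ℝ) * P.L| < 1 * P.L := by
        push_cast; rw [abs_lt]; constructor <;> linarith [hk.1, hk.2, qL_lt_qR_add (ν := ν) hx]
      rw [abs_mul, abs_of_pos P.L_pos] at this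
      exact lt_of_mul_lt_mul_right this P.L_pos.le
    have h6 : j - k = 0 := Int.abs_lt_one_iff.1 (by exact_mod_cast h5)
    rw [sub_eq_zero.1 h6] at hj
    have : sD + k * P.L ≤ P.qL ν x := by linarith
    refine ⟨hx, this, ?_⟩
    rw [if_pos this]; linarith

end

end Target

namespace Target

variable {P : Target}

/-! ### Dependence on the intruder's position -/

/-- A line separates the whole move from the target. The perimeter point `s₀` that is lowest
relative to it is visible from both ends of the move, so it serves to lift the two visible arcs
consistently. -/
lemma exists_minimizer {x y : Plane} (hd : Disjoint (_root_.segment ℝ x y) P.region) :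
    ∃ (e : Plane) (s₀ : ℝ), (∀ p ∈ P.region, ⟪e, P.γ s₀⟫ ≤ ⟪e, p⟫) ∧ ⟪e, x⟫ < ⟪e, P.γ s₀⟫ ∧
      ⟪e, y⟫ < ⟪e, P.γ s₀⟫ := by
  have hc : IsCompact (_root_.segment ℝ x y) := by
    rw [segment_eq_image_lineMap]
    exact isCompact_Icc.image (AffineMap.lineMap_continuous)
  obtain ⟨f, u, v, hu, huv, hv⟩ := geometric_hahn_banach_compact_closed (convex_segment x y) hc
    P.convex_region P.isCompact_region.isClosed hd
  obtain ⟨e, rfl⟩ := (InnerProductSpace.toDual ℝ Plane).surjective f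
  simp only [InnerProductSpace.toDual_apply_apply] at hu hv
  have hcont : Continuous fun p : Plane => ⟪e, p⟫ := continuous_const.inner continuous_id
  obtain ⟨p, hp, hm⟩ := P.isCompact_region.exists_isMinOn
    (P.interior_nonempty.mono interior_subset) hcont.continuousOn
  have hx := (hu x (left_mem_segment ℝ x y)).trans (huv.trans (hv p hp))
  have hy := (hu y (right_mem_segment ℝ x y)).trans (huv.trans (hv p hp))
  have hpf : p ∈ frontier P.region := by
    rw [P.isCompact_region.isClosed.frontier_eq]
    refine ⟨hp, fun hi => ?_⟩
    have h1 : Tendsto (fun t : ℝ => p + t • (x - p)) (𝓝[>] 0) (𝓝 p) := by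
      have : ContinuousAt (fun t : ℝ => p + t • (x - p)) 0 := by fun_prop
      simpa [ContinuousAt] using this.mono_left (nhdsWithin_le_nhds (s := Ioi 0))
    obtain ⟨t, ht, ht0⟩ := ((h1.eventually (mem_interior_iff_mem_nhds.1 hi)).and
      self_mem_nhdsWithin).exists
    have h2 : ⟪e, p⟫ ≤ ⟪e, p + t • (x - p)⟫ := hm ht
    rw [inner_add_right, inner_smul_right, inner_sub_right] at h2
    have : (0 : ℝ) < t := ht0
    nlinarith
  obtain ⟨s₀, rfl⟩ := P.range_eq ▸ hpf
  exact ⟨e, s₀, fun q hq => hm hq, hx, hy⟩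

lemma mem_visible_of_inner {x e : Plane} {s₀ : ℝ} (he : ∀ p ∈ P.region, ⟪e, P.γ s₀⟫ ≤ ⟪e, p⟫)
    (hx : ⟪e, x⟫ < ⟪e, P.γ s₀⟫) : s₀ ∈ P.visible x := by
  rintro p ⟨c, d, hc, hd, hcd, rfl⟩ hp
  have := he _ (interior_subset hp)
  rw [inner_add_right, inner_smul_right, inner_smul_right] at this
  have h1 : ⟪e, P.γ s₀⟫ = c * ⟪e, P.γ s₀⟫ + d * ⟪e, P.γ s₀⟫ := by rw [← add_mul, hcd, one_mul]
  nlinarith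

/-- If `s₁` is visible from `x`, take it as the witness; otherwise take the end of the visible arc
on its side. -/
lemma VisArc.exists_norm_add_abs_le {x y e : Plane} {a b a' b' s₀ s₁ : ℝ} (hx : P.VisArc x a b)
    (hy : P.VisArc y a' b') (hxT : x ∉ P.region) (he : ∀ p ∈ P.region, ⟪e, P.γ s₀⟫ ≤ ⟪e, p⟫)
    (hex : ⟪e, x⟫ < ⟪e, P.γ s₀⟫) (hey : ⟪e, y⟫ < ⟪e, P.γ s₀⟫) (hs₀ : s₀ ∈ Icc a b)
    (hs₀' : s₀ ∈ Icc a' b') (hs₁ : s₁ ∈ Icc a' b') :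
    ∃ s ∈ Icc a b, ‖P.γ s - x‖ + |s₁ - s| ≤ ‖x - y‖ + ‖P.γ s₁ - y‖ := by
  rcases lt_or_ge b s₁ with hb | hb
  · refine ⟨b, right_mem_Icc.2 hx.le, ?_⟩
    rw [abs_of_pos (sub_pos.2 hb)]
    exact hx.add_sub_le_of_right hy hxT he hex hey hs₀ hs₀' hb hs₁.2
  rcases lt_or_ge s₁ a with ha | ha
  · refine ⟨a, left_mem_Icc.2 hx.le, ?_⟩
    rw [abs_sub_comm, abs_of_pos (sub_pos.2 ha)]
    exact hx.add_sub_le_of_left hy hxT he hex hey hs₀ hs₀' ha hs₁.1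
  · refine ⟨s₁, ⟨ha, hb⟩, ?_⟩
    rw [sub_self, abs_zero, add_zero, norm_sub_rev x y, add_comm]
    exact norm_sub_le_norm_sub_add_norm_sub _ _ _

lemma exists_lo_hi_le {x y e : Plane} {s₀ : ℝ} (hxT : x ∉ P.region) (hyT : y ∉ P.region)
    (he : ∀ p ∈ P.region, ⟪e, P.γ s₀⟫ ≤ ⟪e, p⟫) (hex : ⟪e, x⟫ < ⟪e, P.γ s₀⟫)
    (hey : ⟪e, y⟫ < ⟪e, P.γ s₀⟫) {k j : ℤ}
    (hs₀ : s₀ ∈ Icc (P.va x + k * P.L) (P.vb x + k * P.L))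
    (hs₀' : s₀ ∈ Icc (P.va y + j * P.L) (P.vb y + j * P.L)) {ν : ℝ} (hν : 0 < ν) (hν1 : ν ≤ 1) :
    P.lo ν y + j * P.L ≤ P.lo ν x + k * P.L + ‖x - y‖ / ν ∧
      P.hi ν x + k * P.L ≤ P.hi ν y + j * P.L + ‖x - y‖ / ν := by
  have hax := (visArc hxT).shift k
  have hay := (visArc hyT).shift j
  have key : ∀ s₁ ∈ Icc (P.va y) (P.vb y), ∃ s ∈ Icc (P.va x) (P.vb x),
      ‖P.γ s - x‖ / ν + |s₁ + j * P.L - (s + k * P.L)| ≤ ‖x - y‖ / ν + ‖P.γ s₁ - y‖ / ν := by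
    intro s₁ hs₁
    obtain ⟨s, hs, h⟩ := hax.exists_norm_add_abs_le hay hxT he hex hey hs₀ hs₀'
      (s₁ := s₁ + j * P.L) ⟨by linarith [hs₁.1], by linarith [hs₁.2]⟩
    refine ⟨s - k * P.L, ⟨by linarith [hs.1], by linarith [hs.2]⟩, ?_⟩
    have e1 : P.γ (s - k * P.L) = P.γ s := by rw [← P.γ_add_zsmul (s - k * P.L) k, sub_add_cancel]
    rw [γ_add_zsmul] at h
    rw [e1, sub_add_cancel, ← add_div]
    -- The walk along the perimeter is timed at the defender's speed 1, which is no slower than the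
    -- intruder's.
    have h1 := le_div_self (abs_nonneg (s₁ + j * P.L - s)) hν hν1
    calc _ ≤ ‖P.γ s - x‖ / ν + |s₁ + j * P.L - s| / ν := by linarith
      _ = (‖P.γ s - x‖ + |s₁ + j * P.L - s|) / ν := by rw [add_div]
      _ ≤ _ := by gcongr
  constructor
  · obtain ⟨s, hs, h⟩ := key _ (qL_mem hyT ν)
    have := sub_le_lo (ν := ν) hxT hs
    have := le_abs_self (P.qL ν y + j * P.L - (s + k * P.L))
    rw [lo]
    linarith
  · obtain ⟨s, hs, h⟩ := key _ (qR_mem hyT ν)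
    have := hi_le_add (ν := ν) hxT hs
    have := neg_abs_le (P.qR ν y + j * P.L - (s + k * P.L))
    rw [hi, hi] at *
    linarith

/-- The end points of the interval of safe positions move at most as fast as the intruder's
clock runs; the shift does not depend on the speed ratio. -/
lemma exists_abs_sub_le {x y : Plane} (hx : x ∉ P.region) (hy : y ∉ P.region)
    (hd : Disjoint (_root_.segment ℝ x y) P.region) :
    ∃ k : ℤ, ∀ ν, 0 < ν → ν ≤ 1 → |P.lo ν y - P.lo ν x + k * P.L| ≤ ‖x - y‖ / ν ∧
      |P.hi ν y - P.hi ν x + k * P.L| ≤ ‖x - y‖ / ν := by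
  obtain ⟨e, s₀, he, hex, hey⟩ := exists_minimizer hd
  obtain ⟨k, hk⟩ := (visArc hx).exists_shift (mem_visible_of_inner he hex)
  obtain ⟨j, hj⟩ := (visArc hy).exists_shift (mem_visible_of_inner he hey)
  have hk' : s₀ ∈ Icc (P.va x + (-k : ℤ) * P.L) (P.vb x + (-k : ℤ) * P.L) := by
    push_cast; exact ⟨by linarith [hk.1], by linarith [hk.2]⟩
  have hj' : s₀ ∈ Icc (P.va y + (-j : ℤ) * P.L) (P.vb y + (-j : ℤ) * P.L) := by
    push_cast; exact ⟨by linarith [hj.1], by linarith [hj.2]⟩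
  refine ⟨k - j, fun ν hν hν1 => ?_⟩
  obtain ⟨h1, h2⟩ := exists_lo_hi_le hx hy he hex hey hk' hj' hν hν1
  obtain ⟨h3, h4⟩ := exists_lo_hi_le hy hx he hey hex hj' hk' hν hν1
  rw [norm_sub_rev y x] at h3 h4
  push_cast at *
  constructor <;> rw [abs_le] <;> constructor <;> linarith

lemma exists_abs_mid_rad_sub_le {x y : Plane} (hx : x ∉ P.region) (hy : y ∉ P.region)
    (hd : Disjoint (_root_.segment ℝ x y) P.region) :
    ∃ k : ℤ, ∀ ν, 0 < ν → ν ≤ 1 → |P.mid ν y - P.mid ν x + k * P.L| ≤ ‖x - y‖ / ν ∧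
      |P.rad ν y - P.rad ν x| ≤ ‖x - y‖ / ν := by
  obtain ⟨k, hk⟩ := exists_abs_sub_le hx hy hd
  refine ⟨k, fun ν hν hν1 => ?_⟩
  obtain ⟨h1, h2⟩ := hk ν hν hν1
  rw [abs_le] at h1 h2
  rw [mid, mid, rad, rad]
  constructor <;> rw [abs_le] <;> constructor <;> linarith [h1.1, h1.2, h2.1, h2.2]

lemma cdist_le_of_abs {s t s' t' c : ℝ} {k : ℤ} (h : |(s - t) - (s' - t') + k * P.L| ≤ c) :
    P.cdist s t ≤ P.cdist s' t' + c := by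
  have h1 := (norm_coe_le (P := P) ((s - t) - (s' - t')) k).trans h
  rw [cdist, cdist]
  have := norm_add_le (((s - t) - (s' - t') : ℝ) : AddCircle P.L) ((s' - t' : ℝ) : AddCircle P.L)
  rw [← AddCircle.coe_add, sub_add_cancel] at this
  linarith

lemma abs_V_sub_le {x y : Plane} (hx : x ∉ P.region) (hy : y ∉ P.region)
    (hd : Disjoint (_root_.segment ℝ x y) P.region) {ν : ℝ} (hν : 0 < ν) (hν1 : ν ≤ 1)
    (s t : ℝ) : |P.V ν t y - P.V ν s x| ≤ |t - s| + 2 * (‖x - y‖ / ν) := by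
  obtain ⟨k, hk⟩ := exists_abs_mid_rad_sub_le hx hy hd
  obtain ⟨h1, h2⟩ := hk ν hν hν1
  rw [V_eq hx hν hν1, V_eq hy hν hν1]
  have e1 : P.cdist t (P.mid ν y) ≤ P.cdist s (P.mid ν x) + (|t - s| + ‖x - y‖ / ν) := by
    refine cdist_le_of_abs (k := -k) ?_
    have := abs_sub (t - s) (P.mid ν y - P.mid ν x + k * P.L)
    rw [show t - s - (P.mid ν y - P.mid ν x + k * P.L) =
      t - P.mid ν y - (s - P.mid ν x) + ((-k : ℤ) : ℝ) * P.L by push_cast; ring] at this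
    linarith
  have e2 : P.cdist s (P.mid ν x) ≤ P.cdist t (P.mid ν y) + (|t - s| + ‖x - y‖ / ν) := by
    refine cdist_le_of_abs (k := k) ?_
    have := abs_sub (P.mid ν y - P.mid ν x + k * P.L) (t - s)
    rw [show P.mid ν y - P.mid ν x + k * P.L - (t - s) =
      s - P.mid ν x - (t - P.mid ν y) + k * P.L by ring] at this
    linarith
  rw [abs_le] at h2 ⊢
  constructor <;> linarith [h2.1, h2.2]

lemma disjoint_segment_of_norm_lt {x y : Plane} (h : ‖y - x‖ < Metric.infDist x P.region) :
    Disjoint (_root_.segment ℝ x y) P.region := by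
  rw [Set.disjoint_left]
  intro p hp hpT
  have h1 : p ∈ Metric.ball x (Metric.infDist x P.region) :=
    (convex_ball x _).segment_subset
      (Metric.mem_ball_self (lt_of_le_of_lt (norm_nonneg _) h)) (by simpa [dist_eq_norm] using h) hp
  exact (Metric.infDist_le_dist_of_mem hpT).not_gt (by rwa [Metric.mem_ball, dist_comm] at h1)

lemma notMem_of_disjoint {x y : Plane} (hd : Disjoint (_root_.segment ℝ x y) P.region) :
    x ∉ P.region ∧ y ∉ P.region :=
  ⟨Set.disjoint_left.1 hd (left_mem_segment ℝ x y), Set.disjoint_left.1 hd (right_mem_segment ℝ x y)⟩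

lemma infDist_pos {x : Plane} (hx : x ∉ P.region) : 0 < Metric.infDist x P.region :=
  (P.isCompact_region.isClosed.notMem_iff_infDist_pos
    (P.interior_nonempty.mono interior_subset)).1 hx

lemma isOpen_outside (P : Target) : IsOpen {z : ℝ × Plane | z.2 ∉ P.region} :=
  P.isCompact_region.isClosed.isOpen_compl.preimage continuous_snd

lemma eventually_disjoint {x : Plane} (hx : x ∉ P.region) :
    ∀ᶠ y in 𝓝 x, Disjoint (_root_.segment ℝ x y) P.region := by
  filter_upwards [Metric.ball_mem_nhds x (infDist_pos hx)] with y hy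
  exact disjoint_segment_of_norm_lt (by simpa [dist_eq_norm] using hy)

lemma continuousOn_V (P : Target) {ν : ℝ} (hν : 0 < ν) (hν1 : ν ≤ 1) :
    ContinuousOn (fun z : ℝ × Plane => P.V ν z.1 z.2) {z | z.2 ∉ P.region} := by
  rintro ⟨s, x⟩ hx
  refine ContinuousAt.continuousWithinAt ?_
  rw [ContinuousAt, tendsto_iff_norm_sub_tendsto_zero]
  have h0 : Tendsto (fun z : ℝ × Plane => |z.1 - s| + 2 * (‖x - z.2‖ / ν)) (𝓝 (s, x)) (𝓝 0) := by
    have : Continuous fun z : ℝ × Plane => |z.1 - s| + 2 * (‖x - z.2‖ / ν) := by fun_prop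
    simpa using this.tendsto (s, x)
  refine squeeze_zero' (Eventually.of_forall fun _ => norm_nonneg _) ?_ h0
  have h1 : ∀ᶠ z : ℝ × Plane in 𝓝 (s, x), Disjoint (_root_.segment ℝ x z.2) P.region :=
    (continuous_snd.tendsto (s, x)).eventually (eventually_disjoint hx)
  filter_upwards [h1] with z hz
  exact abs_V_sub_le hx (notMem_of_disjoint hz).2 hz hν hν1 s z.1

/-- `mid` depends on the chosen lift and may jump by multiples of `L`; only its circular distance is
continuous, and this is `V + rad`. -/
lemma continuousOn_cdist_mid (P : Target) {ν : ℝ} (hν : 0 < ν) (hν1 : ν ≤ 1) :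
    ContinuousOn (fun z : ℝ × Plane => P.cdist z.1 (P.mid ν z.2)) {z | z.2 ∉ P.region} := by
  have hr : ContinuousOn (P.rad ν) {x | x ∉ P.region} := by
    intro x hx
    refine ContinuousAt.continuousWithinAt ?_
    rw [ContinuousAt, tendsto_iff_norm_sub_tendsto_zero]
    have h0 : Tendsto (fun y : Plane => ‖x - y‖ / ν) (𝓝 x) (𝓝 0) := by
      have : Continuous fun y : Plane => ‖x - y‖ / ν := by fun_prop
      simpa using this.tendsto x
    refine squeeze_zero' (Eventually.of_forall fun _ => norm_nonneg _) ?_ h0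
    filter_upwards [eventually_disjoint hx] with y hy
    obtain ⟨k, hk⟩ := exists_abs_mid_rad_sub_le hx (notMem_of_disjoint hy).2 hy
    exact (hk ν hν hν1).2
  refine ((P.continuousOn_V hν hν1).add
    (hr.comp continuousOn_snd fun z hz => hz)).congr fun z hz => ?_
  show _ = P.V ν z.1 z.2 + P.rad ν z.2
  rw [V_eq hz hν hν1, sub_add_cancel]

/-! ### Bounds through visible points -/

lemma exists_visible_nearest {x : Plane} (hx : x ∉ P.region) :
    ∃ s ∈ Icc (P.va x) (P.vb x), ‖P.γ s - x‖ = Metric.infDist x P.region := by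
  obtain ⟨p, hp, hpx⟩ := P.isCompact_region.exists_infDist_eq_dist
    (P.interior_nonempty.mono interior_subset) x
  have hne : p ≠ x := fun h => hx (h ▸ hp)
  have hray : ∀ c d : ℝ, 0 < c → 0 < d → c + d = 1 → c • x + d • p ∉ P.region := by
    intro c d hc hd hcd h
    have h1 := Metric.infDist_le_dist_of_mem (x := x) h
    have h2 : x - (c • x + d • p) = d • (x - p) := by
      rw [← eq_sub_iff_add_eq] at hcd
      rw [hcd]; module
    rw [hpx, dist_eq_norm, dist_eq_norm, h2, norm_smul, Real.norm_of_nonneg hd.le] at h1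
    nlinarith [norm_pos_iff.2 (sub_ne_zero.2 hne.symm)]
  have hpf : p ∈ frontier P.region := by
    rw [P.isCompact_region.isClosed.frontier_eq]
    refine ⟨hp, fun hi => ?_⟩
    have h1 : Tendsto (fun t : ℝ => t • x + (1 - t) • p) (𝓝[>] 0) (𝓝 p) := by
      have : ContinuousAt (fun t : ℝ => t • x + (1 - t) • p) 0 := by fun_prop
      simpa [ContinuousAt] using this.mono_left (nhdsWithin_le_nhds (s := Ioi 0))
    obtain ⟨t, ht, ht0, ht1⟩ := ((h1.eventually (mem_interior_iff_mem_nhds.1 hi)).and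
      (Ioo_mem_nhdsGT (zero_lt_one (α := ℝ)))).exists
    exact hray t (1 - t) ht0 (by linarith) (by ring) ht
  obtain ⟨s, rfl⟩ := P.range_eq ▸ hpf
  have hs : s ∈ P.visible x := by
    rintro q ⟨c, d, hc, hd, hcd, rfl⟩ hq
    exact hray c d hc hd hcd (interior_subset hq)
  obtain ⟨k, hk⟩ := (visArc hx).exists_shift hs
  exact ⟨_, hk, by rw [γ_add_zsmul, hpx, dist_comm, dist_eq_norm]⟩

section

variable {x : Plane} (hx : x ∉ P.region) {ν : ℝ} (hν : 0 < ν) (hν1 : ν ≤ 1)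
include hx hν hν1

/-- Used to show that `V` would be small just before a capture on the perimeter. -/
lemma V_le_cdist_add {s : ℝ} (hs : s ∈ Icc (P.va x) (P.vb x)) (sD : ℝ) :
    P.V ν sD x ≤ P.cdist sD s + ‖P.γ s - x‖ / ν := by
  obtain ⟨h1, h2⟩ := abs_lo_sub_le hx hν hν1 hs
  have h3 : |s - P.mid ν x| ≤ ‖P.γ s - x‖ / ν := by
    rw [abs_le] at h1 h2 ⊢
    rw [mid]
    constructor <;> linarith [h1.1, h1.2, h2.1, h2.2]
  rw [V_eq hx hν hν1]
  linarith [P.cdist_triangle sD s (P.mid ν x), P.cdist_le_abs s (P.mid ν x), rad_nonneg hx hν hν1]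

/-- Used to show that, with `V ≤ 0`, the defender is close to an intruder that is close to the
target. -/
lemma cdist_le_of_V_nonpos {s : ℝ} (hs : s ∈ Icc (P.va x) (P.vb x)) {sD : ℝ}
    (hV : P.V ν sD x ≤ 0) : P.cdist sD s ≤ 2 * (‖P.γ s - x‖ / ν) := by
  obtain ⟨h1, h2⟩ := abs_lo_sub_le hx hν hν1 hs
  have h3 : |P.mid ν x - s| + P.rad ν x ≤ 2 * (‖P.γ s - x‖ / ν) := by
    rw [abs_le] at h1 h2
    rw [mid, rad]
    have : |(P.lo ν x + P.hi ν x) / 2 - s| ≤ ‖P.γ s - x‖ / ν := by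
      rw [abs_le]; constructor <;> linarith [h1.1, h1.2, h2.1, h2.2]
    linarith [h1.1, h1.2, h2.1, h2.2]
  rw [V_eq hx hν hν1] at hV
  linarith [P.cdist_triangle sD (P.mid ν x) s, P.cdist_le_abs (P.mid ν x) s]

omit hν1 in
-- Compare with the visible point `s` nearest to `x`: the arc from `s` to the breaching point is at
-- most the sum of the two distances, so for `ν < 1` a far breaching point cannot be optimal. This
-- yields the linear rate at which the intruder approaches.
lemma norm_qL_le : (1 - ν) * ‖P.γ (P.qL ν x) - x‖ ≤ (1 + ν) * Metric.infDist x P.region ∧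
    (1 - ν) * ‖P.γ (P.qR ν x) - x‖ ≤ (1 + ν) * Metric.infDist x P.region := by
  obtain ⟨s, hs, hd⟩ := exists_visible_nearest hx
  have hqL := qL_mem hx ν
  have hqR := qR_mem hx ν
  have e : ∀ d : ℝ, d / ν * ν = d := fun d => div_mul_cancel₀ d hν.ne'
  have abs_le' : ∀ t ∈ Icc (P.va x) (P.vb x), |t - s| ≤ ‖P.γ t - x‖ + ‖P.γ s - x‖ := by
    intro t ht
    rcases le_total t s with h | h
    · rw [abs_sub_comm, abs_of_nonneg (sub_nonneg.2 h)]
      exact (visArc hx).sub_le_add hx ht.1 h hs.2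
    · rw [abs_of_nonneg (sub_nonneg.2 h), add_comm]
      exact (visArc hx).sub_le_add hx hs.1 h ht.2
  rw [← hd]
  constructor
  · have h1 := sub_le_lo (ν := ν) hx hs
    have h2 := (le_abs_self _).trans (abs_le' _ hqL)
    rw [lo] at h1
    have h3 : ‖P.γ (P.qL ν x) - x‖ / ν ≤ P.qL ν x - s + ‖P.γ s - x‖ / ν := by linarith
    have h4 := mul_le_mul_of_nonneg_right h3 hν.le
    rw [add_mul, e, e] at h4
    nlinarith
  · have h1 := hi_le_add (ν := ν) hx hs
    have h2 := (neg_abs_le _).trans' (neg_le_neg (abs_le' _ hqR))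
    rw [hi] at h1
    have h3 : ‖P.γ (P.qR ν x) - x‖ / ν ≤ s - P.qR ν x + ‖P.γ s - x‖ / ν := by linarith
    have h4 := mul_le_mul_of_nonneg_right h3 hν.le
    rw [add_mul, e, e] at h4
    nlinarith

lemma abs_mid_sub_mid_le : |P.mid ν x - P.mid 1 x| ≤ P.L := by
  have h1 := mid_mem_Icc hx hν hν1
  have h2 := mid_mem_Icc hx one_pos le_rfl
  have h3 := qL_mem hx ν
  have h4 := qR_mem hx ν
  have h5 := qL_mem hx 1
  have h6 := qR_mem hx 1
  rw [abs_le]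
  constructor <;> linarith [h1.1, h1.2, h2.1, h2.2, h3.2, h4.1, h5.2, h6.1, (visArc hx).lt_add]

/-- Testing the optimum for `ν` at the breaching points for ratio 1 costs their distances times `1 /
ν - 1`. This continuity in the speed ratio settles the intruder's win for `ν = 1`. -/
lemma abs_V_sub_V_one_le (s : ℝ) : |P.V ν s x - P.V 1 s x| ≤
    2 * (‖P.γ (P.qL 1 x) - x‖ + ‖P.γ (P.qR 1 x) - x‖) * (1 / ν - 1) := by
  have h1 := sub_le_lo (ν := ν) hx (qL_mem hx 1)
  have h2 := sub_le_lo (ν := 1) hx (qL_mem hx ν)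
  have h3 := hi_le_add (ν := ν) hx (qR_mem hx 1)
  have h4 := hi_le_add (ν := 1) hx (qR_mem hx ν)
  have h5 : P.lo ν x ≤ P.lo 1 x := by
    rw [div_one] at h2
    have := le_div_self (norm_nonneg (P.γ (P.qL ν x) - x)) hν hν1
    rw [lo]; linarith
  have h6 : P.hi 1 x ≤ P.hi ν x := by
    rw [div_one] at h4
    have := le_div_self (norm_nonneg (P.γ (P.qR ν x) - x)) hν hν1
    have h6 : P.hi ν x = P.qR ν x + ‖P.γ (P.qR ν x) - x‖ / ν := rfl
    linarith
  set dL := ‖P.γ (P.qL 1 x) - x‖ with hdL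
  set dR := ‖P.γ (P.qR 1 x) - x‖ with hdR
  have h7 : P.lo 1 x = P.qL 1 x - dL := by rw [lo, div_one]
  have h8 : P.hi 1 x = P.qR 1 x + dR := by rw [hi, div_one]
  have e1 : dL / ν = dL + dL * (1 / ν - 1) := by ring
  have e2 : dR / ν = dR + dR * (1 / ν - 1) := by ring
  have hn : 0 ≤ 1 / ν - 1 := sub_nonneg.2 (by rw [le_div_iff₀ hν]; linarith)
  have n1 : 0 ≤ dL * (1 / ν - 1) := mul_nonneg (norm_nonneg _) hn
  have n2 : 0 ≤ dR * (1 / ν - 1) := mul_nonneg (norm_nonneg _) hn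
  rw [V_eq hx hν hν1, V_eq hx one_pos le_rfl]
  have hm : |P.mid ν x - P.mid 1 x| ≤ (dL + dR) * (1 / ν - 1) := by
    rw [mid, mid, abs_le]; constructor <;> linarith
  have hr : |P.rad ν x - P.rad 1 x| ≤ (dL + dR) * (1 / ν - 1) := by
    rw [rad, rad, abs_le]; constructor <;> linarith
  have c1 := P.cdist_triangle s (P.mid 1 x) (P.mid ν x)
  have c2 := P.cdist_triangle s (P.mid ν x) (P.mid 1 x)
  rw [cdist_comm (P.mid 1 x)] at c1
  have c3 := P.cdist_le_abs (P.mid ν x) (P.mid 1 x)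
  rw [abs_le] at hr ⊢
  constructor <;> linarith [hr.1, hr.2]

end

end Target

/-! ### One-sided derivatives -/

lemma le_of_eventually_slope {f : ℝ → ℝ} {f' c s : ℝ} (h : HasDerivWithinAt f f' (Ici s) s)
    (hc : ∀ᶠ t in 𝓝[>] s, c * (t - s) ≤ f t - f s) : c ≤ f' := by
  rw [hasDerivWithinAt_iff_tendsto_slope, Ici_sdiff_left] at h
  refine ge_of_tendsto h ?_
  filter_upwards [hc, self_mem_nhdsWithin] with t ht hts
  rw [slope_def_field, le_div_iff₀ (sub_pos.2 hts)]
  exact ht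

lemma nonpos_of_eventually_le_right {f : ℝ → ℝ} {f' s : ℝ} (h : HasDerivWithinAt f f' (Ici s) s)
    (hm : ∀ᶠ t in 𝓝[>] s, f t ≤ f s) : f' ≤ 0 := by
  have := le_of_eventually_slope (c := 0) h.neg (by
    filter_upwards [hm] with t ht
    simp only [Pi.neg_apply]
    linarith)
  linarith

lemma nonneg_of_eventually_le_left {f : ℝ → ℝ} {f' s : ℝ} (h : HasDerivWithinAt f f' (Iic s) s)
    (hm : ∀ᶠ t in 𝓝[<] s, f t ≤ f s) : 0 ≤ f' := by
  rw [hasDerivWithinAt_iff_tendsto_slope, Iic_sdiff_right] at h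
  refine ge_of_tendsto h ?_
  filter_upwards [hm, self_mem_nhdsWithin] with t ht hts
  rw [slope_def_field]
  exact div_nonneg_of_nonpos (by linarith) (sub_nonpos.2 (le_of_lt hts))

namespace Target

variable {P : Target}

lemma le_inner_of_rightDeriv {s t c : ℝ} {e w : Plane} (hst : s < t)
    (h : ∀ σ ∈ Ioo s t, ∀ v, P.Regular σ v → c ≤ ⟪e, v⟫)
    (hw : HasDerivWithinAt P.γ w (Ici s) s) : c ≤ ⟪e, w⟫ := by
  have hf : HasDerivWithinAt (fun r => ⟪e, P.γ r⟫) ⟪e, w⟫ (Ici s) s := by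
    simpa using (hasDerivWithinAt_const s (Ici s) e).inner ℝ hw
  refine le_of_eventually_slope hf ?_
  filter_upwards [Ioo_mem_nhdsGT hst] with r hr
  refine mul_sub_le_of_ae_le_deriv (P.lipschitz_inner e) hr.1.le ?_
  filter_upwards [P.ae_regular] with σ ⟨v, hv⟩ hσ
  rw [(P.hasDerivAt_inner e hv.1).deriv]
  exact h σ ⟨hσ.1, hσ.2.trans hr.2⟩ v hv

/-- Near `s`, the perimeter points `γ s`, `γ σ` and `γ (s + d / 2)` lie almost on one ray with
direction `w`, in this order. The tangent at `σ` has both outer points on its left, so it is almost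
parallel to `w`. -/
lemma eventually_abs_cross_le {s c : ℝ} {w : Plane} (hw : HasDerivWithinAt P.γ w (Ici s) s)
    (hc : 0 < c) : ∃ t, s < t ∧ ∀ σ ∈ Ioo s t, ∀ v, P.Regular σ v → |cross v w| ≤ c := by
  have h1 := (hasDerivWithinAt_iff_isLittleO.1 hw).def (half_pos hc)
  rw [nhdsWithin, Filter.eventually_inf_principal] at h1
  obtain ⟨d, hd, h2⟩ := Metric.eventually_nhds_iff.1 h1
  have h3 : ∀ σ, s ≤ σ → σ < s + d → ‖P.γ σ - P.γ s - (σ - s) • w‖ ≤ c / 2 * (σ - s) := by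
    intro σ hs hσ
    have := h2 (y := σ) (by rw [Real.dist_eq, abs_of_nonneg] <;> linarith) hs
    rwa [Real.norm_of_nonneg (sub_nonneg.2 hs)] at this
  set d' := min 1 (c / 2) * (d / 2) with hd'
  have hd'0 : 0 < d' := by positivity
  have hd'1 : d' ≤ d / 2 := by
    rw [hd']; exact mul_le_of_le_one_left (by positivity) (min_le_left _ _)
  have hd'2 : d' ≤ c / 2 * (d / 2) := by
    rw [hd']; exact mul_le_mul_of_nonneg_right (min_le_right _ _) (by positivity)
  refine ⟨s + d', by linarith, fun σ hσ v hv => ?_⟩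
  have hcr : ∀ z, |cross v z| ≤ ‖z‖ := fun z => by simpa [hv.2] using abs_cross_le v z
  have a1 := P.ccw σ v hv.1 (P.γ s) (P.γ_mem s)
  have a2 := P.ccw σ v hv.1 (P.γ (s + d / 2)) (P.γ_mem _)
  have b1 := (hcr _).trans (h3 σ hσ.1.le (by linarith [hσ.2]))
  have b2 := (hcr _).trans (h3 (s + d / 2) (by linarith) (by linarith))
  have b3 := (hcr (P.γ σ - P.γ s)).trans (P.norm_γ_sub_le _ _)
  rw [abs_of_pos (sub_pos.2 hσ.1)] at b3
  simp only [cross_sub_right, cross_smul_right, add_sub_cancel_left, abs_le] at a1 a2 b1 b2 b3 ⊢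
  have hp : 0 < σ - s := sub_pos.2 hσ.1
  have hσ2 := hσ.2
  constructor
  · have : -c * (d / 2) ≤ d / 2 * cross v w := by nlinarith [b2.2, b3.2]
    nlinarith
  · have : (σ - s) * cross v w ≤ (σ - s) * c := by nlinarith [b1.1]
    exact le_of_mul_le_mul_left this hp

/-- Tangents `v` just after `s` are almost parallel to `w` and point the same way, having a common
interior point on their left; hence `⟪w, v⟫` is almost `‖w‖`. Integration gives `‖w‖ ^ 2 ≥ ‖w‖ - c`
for small `c`, which is impossible if `0 < ‖w‖ < 1`. -/
lemma norm_rightDeriv {s : ℝ} {w : Plane} (hw : HasDerivWithinAt P.γ w (Ici s) s) : ‖w‖ = 1 := by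
  have hle : ‖w‖ ≤ 1 := by
    have h := hw
    rw [hasDerivWithinAt_iff_tendsto_slope, Ici_sdiff_left] at h
    refine le_of_tendsto h.norm ?_
    filter_upwards [self_mem_nhdsWithin] with t ht
    rw [slope_def_module, norm_smul, norm_inv, Real.norm_eq_abs, inv_mul_le_iff₀
      (abs_pos.2 (sub_ne_zero.2 (ne_of_gt ht))), mul_one]
    exact P.norm_γ_sub_le t s
  obtain ⟨z₀, hz₀⟩ := P.interior_nonempty
  obtain ⟨ε, hε, hb⟩ := Metric.isOpen_iff.1 isOpen_interior z₀ hz₀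
  set z := z₀ - P.γ s with hz
  have hzv : ∀ σ ∈ Ioo s (s + ε / 2), ∀ v, P.Regular σ v → ε / 2 ≤ cross v z := by
    intro σ hσ v hv
    have h1 := hv.le_cross_of_ball hε (hb.trans interior_subset)
    have h2 := abs_cross_le v (P.γ σ - P.γ s)
    rw [hv.2, one_mul] at h2
    have h3 := h2.trans (P.norm_γ_sub_le _ _)
    rw [abs_of_pos (sub_pos.2 hσ.1)] at h3
    have h4 : cross v z = cross v (z₀ - P.γ σ) + cross v (P.γ σ - P.γ s) := by
      rw [← cross_add_right, sub_add_sub_cancel]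
    linarith [neg_abs_le (cross v (P.γ σ - P.γ s)), hσ.2]
  have hzw : ε / 2 ≤ cross w z := by
    have he : ∀ v : Plane, ⟪(!₂[z 1, -z 0] : Plane), v⟫ = cross v z := fun v => by
      rw [inner_eq, cross]; simp; ring
    rw [← he]
    exact le_inner_of_rightDeriv (t := s + ε / 2) (by linarith)
      (fun σ hσ v hv => by rw [he]; exact hzv σ hσ v hv) hw
  by_contra hne
  have hlt : ‖w‖ < 1 := lt_of_le_of_ne hle hne
  have hw0 : 0 < ‖w‖ := norm_pos_iff.2 fun h0 => by
    rw [h0, cross] at hzw; simp at hzw; linarith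
  -- The first bound makes `key` contradictory, the second keeps `⟪v, w⟫` positive.
  set c := min ((‖w‖ - ‖w‖ ^ 2) / 2) (ε * ‖w‖ / (4 * (‖z‖ + 1))) with hc
  have hc0 : 0 < c := lt_min (by nlinarith) (by positivity)
  have hc1 : c ≤ (‖w‖ - ‖w‖ ^ 2) / 2 := min_le_left _ _
  have hc2 : c * (4 * (‖z‖ + 1)) ≤ ε * ‖w‖ := by
    rw [← le_div_iff₀ (by positivity)]; exact min_le_right _ _
  obtain ⟨t, hst, ht⟩ := eventually_abs_cross_le hw hc0
  have key : ‖w‖ - c ≤ ⟪w, w⟫ := by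
    refine le_inner_of_rightDeriv (t := min t (s + ε / 2)) (lt_min hst (by linarith))
      (fun σ hσ v hv => ?_) hw
    have h1 := hzv σ ⟨hσ.1, hσ.2.trans_le (min_le_right _ _)⟩ v hv
    have h2 := ht σ ⟨hσ.1, hσ.2.trans_le (min_le_left _ _)⟩ v hv
    have h3 : ‖w‖ ^ 2 * cross v z = ⟪v, w⟫ * cross w z + cross v w * ⟪w, z⟫ := by
      rw [norm_sq_eq, inner_eq, inner_eq, cross, cross, cross]; ring
    have h4 : |cross v w * ⟪w, z⟫| ≤ c * (‖w‖ * ‖z‖) := by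
      rw [abs_mul]
      exact mul_le_mul h2 (abs_real_inner_le_norm _ _) (abs_nonneg _) hc0.le
    have h5 : 0 < ⟪v, w⟫ * cross w z := by
      have : ‖w‖ ^ 2 * (ε / 2) ≤ ‖w‖ ^ 2 * cross v z := by gcongr
      have h6 : c * (‖w‖ * ‖z‖) ≤ ‖w‖ ^ 2 * (ε / 4) := by nlinarith [norm_nonneg z]
      have h7 : 0 < ‖w‖ ^ 2 * ε := by positivity
      linarith [le_abs_self (cross v w * ⟪w, z⟫)]
    have h6 : 0 < ⟪v, w⟫ := pos_of_mul_pos_left h5 (by linarith)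
    have h7 := inner_sq_add_cross_sq v w
    rw [hv.2, one_mul] at h7
    have h8 := sq_le_sq' (abs_le.1 h2).1 (abs_le.1 h2).2
    rw [real_inner_comm]
    by_contra! hlt'
    nlinarith
  rw [real_inner_self_eq_norm_sq] at key
  linarith

lemma reflect_leftDeriv {s : ℝ} {v : Plane} (hv : HasDerivWithinAt P.γ v (Iic s) s) :
    HasDerivWithinAt P.reflect.γ (-mirror v) (Ici (-s)) (-s) := by
  have := hasDerivWithinAt_mirror hv
  rwa [Set.neg_Iic] at this

lemma reflect_rightDeriv {s : ℝ} {v : Plane} (hv : HasDerivWithinAt P.γ v (Ici s) s) :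
    HasDerivWithinAt P.reflect.γ (-mirror v) (Iic (-s)) (-s) := by
  have := hasDerivWithinAt_mirror hv
  rwa [Set.neg_Ici] at this

lemma norm_leftDeriv {s : ℝ} {v : Plane} (hv : HasDerivWithinAt P.γ v (Iic s) s) : ‖v‖ = 1 := by
  simpa using norm_rightDeriv (reflect_leftDeriv hv)

/-! ### Breaching points -/

lemma IsLeftBreachingPoint.exists_visArc {x : Plane} (hx : x ∉ P.region) {ν s : ℝ}
    (h : P.IsLeftBreachingPoint ν x s) : ∃ a b, P.VisArc x a b ∧ s ∈ Icc a b ∧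
      ∀ t ∈ Icc a b, t - ‖P.γ t - x‖ / ν ≤ s - ‖P.γ s - x‖ / ν := by
  obtain ⟨a, b, hab, hs⟩ := exists_visArc_mem hx h.1
  exact ⟨a, b, hab, hs, (hab.isLeftBreachingPoint_iff hs).1 h⟩

lemma IsRightBreachingPoint.reflect {x : Plane} (hx : x ∉ P.region) {ν s : ℝ}
    (h : P.IsRightBreachingPoint ν x s) : P.reflect.IsLeftBreachingPoint ν (mirror x) (-s) := by
  obtain ⟨a, b, hab, hs⟩ := exists_visArc_mem hx h.1
  have h1 := (hab.isRightBreachingPoint_iff hs).1 h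
  refine (hab.reflect.isLeftBreachingPoint_iff ⟨by linarith [hs.2], by linarith [hs.1]⟩).2
    fun t ht => ?_
  have := h1 (-t) ⟨by linarith [ht.2], by linarith [ht.1]⟩
  simp only [reflect_γ, neg_neg, ← map_sub, LinearIsometryEquiv.norm_map]
  linarith

lemma notMem_reflect {x : Plane} (hx : x ∉ P.region) : mirror x ∉ P.reflect.region := by
  simpa [mem_reflect_region] using hx

/-- For two maximizers `q < q'`, `q' - q` is at most the difference of the distances divided by `ν`.
For `ν < 1` the angle bound at `q'` makes that quotient smaller than the chord, which is at most `q'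
- q`. -/
lemma IsLeftBreachingPoint.eq {x : Plane} (hx : x ∉ P.region) {ν s t : ℝ} (hν : 0 < ν)
    (hν1 : ν < 1) (hs : P.IsLeftBreachingPoint ν x s) (ht : P.IsLeftBreachingPoint ν x t) :
    P.γ s = P.γ t := by
  have key : ∀ a b q q', P.VisArc x a b → q ∈ Icc a b → q' ∈ Icc a b → q < q' →
      P.IsLeftBreachingPoint ν x q → P.IsLeftBreachingPoint ν x q' → False := by
    intro a b q q' hab hq hq' hlt h h'
    have h1 := (hab.isLeftBreachingPoint_iff hq).1 h
    have h2 := (hab.isLeftBreachingPoint_iff hq').1 h'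
    have hA : P.γ q - x ≠ P.γ q' - x := fun he => hlt.ne (P.γ_inj (sub_left_injective he) (by
      rw [abs_lt]; constructor <;> linarith [hq.1, hq.2, hq'.1, hq'.2, hab.lt_add]))
    have cl := hab.inner_le_of_isMax hx hν hq.1 hlt hq'.2
      fun σ hσ => h2 σ ⟨hq.1.trans hσ.1, hσ.2.trans hq'.2⟩
    rcases norm_sub_norm_lt_or (u := P.γ q - x) (w := P.γ q' - x) hν1.le hν
      (sub_ne_zero.2 (P.γ_ne hx _)) hA (by simpa using cl) with h3 | h3
    · have h4 := h1 q' hq'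
      have h5 := P.norm_γ_sub_le q' q
      rw [abs_of_pos (by linarith)] at h5
      rw [sub_sub_sub_cancel_right] at h3
      have h6 : (q' - q) ≤ (‖P.γ q' - x‖ - ‖P.γ q - x‖) / ν := by rw [sub_div]; linarith
      rw [le_div_iff₀ hν] at h6
      nlinarith
    · exact hν1.ne h3.1
  obtain ⟨a, b, hab, hsm, -⟩ := hs.exists_visArc hx
  obtain ⟨k, hk⟩ := hab.exists_shift ht.1
  rw [← P.γ_add_zsmul t k]
  have ht' := (isLeftBreachingPoint_add_zsmul k).2 ht
  rcases lt_trichotomy s (t + k * P.L) with h | h | h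
  · exact (key a b _ _ hab hsm hk h hs ht').elim
  · rw [h]
  · exact (key a b _ _ hab hk hsm h ht' hs).elim

lemma IsRightBreachingPoint.eq {x : Plane} (hx : x ∉ P.region) {ν s t : ℝ} (hν : 0 < ν)
    (hν1 : ν < 1) (hs : P.IsRightBreachingPoint ν x s) (ht : P.IsRightBreachingPoint ν x t) :
    P.γ s = P.γ t := by
  have := (hs.reflect hx).eq (notMem_reflect hx) hν hν1 (ht.reflect hx)
  simpa using this

lemma eq_of_mem_Ico {s t : ℝ} (hs : s ∈ Ico 0 P.L) (ht : t ∈ Ico 0 P.L) (h : P.γ s = P.γ t) :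
    s = t :=
  P.injOn hs ht h

/-! ### Approach angles -/

lemma hasDerivWithinAt_gain {x w : Plane} (hx : x ∉ P.region) {S : Set ℝ} {s ν : ℝ}
    (hw : HasDerivWithinAt P.γ w S s) :
    HasDerivWithinAt (fun t => t - ‖P.γ t - x‖ / ν)
      (1 - ⟪P.γ s - x, w⟫ / ‖P.γ s - x‖ / ν) S s := by
  have h0 : P.γ s - x ≠ 0 := sub_ne_zero.2 (P.γ_ne hx s)
  have h1 : HasDerivWithinAt (fun t => P.γ t - x) w S s := hw.sub_const x
  have h2 : HasDerivWithinAt (fun t => ‖P.γ t - x‖ ^ 2) (2 * ⟪P.γ s - x, w⟫) S s := h1.norm_sq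
  have h3 := h2.sqrt (pow_ne_zero 2 (norm_ne_zero_iff.2 h0))
  simp only [Real.sqrt_sq (norm_nonneg _)] at h3
  rw [mul_div_mul_left _ _ two_ne_zero] at h3
  exact (hasDerivWithinAt_id s S).sub (h3.div_const ν)

lemma approachAngle_eq (x : Plane) (s : ℝ) {v : Plane} (hv : ‖v‖ = 1) :
    P.approachAngle x s v = Real.arccos (⟪P.γ s - x, v⟫ / ‖P.γ s - x‖) := by
  rw [approachAngle, InnerProductGeometry.angle, hv, mul_one]

lemma le_div_of_gain_nonpos {x w : Plane} {s ν : ℝ} (hν : 0 < ν)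
    (h : 1 - ⟪P.γ s - x, w⟫ / ‖P.γ s - x‖ / ν ≤ 0) : ν ≤ ⟪P.γ s - x, w⟫ / ‖P.γ s - x‖ := by
  have : 1 ≤ ⟪P.γ s - x, w⟫ / ‖P.γ s - x‖ / ν := by linarith
  rwa [le_div_iff₀ hν, one_mul] at this

lemma div_le_of_gain_nonneg {x w : Plane} {s ν : ℝ} (hν : 0 < ν)
    (h : 0 ≤ 1 - ⟪P.γ s - x, w⟫ / ‖P.γ s - x‖ / ν) : ⟪P.γ s - x, w⟫ / ‖P.γ s - x‖ ≤ ν := by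
  have : ⟪P.γ s - x, w⟫ / ‖P.γ s - x‖ / ν ≤ 1 := by linarith
  rwa [div_le_iff₀ hν, one_mul] at this

section

variable {x : Plane} (hx : x ∉ P.region) {ν s : ℝ} (hν : 0 < ν)
include hx hν

lemma IsLeftBreachingPoint.le_inner_right {w : Plane} {a b : ℝ} (hs : s ∈ Ico a b)
    (hm : ∀ t ∈ Icc a b, t - ‖P.γ t - x‖ / ν ≤ s - ‖P.γ s - x‖ / ν)
    (hw : HasDerivWithinAt P.γ w (Ici s) s) : ν ≤ ⟪P.γ s - x, w⟫ / ‖P.γ s - x‖ := by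
  refine le_div_of_gain_nonpos hν (nonpos_of_eventually_le_right (hasDerivWithinAt_gain hx hw) ?_)
  filter_upwards [Ioo_mem_nhdsGT hs.2] with t ht
  exact hm t ⟨hs.1.trans ht.1.le, ht.2.le⟩

lemma IsLeftBreachingPoint.inner_left_le {v : Plane} {a b : ℝ} (hs : s ∈ Ioc a b)
    (hm : ∀ t ∈ Icc a b, t - ‖P.γ t - x‖ / ν ≤ s - ‖P.γ s - x‖ / ν)
    (hv : HasDerivWithinAt P.γ v (Iic s) s) : ⟪P.γ s - x, v⟫ / ‖P.γ s - x‖ ≤ ν := by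
  refine div_le_of_gain_nonneg hν (nonneg_of_eventually_le_left (hasDerivWithinAt_gain hx hv) ?_)
  filter_upwards [Ioo_mem_nhdsLT hs.1] with t ht
  exact hm t ⟨ht.1.le, ht.2.le.trans hs.2⟩

omit hx hν in
lemma VisArc.mem_Ioo_of_mem_interior {a b : ℝ} (h : P.VisArc x a b) (hs : s ∈ Icc a b)
    (hi : s ∈ interior (P.visible x)) : s ∈ Ioo a b := by
  have hn := mem_interior_iff_mem_nhds.1 hi
  refine ⟨lt_of_le_of_ne hs.1 ?_, lt_of_le_of_ne hs.2 ?_⟩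
  · rintro rfl
    have h1 : Ioo (b - P.L) a ∈ 𝓝[<] a := Ioo_mem_nhdsLT (by linarith [h.lt_add])
    obtain ⟨t, ht, htv⟩ := (Filter.nonempty_of_mem
      (inter_mem h1 (nhdsWithin_le_nhds hn)))
    refine h.invis (t + P.L) ⟨by linarith [ht.1], by linarith [ht.2]⟩ ?_
    simpa using (visible_add_zsmul (P := P) (x := x) (s := t) 1).2 htv
  · rintro rfl
    have h1 : Ioo s (a + P.L) ∈ 𝓝[>] s := Ioo_mem_nhdsGT h.lt_add
    obtain ⟨t, ht, htv⟩ := (Filter.nonempty_of_mem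
      (inter_mem h1 (nhdsWithin_le_nhds hn)))
    exact h.invis t ht htv

lemma IsLeftBreachingPoint.angles_of_interior (h : P.IsLeftBreachingPoint ν x s)
    (hi : s ∈ interior (P.visible x)) {v w : Plane} (hv : HasDerivWithinAt P.γ v (Iic s) s)
    (hw : HasDerivWithinAt P.γ w (Ici s) s) :
    P.approachAngle x s w ≤ Real.arccos ν ∧ Real.arccos ν ≤ P.approachAngle x s v := by
  obtain ⟨a, b, hab, hs, hm⟩ := h.exists_visArc hx
  have hs' := hab.mem_Ioo_of_mem_interior hs hi
  rw [approachAngle_eq x s (norm_leftDeriv hv), approachAngle_eq x s (norm_rightDeriv hw)]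
  exact ⟨Real.antitone_arccos (le_inner_right hx hν ⟨hs'.1.le, hs'.2⟩ hm hw),
    Real.antitone_arccos (inner_left_le hx hν ⟨hs'.1, hs'.2.le⟩ hm hv)⟩

lemma IsLeftBreachingPoint.angle_eq (hν1 : ν ≤ 1) (h : P.IsLeftBreachingPoint ν x s) {v : Plane}
    (hv : HasDerivAt P.γ v s) : P.approachAngle x s v = Real.arccos ν := by
  obtain ⟨a, b, hab, hs, hm⟩ := h.exists_visArc hx
  have hv1 := norm_rightDeriv (hv.hasDerivWithinAt (s := Ici s))
  have hu := P.norm_γ_sub_pos hx s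
  rw [approachAngle_eq x s hv1]
  congr 1
  obtain ⟨p, hp, -⟩ := hab.exists_notMem
  have hcr : HasDerivAt (fun t => cross (P.γ s - x) (P.γ t - x)) (cross (P.γ s - x) v) s :=
    (crossL (P.γ s - x)).hasFDerivAt.comp_hasDerivAt s (hv.sub_const x)
  have h0 := P.ccw s v hv (P.γ p) (P.γ_mem p)
  have hsplit : cross (P.γ s - x) (P.γ p - x) = cross (P.γ s - x) (P.γ p - P.γ s) := by
    rw [← sub_add_sub_cancel (P.γ p) (P.γ s) x, cross_add_right, cross_self, add_zero]
  -- if the perimeter is tangent to the line of sight, it leads straight away from `x` or to `x`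
  have hpar : cross (P.γ s - x) v = 0 →
      (P.γ s - x = ‖P.γ s - x‖ • v ∧ ⟪P.γ s - x, v⟫ / ‖P.γ s - x‖ = 1) ∨
      (P.γ s - x = -‖P.γ s - x‖ • v ∧ ⟪P.γ s - x, v⟫ / ‖P.γ s - x‖ = -1) := by
    intro hc
    have h1 := inner_sq_add_cross_sq (P.γ s - x) v
    rw [hc, hv1, mul_one, zero_pow two_ne_zero, add_zero, sq_eq_sq_iff_eq_or_eq_neg] at h1
    have h2 : P.γ s - x = ⟪P.γ s - x, v⟫ • v := by
      have hn : v 0 ^ 2 + v 1 ^ 2 = 1 := by rw [← norm_sq_eq, hv1, one_pow]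
      rw [cross] at hc
      ext i
      fin_cases i
      · simp only [inner_eq, PiLp.smul_apply, smul_eq_mul, Fin.zero_eta]
        linear_combination v 1 * hc - (P.γ s - x) 0 * hn
      · simp only [inner_eq, PiLp.smul_apply, smul_eq_mul, Fin.mk_one]
        linear_combination -v 0 * hc - (P.γ s - x) 1 * hn
    rcases h1 with h1 | h1
    · left
      refine ⟨by rw [← h1]; exact h2, by rw [h1, div_self hu.ne']⟩
    · right
      refine ⟨by rw [← h1]; exact h2, by rw [h1, neg_div, div_self hu.ne']⟩
  -- At an end of the visible arc a differentiable perimeter is tangent to the line of sight. At the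
  -- first end both directions are contradictory; at the last end only the direction straight away
  -- from `x` remains, and it forces `ν = 1`. In between, the two one-sided conditions meet.
  rcases hs.1.eq_or_lt with rfl | ha
  · have hc : cross (P.γ a - x) v = 0 := by
      refine IsLocalMax.hasDerivAt_eq_zero (Eventually.of_forall fun t => ?_) hcr
      rw [cross_self]
      exact hab.left _ (P.γ_mem t)
    have h1 := le_inner_right hx hν ⟨le_rfl, hab.lt⟩ hm hv.hasDerivWithinAt
    rcases hpar hc with ⟨h2, h3⟩ | ⟨h2, h3⟩
    · have h4 := hab.left_neg p hp
      rw [hsplit, h2, cross_smul_left] at h4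
      nlinarith
    · linarith
  rcases hs.2.eq_or_lt with rfl | hb
  · have hc : cross (P.γ s - x) v = 0 := by
      refine IsLocalMin.hasDerivAt_eq_zero (Eventually.of_forall fun t => ?_) hcr
      rw [cross_self]
      exact hab.right _ (P.γ_mem t)
    have h1 := inner_left_le hx hν ⟨ha, le_rfl⟩ hm hv.hasDerivWithinAt
    rcases hpar hc with ⟨h2, h3⟩ | ⟨h2, h3⟩
    · linarith
    · have h4 := hab.right_pos p hp
      rw [hsplit, h2, cross_smul_left] at h4
      nlinarith
  · exact le_antisymm (inner_left_le hx hν ⟨ha, hb.le⟩ hm hv.hasDerivWithinAt)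
      (le_inner_right hx hν ⟨ha.le, hb⟩ hm hv.hasDerivWithinAt)

omit hx hν in
lemma approachAngle_reflect (v : Plane) :
    P.reflect.approachAngle (mirror x) (-s) (-mirror v) = Real.pi - P.approachAngle x s v := by
  rw [approachAngle, approachAngle, reflect_γ, neg_neg, ← map_sub,
    InnerProductGeometry.angle_neg_right]
  congr 1
  exact LinearIsometry.angle_map mirror.toLinearIsometry _ _

lemma IsRightBreachingPoint.angle_eq (hν1 : ν ≤ 1) (h : P.IsRightBreachingPoint ν x s) {v : Plane}
    (hv : HasDerivAt P.γ v s) : P.approachAngle x s v = Real.pi - Real.arccos ν := by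
  have := (h.reflect hx).angle_eq (notMem_reflect hx) hν hν1 (hasDerivAt_mirror hv)
  rw [approachAngle_reflect] at this
  linarith

lemma IsRightBreachingPoint.angles_of_interior (h : P.IsRightBreachingPoint ν x s)
    (hi : s ∈ interior (P.visible x)) {v w : Plane} (hv : HasDerivWithinAt P.γ v (Iic s) s)
    (hw : HasDerivWithinAt P.γ w (Ici s) s) : P.approachAngle x s w ≤ Real.pi - Real.arccos ν ∧
      Real.pi - Real.arccos ν ≤ P.approachAngle x s v := by
  have hi' : -s ∈ interior (P.reflect.visible (mirror x)) := by
    have h1 : P.reflect.visible (mirror x) = Homeomorph.neg ℝ ⁻¹' P.visible x := by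
      ext t; exact P.mem_visible_reflect
    rw [h1, ← Homeomorph.preimage_interior]
    simpa using hi
  have := (h.reflect hx).angles_of_interior (notMem_reflect hx) hν hi' (reflect_rightDeriv hw)
    (reflect_leftDeriv hv)
  rw [approachAngle_reflect, approachAngle_reflect] at this
  exact ⟨by linarith [this.2], by linarith [this.1]⟩

/-! ### The test for the left region -/

lemma mem_leftRegion_iff_leftTest (hν1 : ν ≤ 1) (sD : ℝ)
    (hle : P.arc (P.sR ν x) (P.sL ν x) ≤ P.L / 2) :
    x ∈ P.leftRegion ν sD ↔ P.LeftTest ν sD x := by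
  obtain ⟨k, hk, hs, hR, hL⟩ := star_eq hx (ν := ν) sD
  obtain ⟨h1, h2, h3⟩ := mid_bounds hx hν hν1
  obtain ⟨h4, h5⟩ := mid_mem_Icc hx hν hν1
  obtain ⟨jL, hjL⟩ := P.exists_qL_eq ν x
  obtain ⟨jR, hjR⟩ := P.exists_qR_eq ν x
  have hLp := P.L_pos
  have hm : P.lo ν x + P.hi ν x = 2 * P.mid ν x := by rw [mid]; ring
  have hpq := qL_lt_qR_add (ν := ν) hx
  rw [← arc_add_left _ _ jR, ← arc_add_right _ _ jL, ← hjL, ← hjR,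
    arc_eq (k := 0) (r := P.qL ν x - P.qR ν x) (by linarith) (by linarith)
    (by push_cast; ring)] at hle
  set D := sD + k * P.L with hD
  have half1 : P.arc sD (sD + P.L / 2) = P.L / 2 :=
    arc_eq (k := 0) (by linarith) (by linarith) (by push_cast; ring)
  have half2 : P.arc (sD + P.L / 2) sD = P.L / 2 :=
    arc_eq (k := -1) (by linarith) (by linarith) (by push_cast; ring)
  have hSL : P.sL ν x ∈ P.leftHalf sD ↔ D ≤ P.qL ν x ∨ P.qL ν x + P.L / 2 ≤ D := by
    rw [leftHalf, segment, mem_ofPred_eq, half1, ← arc_add_left _ _ k, ← arc_add_right _ _ jL,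
      ← hjL, ← hD]
    rcases le_or_gt D (P.qL ν x) with h | h
    · rw [arc_eq (k := 0) (r := P.qL ν x - D) (by linarith) (by linarith [hk.1])
        (by push_cast; ring)]
      exact ⟨fun _ => Or.inl h, fun _ => by linarith [hk.1]⟩
    · rw [arc_eq (k := -1) (r := P.qL ν x + P.L - D) (by linarith [hk.2]) (by linarith)
        (by push_cast; ring)]
      exact ⟨fun _ => Or.inr (by linarith), fun h' => by rcases h' with h' | h' <;> linarith⟩
  have hSR : P.sR ν x ∈ P.rightHalf sD ↔ D ≤ P.qR ν x + P.L / 2 := by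
    rw [rightHalf, segment, mem_ofPred_eq, half2, ← arc_add_left _ _ k, ← arc_add_right _ _ jR,
      ← hjR, add_right_comm, ← hD]
    rcases le_or_gt D (P.qR ν x + P.L / 2) with h | h
    · rw [arc_eq (k := -1) (r := P.qR ν x + P.L / 2 - D) (by linarith) (by linarith [hk.1])
        (by push_cast; ring)]
      exact ⟨fun _ => h, fun _ => by linarith [hk.1]⟩
    · rw [arc_eq (k := -2) (r := P.qR ν x + 3 * P.L / 2 - D) (by linarith [hk.2]) (by linarith)
        (by push_cast; ring)]
      exact ⟨fun _ => by linarith [hk.2], fun h' => by linarith⟩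
  have hdeg : P.mid ν x = P.qL ν x ∨ P.mid ν x = P.qR ν x → P.qR ν x = P.qL ν x := by
    intro h
    rcases (qR_le_qL (ν := ν) hx).lt_or_eq with hlt | heq
    · have := h3 hlt
      rcases h with h | h <;> linarith [this.1, this.2]
    · exact heq
  rw [leftRegion, LeftTest, mem_ofPred_eq, hs, hSL, hSR, hR, hL]
  rcases le_or_gt D (P.qL ν x) with h | h
  · have hDR : D ≤ P.qR ν x + P.L / 2 := by linarith
    simp only [h, hDR, hx, if_true, true_or, true_and, not_true_eq_false, not_false_eq_true,
      false_and, and_false, or_false]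
  · simp only [h.not_ge, hx, if_false, false_or, true_and, not_false_eq_true, false_and]
    constructor
    · intro h'
      have h6 : P.mid ν x + P.L / 2 < D := by linarith
      have h7 : ¬ D ≤ P.qR ν x + P.L / 2 := by linarith
      rcases le_or_gt (P.qL ν x + P.L / 2) D with h8 | h8
      · exact Or.inr (Or.inl ⟨h8, h7⟩)
      · exact Or.inr (Or.inr ⟨h8.not_ge, h7, h'⟩)
    · rintro (⟨h6, h7, h8⟩ | ⟨h6, h7⟩ | ⟨-, -, h8⟩)
      · linarith
      -- In the tie `D = qL + L / 2` the strict inequality `mid < qL` decides. It fails only if the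
      -- breaching points coincide, and then `sR` would be in the right half.
      · rcases h6.lt_or_eq with h8 | h8
        · linarith
        · rcases h5.lt_or_eq with h9 | h9
          · linarith
          · rw [hdeg (Or.inl h9)] at h7
            linarith
      · exact h8

end

end Target

namespace Target

variable {P : Target}

/-! ### A step of the intruder towards a breaching point -/

lemma mem_visible_of_toward {x : Plane} {s l : ℝ} (hs : s ∈ P.visible x) (h0 : 0 ≤ l)
    (h1 : l < 1) : s ∈ P.visible (x + l • (P.γ s - x)) := by
  rintro p ⟨c, d, hc, hd, hcd, rfl⟩
  refine hs _ ⟨c * (1 - l), c * l + d, mul_pos hc (by linarith), by positivity, ?_, ?_⟩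
  · linarith
  · module

lemma infDist_toward_le {x : Plane} {s l : ℝ} (h0 : 0 ≤ l) (h1 : l ≤ 1) :
    Metric.infDist (x + l • (P.γ s - x)) P.region ≤ (1 - l) * Metric.infDist x P.region := by
  obtain ⟨p, hp, hpx⟩ := P.isCompact_region.exists_infDist_eq_dist
    (P.interior_nonempty.mono interior_subset) x
  have hq : (1 - l) • p + l • P.γ s ∈ P.region :=
    P.convex_region hp (P.γ_mem s) (by linarith) h0 (by ring)
  refine (Metric.infDist_le_dist_of_mem hq).trans_eq ?_
  rw [hpx, dist_eq_norm, dist_eq_norm,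
    show x + l • (P.γ s - x) - ((1 - l) • p + l • P.γ s) = (1 - l) • (x - p) by module,
    norm_smul, Real.norm_of_nonneg (by linarith)]

lemma norm_sub_toward {x g : Plane} {l : ℝ} (h1 : l ≤ 1) :
    ‖g - (x + l • (g - x))‖ = (1 - l) * ‖g - x‖ := by
  rw [show g - (x + l • (g - x)) = (1 - l) • (g - x) by module, norm_smul,
    Real.norm_of_nonneg (by linarith)]

section

variable {x : Plane} (hx : x ∉ P.region) {ν h : ℝ} (hν : 0 < ν) (hν1 : ν ≤ 1) (h0 : 0 ≤ h)
  (hh : ν * h < Metric.infDist x P.region)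
include hx hν h0 hh

lemma toward_facts (s : ℝ) : 0 ≤ ν * h / ‖P.γ s - x‖ ∧ ν * h / ‖P.γ s - x‖ < 1 ∧
    ‖x - (x + (ν * h / ‖P.γ s - x‖) • (P.γ s - x))‖ = ν * h ∧
    Disjoint (_root_.segment ℝ x (x + (ν * h / ‖P.γ s - x‖) • (P.γ s - x))) P.region ∧
    ‖P.γ s - (x + (ν * h / ‖P.γ s - x‖) • (P.γ s - x))‖ / ν = ‖P.γ s - x‖ / ν - h := by
  have hd := P.norm_γ_sub_pos hx s
  have h1 : ν * h < ‖P.γ s - x‖ := by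
    refine hh.trans_le ?_
    rw [← dist_eq_norm, dist_comm]
    exact Metric.infDist_le_dist_of_mem (P.γ_mem s)
  have hl0 : 0 ≤ ν * h / ‖P.γ s - x‖ := by positivity
  have hl1 : ν * h / ‖P.γ s - x‖ < 1 := by rwa [div_lt_one hd]
  have hn : ‖x - (x + (ν * h / ‖P.γ s - x‖) • (P.γ s - x))‖ = ν * h := by
    rw [sub_add_cancel_left, norm_neg, norm_smul, Real.norm_of_nonneg hl0, div_mul_cancel₀ _ hd.ne']
  refine ⟨hl0, hl1, hn, disjoint_segment_of_norm_lt (by rwa [norm_sub_rev, hn]), ?_⟩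
  rw [norm_sub_toward hl1.le, sub_mul, div_mul_cancel₀ _ hd.ne']
  field_simp

include hν1

/-- A breaching point approached head-on stays visible and its distance shrinks at full speed, so
`lo` rises by at least `h`; by the Lipschitz bound it rises by no more. The inequality `qL - L / 2 <
mid` rules out a mismatch between the two lifts involved. -/
lemma toward_left : ∃ k : ℤ,
    P.lo ν (x + (ν * h / ‖P.γ (P.qL ν x) - x‖) • (P.γ (P.qL ν x) - x)) =
      P.lo ν x + h - k * P.L ∧
    |P.hi ν (x + (ν * h / ‖P.γ (P.qL ν x) - x‖) • (P.γ (P.qL ν x) - x)) - P.hi ν x + k * P.L|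
      ≤ h := by
  obtain ⟨hl0, hl1, hn, hdis, hdq⟩ := toward_facts hx hν h0 hh (P.qL ν x)
  set y := x + (ν * h / ‖P.γ (P.qL ν x) - x‖) • (P.γ (P.qL ν x) - x) with hy
  have hyT := (notMem_of_disjoint hdis).2
  obtain ⟨k, hk⟩ := exists_abs_sub_le hx hyT hdis
  obtain ⟨h1, h2⟩ := hk ν hν hν1
  rw [hn, mul_div_cancel_left₀ _ hν.ne'] at h1 h2
  refine ⟨k, ?_, h2⟩
  obtain ⟨j, hj⟩ := (visArc hyT).exists_shift
    (mem_visible_of_toward ((visArc hx).vis _ (qL_mem hx ν)) hl0 hl1)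
  have h3 := sub_le_lo (ν := ν) hyT hj
  have h4 := (abs_le.1 (abs_lo_sub_le hyT hν hν1 hj).2).2
  rw [γ_add_zsmul, hdq] at h3 h4
  have h5 := (mid_bounds hx hν hν1).2.1
  have h1' := abs_le.1 h1
  have h2' := abs_le.1 h2
  have hlo : P.lo ν x = P.qL ν x - ‖P.γ (P.qL ν x) - x‖ / ν := rfl
  have hm : 2 * P.mid ν x = P.lo ν x + P.hi ν x := by rw [mid]; ring
  have hLp := P.L_pos
  have hkj : ((-(k + j) : ℤ) : ℝ) * P.L < 1 * P.L := by push_cast; linarith [h2'.1]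
  have hkj' : -(k + j) < 1 := by exact_mod_cast lt_of_mul_lt_mul_right hkj hLp.le
  have hkj2 : ((k + j : ℤ) : ℝ) ≥ 0 := by exact_mod_cast (by omega : 0 ≤ k + j)
  push_cast at hkj2
  nlinarith [h1'.2]

lemma toward_right : ∃ k : ℤ,
    P.hi ν (x + (ν * h / ‖P.γ (P.qR ν x) - x‖) • (P.γ (P.qR ν x) - x)) =
      P.hi ν x - h - k * P.L ∧
    |P.lo ν (x + (ν * h / ‖P.γ (P.qR ν x) - x‖) • (P.γ (P.qR ν x) - x)) - P.lo ν x + k * P.L|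
      ≤ h := by
  obtain ⟨hl0, hl1, hn, hdis, hdq⟩ := toward_facts hx hν h0 hh (P.qR ν x)
  set y := x + (ν * h / ‖P.γ (P.qR ν x) - x‖) • (P.γ (P.qR ν x) - x) with hy
  have hyT := (notMem_of_disjoint hdis).2
  obtain ⟨k, hk⟩ := exists_abs_sub_le hx hyT hdis
  obtain ⟨h1, h2⟩ := hk ν hν hν1
  rw [hn, mul_div_cancel_left₀ _ hν.ne'] at h1 h2
  refine ⟨k, ?_, h1⟩
  obtain ⟨j, hj⟩ := (visArc hyT).exists_shift
    (mem_visible_of_toward ((visArc hx).vis _ (qR_mem hx ν)) hl0 hl1)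
  have h3 := hi_le_add (ν := ν) hyT hj
  have h4 := (abs_le.1 (abs_lo_sub_le hyT hν hν1 hj).1).1
  rw [γ_add_zsmul, hdq] at h3 h4
  have h5 := (mid_bounds hx hν hν1).1
  have h1' := abs_le.1 h1
  have h2' := abs_le.1 h2
  have hhi : P.hi ν x = P.qR ν x + ‖P.γ (P.qR ν x) - x‖ / ν := rfl
  have hm : 2 * P.mid ν x = P.lo ν x + P.hi ν x := by rw [mid]; ring
  have hLp := P.L_pos
  have hkj : ((k + j : ℤ) : ℝ) * P.L < 1 * P.L := by push_cast; linarith [h1'.2]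
  have hkj' : k + j < 1 := by exact_mod_cast lt_of_mul_lt_mul_right hkj hLp.le
  have hkj2 : ((k + j : ℤ) : ℝ) ≤ 0 := by exact_mod_cast (by omega : k + j ≤ 0)
  push_cast at hkj2
  nlinarith [h2'.1]

end

/-- `z` is a signed gap that may exceed half the perimeter, in which case the shorter way round is
`L - z`. -/
lemma le_cdist {s t z c : ℝ} {k : ℤ} (hz : s - t + k * P.L = z ∨ s - t + k * P.L = -z)
    (h1 : -(P.L / 2) ≤ z) (h2 : z ≤ P.L) (hc : c ≤ z) (hc' : P.L / 2 < z → c ≤ P.L - z) :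
    c ≤ P.cdist s t := by
  have habs : |s - t + k * P.L| = |z| := by rcases hz with h | h <;> simp [h]
  rcases le_or_gt z (P.L / 2) with h3 | h3
  · rw [cdist_eq_abs (k := k) (by rw [habs]; exact abs_le.2 ⟨h1, h3⟩), habs]
    exact hc.trans (le_abs_self z)
  · have hLp := P.L_pos
    refine (hc' h3).trans ?_
    rcases hz with h | h
    · have e : s - t + ((k - 1 : ℤ) : ℝ) * P.L = -(P.L - z) := by push_cast; linarith
      rw [cdist_eq_abs (k := k - 1) (by rw [e, abs_neg, abs_of_nonneg] <;> linarith), e, abs_neg]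
      exact le_abs_self _
    · have e : s - t + ((k + 1 : ℤ) : ℝ) * P.L = P.L - z := by push_cast; linarith
      rw [cdist_eq_abs (k := k + 1) (by rw [e, abs_of_nonneg] <;> linarith), e]
      exact le_abs_self _

section

variable {x : Plane} (hx : x ∉ P.region) {ν : ℝ} (hν : 0 < ν) (hν1 : ν ≤ 1)
include hx hν hν1

lemma exists_rep (s : ℝ) : ∃ j : ℤ, P.cdist s (P.mid ν x) = |P.mid ν x - s + j * P.L| ∧
    ((x ∈ P.leftRegion ν s ∧ P.mid ν x - s + j * P.L ∈ Ioo 0 (P.L / 2)) ∨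
     (x ∉ P.leftRegion ν s ∧ P.mid ν x - s + j * P.L ∈ Icc (-(P.L / 2)) 0)) := by
  by_cases h : x ∈ P.leftRegion ν s
  · obtain ⟨j, hj⟩ := (mem_leftRegion_iff hx hν hν1 s).1 h
    refine ⟨j, ?_, Or.inl ⟨h, hj⟩⟩
    rw [cdist_comm, cdist_eq_abs (k := j)]
    exact abs_le.2 ⟨by linarith [hj.1, P.L_pos], hj.2.le⟩
  · obtain ⟨j, hj, hj'⟩ := P.exists_cdist_eq (P.mid ν x) s
    refine ⟨j, by rw [cdist_comm, hj], Or.inr ⟨h, hj'.1, ?_⟩⟩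
    by_contra! hlt
    exact h ((mem_leftRegion_iff hx hν hν1 s).2 ⟨j, hlt, hj'.2⟩)

/-- The interval end that the defender has to reach recedes at full speed and the other end moves no
faster, so `rad` does not grow and the defender gains nothing. The second alternative is that `mid`
has passed the point opposite to the defender, where `V` is within `2 h` of its maximum for that
`rad`. -/
lemma intruder_step {s t h : ℝ} (h0 : 0 ≤ h) (hh : ν * h < Metric.infDist x P.region)
    (hL : h ≤ P.L / 8) (hst : |t - s| ≤ h) :
    x + h • P.uStar ν s x ∉ P.region ∧ P.rad ν (x + h • P.uStar ν s x) ≤ P.rad ν x ∧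
    (P.V ν s x ≤ P.V ν t (x + h • P.uStar ν s x) ∨
      P.L / 2 - 2 * h - P.rad ν (x + h • P.uStar ν s x) ≤ P.V ν t (x + h • P.uStar ν s x)) := by
  have hLp := P.L_pos
  have hst' := abs_le.1 hst
  obtain ⟨j, hj, ⟨hl, hm⟩ | ⟨hl, hm⟩⟩ := exists_rep hx hν hν1 s
  · have hu : x + h • P.uStar ν s x =
        x + (ν * h / ‖P.γ (P.qL ν x) - x‖) • (P.γ (P.qL ν x) - x) := by
      rw [uStar, if_pos hl, γ_qL, smul_smul]; congr 2; ring
    rw [hu]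
    obtain ⟨-, -, -, hdis, -⟩ := toward_facts hx hν h0 hh (P.qL ν x)
    obtain ⟨k, hk1, hk2⟩ := toward_left hx hν hν1 h0 hh
    set y := x + (ν * h / ‖P.γ (P.qL ν x) - x‖) • (P.γ (P.qL ν x) - x)
    have hyT := (notMem_of_disjoint hdis).2
    have hk2' := abs_le.1 hk2
    have hr : P.rad ν y ≤ P.rad ν x := by rw [rad, rad, hk1]; linarith [hk2'.2]
    refine ⟨hyT, hr, ?_⟩
    rw [V_eq hx hν hν1, V_eq hyT hν hν1, hj, abs_of_pos hm.1]
    have e1 : P.mid ν x = P.lo ν x + P.rad ν x := by rw [mid, rad]; ring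
    have e2 : P.mid ν y = P.lo ν y + P.rad ν y := by rw [mid, rad]; ring
    have e3 : 2 * P.mid ν x = P.lo ν x + P.hi ν x := by rw [mid]; ring
    have e4 : 2 * P.mid ν y = P.lo ν y + P.hi ν y := by rw [mid]; ring
    by_cases hz : P.mid ν y - t + (j + k) * P.L ≤ P.L / 2
    · left
      have := le_cdist (P := P) (s := t) (t := P.mid ν y) (k := -(j + k))
        (z := P.mid ν y - t + (j + k) * P.L) (c := P.mid ν y - t + (j + k) * P.L)
        (Or.inr (by push_cast; ring)) (by linarith [hm.1, hk2'.1, hst'.2])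
        (by linarith) le_rfl (fun h => by linarith)
      linarith [hst'.2]
    · right
      have := le_cdist (P := P) (s := t) (t := P.mid ν y) (k := -(j + k))
        (z := P.mid ν y - t + (j + k) * P.L) (c := P.L / 2 - 2 * h)
        (Or.inr (by push_cast; ring)) (by linarith) (by linarith [hm.2, hk2'.2, hst'.1])
        (by linarith) (fun _ => by linarith [hm.2, hk2'.2, hst'.1])
      linarith
  · have hu : x + h • P.uStar ν s x =
        x + (ν * h / ‖P.γ (P.qR ν x) - x‖) • (P.γ (P.qR ν x) - x) := by
      rw [uStar, if_neg hl, γ_qR, smul_smul]; congr 2; ring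
    rw [hu]
    obtain ⟨-, -, -, hdis, -⟩ := toward_facts hx hν h0 hh (P.qR ν x)
    obtain ⟨k, hk1, hk2⟩ := toward_right hx hν hν1 h0 hh
    set y := x + (ν * h / ‖P.γ (P.qR ν x) - x‖) • (P.γ (P.qR ν x) - x)
    have hyT := (notMem_of_disjoint hdis).2
    have hk2' := abs_le.1 hk2
    have hr : P.rad ν y ≤ P.rad ν x := by rw [rad, rad, hk1]; linarith [hk2'.1]
    refine ⟨hyT, hr, ?_⟩
    rw [V_eq hx hν hν1, V_eq hyT hν hν1, hj, abs_of_nonpos hm.2]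
    have e1 : P.mid ν x = P.hi ν x - P.rad ν x := by rw [mid, rad]; ring
    have e2 : P.mid ν y = P.hi ν y - P.rad ν y := by rw [mid, rad]; ring
    have e3 : 2 * P.mid ν x = P.lo ν x + P.hi ν x := by rw [mid]; ring
    have e4 : 2 * P.mid ν y = P.lo ν y + P.hi ν y := by rw [mid]; ring
    by_cases hz : -(P.mid ν y - t + (j + k) * P.L) ≤ P.L / 2
    · left
      have := le_cdist (P := P) (s := t) (t := P.mid ν y) (k := -(j + k))
        (z := -(P.mid ν y - t + (j + k) * P.L)) (c := -(P.mid ν y - t + (j + k) * P.L))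
        (Or.inl (by push_cast; ring)) (by linarith [hm.2, hk2'.2, hst'.1])
        (by linarith) le_rfl (fun h => by linarith)
      linarith [hst'.1]
    · right
      have := le_cdist (P := P) (s := t) (t := P.mid ν y) (k := -(j + k))
        (z := -(P.mid ν y - t + (j + k) * P.L)) (c := P.L / 2 - 2 * h)
        (Or.inl (by push_cast; ring)) (by linarith) (by linarith [hm.1, hk2'.1, hst'.2])
        (by linarith) (fun _ => by linarith [hm.1, hk2'.1, hst'.2])
      linarith

omit hν1 in
-- A step towards a perimeter point at distance `d` contracts the distance to the convex target by
-- the factor `1 - ν h / d`. The bound on `d` from `norm_qL_le` gives a linear decrease for `ν < 1`;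
-- an a priori bound `M` gives a geometric one, also for `ν = 1`.
lemma infDist_intruder_step {s h : ℝ} (h0 : 0 ≤ h) (hh : ν * h < Metric.infDist x P.region) :
    ((1 + ν) * Metric.infDist (x + h • P.uStar ν s x) P.region ≤
      (1 + ν) * Metric.infDist x P.region - ν * (1 - ν) * h) ∧
    ∀ M, (∀ s, ‖P.γ s - x‖ ≤ M) → Metric.infDist (x + h • P.uStar ν s x) P.region ≤
      (1 - ν * h / M) * Metric.infDist x P.region := by
  have hρ := infDist_pos hx
  have key : ∃ q, x + h • P.uStar ν s x = x + (ν * h / ‖P.γ q - x‖) • (P.γ q - x) ∧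
      (1 - ν) * ‖P.γ q - x‖ ≤ (1 + ν) * Metric.infDist x P.region := by
    by_cases hl : x ∈ P.leftRegion ν s
    · refine ⟨P.qL ν x, ?_, (norm_qL_le hx hν).1⟩
      rw [uStar, if_pos hl, γ_qL, smul_smul]; congr 2; ring
    · refine ⟨P.qR ν x, ?_, (norm_qL_le hx hν).2⟩
      rw [uStar, if_neg hl, γ_qR, smul_smul]; congr 2; ring
  obtain ⟨q, hq, hqn⟩ := key
  rw [hq]
  obtain ⟨hl0, hl1, -⟩ := toward_facts hx hν h0 hh q
  have hd := P.norm_γ_sub_pos hx q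
  have h1 := infDist_toward_le (P := P) (x := x) (s := q) hl0 hl1.le
  constructor
  · have h2 : ν * (1 - ν) * h ≤ (1 + ν) * (ν * h / ‖P.γ q - x‖ * Metric.infDist x P.region) := by
      rw [div_mul_eq_mul_div, ← mul_div_assoc, le_div_iff₀ hd]
      nlinarith [mul_nonneg hν.le h0]
    nlinarith
  · intro M hM
    refine h1.trans (mul_le_mul_of_nonneg_right ?_ hρ.le)
    have : ν * h / M ≤ ν * h / ‖P.γ q - x‖ :=
      div_le_div_of_nonneg_left (mul_nonneg hν.le h0) hd (hM q)
    linarith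

end

/-! ### A step of the defender -/

section

variable {x y : Plane} {ν h : ℝ} (hν : 0 < ν) (hν1 : ν ≤ 1) (hxy : ‖x - y‖ ≤ ν * h)
  (hd : Disjoint (_root_.segment ℝ x y) P.region)
include hν hν1 hxy hd

/-- One lift `i` serves both speed ratios, because the shift in `exists_abs_sub_le` is independent
of the ratio. The bound `ν h` for ratio 1 is what makes that midpoint slower than the defender when
`ν < 1`. -/
lemma exists_step_bounds (s : ℝ) (j : ℤ) : ∃ i : ℤ,
    |(P.lo ν y - s + i * P.L) - (P.lo ν x - s + j * P.L)| ≤ h ∧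
    |(P.hi ν y - s + i * P.L) - (P.hi ν x - s + j * P.L)| ≤ h ∧
    |(P.mid ν y - s + i * P.L) - (P.mid ν x - s + j * P.L)| ≤ h ∧
    |(P.mid 1 y - s + i * P.L) - (P.mid 1 x - s + j * P.L)| ≤ ν * h := by
  obtain ⟨hx, hy⟩ := notMem_of_disjoint hd
  obtain ⟨k, hk⟩ := exists_abs_sub_le hx hy hd
  obtain ⟨h1, h2⟩ := hk ν hν hν1
  obtain ⟨h3, h4⟩ := hk 1 one_pos le_rfl
  rw [div_one] at h3 h4
  have hn : ‖x - y‖ / ν ≤ h := by rw [div_le_iff₀ hν]; linarith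
  have e : ∀ a b : ℝ, a - s + ((j + k : ℤ) : ℝ) * P.L - (b - s + j * P.L) = a - b + k * P.L :=
    fun a b => by push_cast; ring
  refine ⟨j + k, ?_⟩
  simp only [e]
  refine ⟨h1.trans hn, h2.trans hn, ?_, ?_⟩
  · rw [abs_le] at *
    rw [mid, mid]; constructor <;> linarith
  · rw [abs_le] at *
    rw [mid, mid]; constructor <;> linarith

/-- Running towards `mid` makes up for the motion of the interval, which is at most `h`. If the
defender overshoots `mid`, it is within `2 h` of it. -/
lemma V_defender_step (s : ℝ) :
    P.cdist (s + h * P.ωStar ν s x) (P.mid ν y) ≤ max (P.cdist s (P.mid ν x)) (2 * h) ∧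
    P.V ν (s + h * P.ωStar ν s x) y ≤ max (P.V ν s x) (2 * h) := by
  obtain ⟨hx, hy⟩ := notMem_of_disjoint hd
  have h0 : 0 ≤ h := nonneg_of_mul_nonneg_right ((norm_nonneg _).trans hxy) hν
  have hry := rad_nonneg hy hν hν1
  have e1 : ∀ x, P.mid ν x = P.lo ν x + P.rad ν x := fun x => by rw [mid, rad]; ring
  have e2 : ∀ x, P.mid ν x = P.hi ν x - P.rad ν x := fun x => by rw [mid, rad]; ring
  rw [V_eq hx hν hν1, V_eq hy hν hν1]
  obtain ⟨j, hj, hcase⟩ := exists_rep hx hν hν1 s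
  obtain ⟨i, h1, h2, h3, -⟩ := exists_step_bounds hν hν1 hxy hd s j
  rw [abs_le] at h1 h2 h3
  rw [hj]
  rcases hcase with ⟨hl, hm⟩ | ⟨hl, hm⟩
  · rw [ωStar, if_pos hl, mul_one, abs_of_pos hm.1]
    have hc := P.cdist_le (P.mid ν y) (s + h) i
    rw [cdist_comm] at hc
    rcases le_total 0 (P.mid ν y - (s + h) + i * P.L) with hp | hp
    · rw [abs_of_nonneg hp] at hc
      refine ⟨le_max_of_le_left (by linarith [h3.2]), le_max_of_le_left ?_⟩
      linarith [e1 x, e1 y, h1.2]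
    · rw [abs_of_nonpos hp] at hc
      have : P.cdist (s + h) (P.mid ν y) ≤ 2 * h := by linarith [h3.1, hm.1]
      exact ⟨le_max_of_le_right this, le_max_of_le_right (by linarith)⟩
  · rw [ωStar, if_neg hl, mul_neg_one, ← sub_eq_add_neg, abs_of_nonpos hm.2]
    have hc := P.cdist_le (P.mid ν y) (s - h) i
    rw [cdist_comm] at hc
    rcases le_total 0 (P.mid ν y - (s - h) + i * P.L) with hp | hp
    · rw [abs_of_nonneg hp] at hc
      have : P.cdist (s - h) (P.mid ν y) ≤ 2 * h := by linarith [h3.2, hm.2]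
      exact ⟨le_max_of_le_right this, le_max_of_le_right (by linarith)⟩
    · rw [abs_of_nonpos hp] at hc
      refine ⟨le_max_of_le_left (by linarith [h3.1]), le_max_of_le_left ?_⟩
      linarith [e2 x, e2 y, h2.1]

end

/-- A bound on the time until the defender reaches the afferent surface. The midpoint for speed
ratio 1 serves as a clock: it moves at most as fast as the intruder. -/
def Approaching (P : Target) (ν c s : ℝ) (x : Plane) : Prop :=
  (∃ j : ℤ, P.mid ν x - s + j * P.L ∈ Ioo 0 (P.L / 2) ∧
    P.mid 1 x - s + j * P.L ≤ 3 / 2 * P.L - c) ∨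
  ∃ j : ℤ, P.mid ν x - s + j * P.L ∈ Ico (-(P.L / 2)) 0 ∧
    -(3 / 2 * P.L - c) ≤ P.mid 1 x - s + j * P.L

lemma Approaching.le {x : Plane} (hx : x ∉ P.region) {ν : ℝ} (hν : 0 < ν) (hν1 : ν ≤ 1) {c s : ℝ}
    (h : P.Approaching ν c s x) : c ≤ 5 / 2 * P.L := by
  have := abs_le.1 (abs_mid_sub_mid_le hx hν hν1)
  rcases h with ⟨j, h1, h2⟩ | ⟨j, h1, h2⟩
  · linarith [h1.1]
  · linarith [h1.2]

/-- This explains the constant `3 / 2 * L` in `Approaching`: the gap to `mid ν` is at most `L / 2`,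
and the midpoint for ratio 1 is within `L` of it. -/
lemma approaching_or {x : Plane} (hx : x ∉ P.region) {ν : ℝ} (hν : 0 < ν) (hν1 : ν ≤ 1) (s : ℝ) :
    P.cdist s (P.mid ν x) = 0 ∨ P.Approaching ν 0 s x := by
  have := abs_le.1 (abs_mid_sub_mid_le hx hν hν1)
  obtain ⟨j, hj, ⟨hl, hm⟩ | ⟨hl, hm⟩⟩ := exists_rep hx hν hν1 s
  · exact Or.inr (Or.inl ⟨j, hm, by linarith [hm.2]⟩)
  · rcases hm.2.eq_or_lt with h | h
    · left; rw [hj, h, abs_zero]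
    · exact Or.inr (Or.inr ⟨j, ⟨hm.1, h⟩, by linarith [hm.1]⟩)

/-- Until it passes `mid ν`, the defender keeps running in the same direction, and its gap to the
midpoint for ratio 1 shrinks at rate at least `1 - ν`. -/
lemma Approaching.step {x y : Plane} {ν h : ℝ} (hν : 0 < ν) (hν1 : ν ≤ 1)
    (hxy : ‖x - y‖ ≤ ν * h) (hd : Disjoint (_root_.segment ℝ x y) P.region) {c s : ℝ}
    (ha : P.Approaching ν c s x) :
    P.cdist (s + h * P.ωStar ν s x) (P.mid ν y) ≤ 2 * h ∨
      P.Approaching ν (c + (1 - ν) * h) (s + h * P.ωStar ν s x) y := by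
  obtain ⟨hx, hy⟩ := notMem_of_disjoint hd
  have h0 : 0 ≤ h := nonneg_of_mul_nonneg_right ((norm_nonneg _).trans hxy) hν
  rcases ha with ⟨j, hm, hc⟩ | ⟨j, hm, hc⟩
  · obtain ⟨i, -, -, h3, h4⟩ := exists_step_bounds hν hν1 hxy hd s j
    rw [abs_le] at h3 h4
    rw [ωStar, if_pos ((mem_leftRegion_iff hx hν hν1 s).2 ⟨j, hm⟩), mul_one]
    rcases lt_or_ge 0 (P.mid ν y - (s + h) + i * P.L) with hp | hp
    · exact Or.inr (Or.inl ⟨i, ⟨hp, by linarith [hm.2]⟩, by linarith⟩)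
    · left
      rw [cdist_comm]
      refine (P.cdist_le _ _ i).trans ?_
      rw [abs_of_nonpos hp]
      linarith [hm.1]
  · obtain ⟨i, -, -, h3, h4⟩ := exists_step_bounds hν hν1 hxy hd s j
    rw [abs_le] at h3 h4
    have hl : x ∉ P.leftRegion ν s := by
      rw [mem_leftRegion_iff hx hν hν1]
      rintro ⟨k, hk⟩
      have h5 : (0 : ℝ) < ((k - j : ℤ) : ℝ) * P.L := by push_cast; linarith [hk.1, hm.2]
      have h6 : ((k - j : ℤ) : ℝ) * P.L < 1 * P.L := by push_cast; linarith [hk.2, hm.1]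
      have h7 : (0 : ℝ) < ((k - j : ℤ) : ℝ) := pos_of_mul_pos_left h5 P.L_pos.le
      have h8 : ((k - j : ℤ) : ℝ) < 1 := lt_of_mul_lt_mul_right h6 P.L_pos.le
      have h7' : 0 < k - j := by exact_mod_cast h7
      have h8' : k - j < 1 := by exact_mod_cast h8
      omega
    rw [ωStar, if_neg hl, mul_neg_one, ← sub_eq_add_neg]
    rcases lt_or_ge (P.mid ν y - (s - h) + i * P.L) 0 with hp | hp
    · exact Or.inr (Or.inr ⟨i, ⟨by linarith [hm.1], hp⟩, by linarith⟩)
    · left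
      rw [cdist_comm]
      refine (P.cdist_le _ _ i).trans ?_
      rw [abs_of_nonneg hp]
      linarith [hm.2]

end Target

/-! ### Sampled motions -/

namespace IsSampling

variable {δ : ℝ} {τ : ℕ → ℝ} (h : IsSampling δ τ)
include h

lemma strictMono : StrictMono τ := strictMono_nat_of_lt_succ fun i => (h.2.1 i).1

lemma nonneg (i : ℕ) : 0 ≤ τ i := h.1 ▸ h.strictMono.monotone (Nat.zero_le i)

lemma pos : 0 < δ := by linarith [h.2.1 0]

lemma exists_last {t : ℝ} (ht : 0 ≤ t) : ∃ i, τ i ≤ t ∧ t < τ (i + 1) := by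
  classical
  have hex : ∃ n, t < τ n := (h.2.2.eventually (eventually_gt_atTop t)).exists
  obtain ⟨i, hi⟩ : ∃ i, Nat.find hex = i + 1 := Nat.exists_eq_succ_of_ne_zero fun h0 => by
    have := Nat.find_spec hex
    rw [h0, h.1] at this
    exact this.not_ge ht
  refine ⟨i, not_lt.1 (Nat.find_min hex (by omega)), ?_⟩
  have := Nat.find_spec hex
  rwa [hi] at this

lemma speedLE {F : Type*} [NormedAddCommGroup F] {c : ℝ} {y : ℝ → F}
    (hs : ∀ i, ∀ t ∈ Icc (τ i) (τ (i + 1)), ∀ t' ∈ Icc (τ i) (τ (i + 1)), t ≤ t' →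
      ‖y t' - y t‖ ≤ c * (t' - t)) : SpeedLE c y := by
  have key : ∀ i, ∀ t t', 0 ≤ t → t ≤ t' → t' ≤ τ i → ‖y t' - y t‖ ≤ c * (t' - t) := by
    intro i
    induction i with
    | zero =>
      intro t t' h0 h1 h2
      rw [h.1] at h2
      rw [le_antisymm h1 (h2.trans h0)]; simp
    | succ i ih =>
      intro t t' h0 h1 h2
      rcases le_total t' (τ i) with h3 | h3
      · exact ih t t' h0 h1 h3
      rcases le_total t (τ i) with h4 | h4
      · have e1 := ih t (τ i) h0 h4 le_rfl
        have e2 := hs i (τ i) ⟨le_rfl, h3.trans h2⟩ t' ⟨h3, h2⟩ h3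
        have := norm_sub_le_norm_sub_add_norm_sub (y t') (y (τ i)) (y t)
        linarith
      · exact hs i t ⟨h4, h1.trans h2⟩ t' ⟨h3, h2⟩ h1
  intro t ht t' ht'
  rcases le_total t t' with hle | hle
  · obtain ⟨i, -, hi⟩ := h.exists_last ht'
    rw [abs_of_nonneg (sub_nonneg.2 hle)]
    exact key _ t t' ht hle hi.le
  · obtain ⟨i, -, hi⟩ := h.exists_last ht
    rw [norm_sub_rev, abs_sub_comm, abs_of_nonneg (sub_nonneg.2 hle)]
    exact key _ t' t ht' hle hi.le

end IsSampling

lemma IsIntruderStepMotion.speedLE {U : ℝ → Plane → Plane} {δ ν : ℝ} {τ : ℕ → ℝ} {s : ℝ → ℝ}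
    {x : ℝ → Plane} (h : IsIntruderStepMotion U τ s x) (hτ : IsSampling δ τ)
    (hU : ∀ s x, ‖U s x‖ ≤ ν) : SpeedLE ν x := by
  refine hτ.speedLE fun i t ht t' ht' hle => ?_
  rw [h.2 i t ht, h.2 i t' ht', add_sub_add_left_eq_sub, ← sub_smul, sub_sub_sub_cancel_right,
    norm_smul, Real.norm_of_nonneg (sub_nonneg.2 hle), mul_comm]
  exact mul_le_mul_of_nonneg_right (hU _ _) (sub_nonneg.2 hle)

lemma IsDefenderStepMotion.speedLE {W : ℝ → Plane → ℝ} {δ ν : ℝ} {τ : ℕ → ℝ} {s : ℝ → ℝ}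
    {x : ℝ → Plane} (h : IsDefenderStepMotion ν W τ s x) (hτ : IsSampling δ τ)
    (hW : ∀ s x, |W s x| ≤ 1) : SpeedLE 1 s := by
  refine hτ.speedLE fun i t ht t' ht' hle => ?_
  rw [h.2 i t ht, h.2 i t' ht', add_sub_add_left_eq_sub, ← sub_mul, sub_sub_sub_cancel_right,
    norm_mul, Real.norm_of_nonneg (sub_nonneg.2 hle), mul_comm]
  exact mul_le_mul_of_nonneg_right (hW _ _) (sub_nonneg.2 hle)

lemma SpeedLE.continuousOn {F : Type*} [NormedAddCommGroup F] {c : ℝ} {y : ℝ → F}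
    (h : SpeedLE c y) : ContinuousOn y (Ici 0) := by
  have : LipschitzOnWith (Real.toNNReal c) y (Ici 0) := LipschitzOnWith.of_dist_le_mul
    fun t ht t' ht' => by
      rw [dist_eq_norm, Real.dist_eq]
      exact (h ht' ht).trans (mul_le_mul_of_nonneg_right (Real.le_coe_toNNReal c) (abs_nonneg _))
  exact this.continuousOn

lemma SpeedLE.of_tendsto {F : Type*} [NormedAddCommGroup F] {c : ℝ} {y : ℝ → F} {yn : ℕ → ℝ → F}
    (h : ∀ n, SpeedLE c (yn n)) (hl : ∀ t, 0 ≤ t → Tendsto (fun n => yn n t) atTop (𝓝 (y t))) :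
    SpeedLE c y := fun t ht t' ht' =>
  le_of_tendsto ((hl t' ht').sub (hl t ht)).norm (Eventually.of_forall fun n => h n ht ht')

/-- Sampled motions of the two players that converge to a given motion. -/
structure Approx (ν s₀ : ℝ) (x₀ : Plane) (s : ℝ → ℝ) (x : ℝ → Plane) (δ : ℕ → ℝ)
    (τ : ℕ → ℕ → ℝ) (sn : ℕ → ℝ → ℝ) (xn : ℕ → ℝ → Plane) : Prop where
  tendsto_δ : Tendsto δ atTop (𝓝 0)
  sampling : ∀ n, IsSampling (δ n) (τ n)
  speed_s : ∀ n, SpeedLE 1 (sn n)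
  speed_x : ∀ n, SpeedLE ν (xn n)
  init_s : ∀ n, sn n 0 = s₀
  init_x : ∀ n, xn n 0 = x₀
  lim_s : TendstoLocallyUniformlyOn sn s atTop (Ici 0)
  lim_x : TendstoLocallyUniformlyOn xn x atTop (Ici 0)

lemma IsIntruderMotion.exists_approx {U : ℝ → Plane → Plane} {ν s₀ : ℝ} {x₀ : Plane} {s : ℝ → ℝ}
    {x : ℝ → Plane} (h : IsIntruderMotion U s₀ x₀ s x) (hU : ∀ s x, ‖U s x‖ ≤ ν) :
    ∃ δ τ sn xn, Approx ν s₀ x₀ s x δ τ sn xn ∧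
      ∀ n, IsIntruderStepMotion U (τ n) (sn n) (xn n) := by
  obtain ⟨δ, τ, sn, xn, h1, h2, h3, h4⟩ := h
  exact ⟨δ, τ, sn, xn, ⟨h1, fun n => (h2 n).1, fun n => (h2 n).2.1.1,
    fun n => (h2 n).2.1.speedLE (h2 n).1 hU, fun n => (h2 n).2.2.1, fun n => (h2 n).2.2.2, h3, h4⟩,
    fun n => (h2 n).2.1⟩

lemma IsDefenderMotion.exists_approx {W : ℝ → Plane → ℝ} {ν s₀ : ℝ} {x₀ : Plane} {s : ℝ → ℝ}
    {x : ℝ → Plane} (h : IsDefenderMotion ν W s₀ x₀ s x) (hW : ∀ s x, |W s x| ≤ 1) :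
    ∃ δ τ sn xn, Approx ν s₀ x₀ s x δ τ sn xn ∧
      ∀ n, IsDefenderStepMotion ν W (τ n) (sn n) (xn n) := by
  obtain ⟨δ, τ, sn, xn, h1, h2, h3, h4⟩ := h
  exact ⟨δ, τ, sn, xn, ⟨h1, fun n => (h2 n).1, fun n => (h2 n).2.1.speedLE (h2 n).1 hW,
    fun n => (h2 n).2.1.1, fun n => (h2 n).2.2.1, fun n => (h2 n).2.2.2, h3, h4⟩,
    fun n => (h2 n).2.1⟩

namespace Approx

variable {ν s₀ : ℝ} {x₀ : Plane} {s : ℝ → ℝ} {x : ℝ → Plane} {δ : ℕ → ℝ} {τ : ℕ → ℕ → ℝ}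
  {sn : ℕ → ℝ → ℝ} {xn : ℕ → ℝ → Plane} (h : Approx ν s₀ x₀ s x δ τ sn xn)
include h

lemma tendsto_s {t : ℝ} (ht : 0 ≤ t) : Tendsto (fun n => sn n t) atTop (𝓝 (s t)) :=
  h.lim_s.tendsto_at ht

lemma tendsto_x {t : ℝ} (ht : 0 ≤ t) : Tendsto (fun n => xn n t) atTop (𝓝 (x t)) :=
  h.lim_x.tendsto_at ht

lemma speedLE_s : SpeedLE 1 s := .of_tendsto h.speed_s fun _ ht => h.tendsto_s ht

lemma speedLE_x : SpeedLE ν x := .of_tendsto h.speed_x fun _ ht => h.tendsto_x ht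

lemma x_zero : x 0 = x₀ :=
  tendsto_nhds_unique (h.tendsto_x le_rfl) (by simp only [h.init_x]; exact tendsto_const_nhds)

/-- The step estimates hold at sampling times. By the common speed limits, the states at the last
sampling times up to `t` converge to the limit state at `t`. -/
lemma exists_last {t : ℝ} (ht : 0 ≤ t) : ∃ i : ℕ → ℕ, (∀ n, τ n (i n) ≤ t) ∧
    (∀ n, t < τ n (i n + 1)) ∧ Tendsto (fun n => τ n (i n)) atTop (𝓝 t) ∧
    Tendsto (fun n => (sn n (τ n (i n)), xn n (τ n (i n)))) atTop (𝓝 (s t, x t)) := by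
  choose i hi1 hi2 using fun n => (h.sampling n).exists_last ht
  have hd : ∀ n, |τ n (i n) - t| ≤ δ n := fun n => by
    rw [abs_sub_comm, abs_of_nonneg (sub_nonneg.2 (hi1 n))]
    linarith [hi2 n, ((h.sampling n).2.1 (i n)).2]
  have hτ : Tendsto (fun n => |τ n (i n) - t|) atTop (𝓝 0) :=
    squeeze_zero (fun _ => abs_nonneg _) hd h.tendsto_δ
  refine ⟨i, hi1, hi2, tendsto_iff_norm_sub_tendsto_zero.2 hτ, Tendsto.prodMk_nhds ?_ ?_⟩
  · have h1 : Tendsto (fun n => sn n (τ n (i n)) - sn n t) atTop (𝓝 0) :=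
      squeeze_zero_norm (fun n => h.speed_s n ht ((h.sampling n).nonneg _))
        (by simpa using hτ.const_mul 1)
    simpa using h1.add (h.tendsto_s ht)
  · have h1 : Tendsto (fun n => xn n (τ n (i n)) - xn n t) atTop (𝓝 0) :=
      squeeze_zero_norm (fun n => h.speed_x n ht ((h.sampling n).nonneg _))
        (by simpa using hτ.const_mul ν)
    simpa using h1.add (h.tendsto_x ht)

/-- As long as the limit motion is outside the target, the approximating motions keep a distance
from the target that exceeds the length of a step. -/
lemma eventually_margin {P : Target} {t : ℝ} (ht : 0 ≤ t) (hx : ∀ r ∈ Icc 0 t, x r ∉ P.region) :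
    ∀ᶠ n in atTop, ∀ r ∈ Icc 0 t, ν * δ n < Metric.infDist (xn n r) P.region := by
  have hc : ContinuousOn (fun r => Metric.infDist (x r) P.region) (Icc 0 t) :=
    (Metric.continuous_infDist_pt _).comp_continuousOn
      (h.speedLE_x.continuousOn.mono Icc_subset_Ici_self)
  obtain ⟨r₀, hr₀, hm⟩ := isCompact_Icc.exists_isMinOn ⟨0, left_mem_Icc.2 ht⟩ hc
  have hρ := Target.infDist_pos (hx r₀ hr₀)
  set ρ := Metric.infDist (x r₀) P.region
  have hu : TendstoUniformlyOn xn x atTop (Icc 0 t) :=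
    (tendstoLocallyUniformlyOn_iff_tendstoUniformlyOn_of_compact isCompact_Icc).1
      (h.lim_x.mono Icc_subset_Ici_self)
  have hδ : Tendsto (fun n => ν * δ n) atTop (𝓝 0) := by simpa using h.tendsto_δ.const_mul ν
  filter_upwards [Metric.tendstoUniformlyOn_iff.1 hu (ρ / 2) (half_pos hρ),
    hδ.eventually (gt_mem_nhds (half_pos hρ))] with n hn1 hn2 r hr
  have h1 := hn1 r hr
  have h2 : ρ ≤ Metric.infDist (x r) P.region := hm hr
  have h3 := Metric.infDist_le_infDist_add_dist (s := P.region) (x := x r) (y := xn n r)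
  linarith

end Approx

lemma exists_first_time {P : Target} {x : ℝ → Plane} (hc : ContinuousOn x (Ici 0))
    (h0 : x 0 ∉ P.region) {t : ℝ} (ht : 0 ≤ t) (hx : x t ∈ P.region) :
    ∃ r, 0 < r ∧ r ≤ t ∧ x r ∈ P.region ∧ ∀ u, 0 ≤ u → u < r → x u ∉ P.region := by
  have hcl : IsCompact (Icc 0 t ∩ x ⁻¹' P.region) :=
    isCompact_Icc.of_isClosed_subset ((hc.mono Icc_subset_Ici_self).preimage_isClosed_of_isClosed
      isClosed_Icc P.isCompact_region.isClosed) inter_subset_left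
  obtain ⟨r, ⟨hr, hxr⟩, hm⟩ := hcl.exists_isLeast ⟨t, ⟨ht, le_rfl⟩, hx⟩
  refine ⟨r, lt_of_le_of_ne hr.1 fun h => h0 (h ▸ hxr), hr.2, hxr, fun u hu hur hxu => ?_⟩
  exact (hm ⟨⟨hu, hur.le.trans hr.2⟩, hxu⟩).not_gt hur

/-! ### Perimeter distance against Euclidean distance; limits of `V` along states. -/

namespace Target

variable {P : Target}

lemma norm_γ_sub_le_cdist (s t : ℝ) : ‖P.γ s - P.γ t‖ ≤ P.cdist s t := by
  obtain ⟨k, hk, -⟩ := P.exists_cdist_eq s t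
  rw [hk, ← P.γ_add_zsmul s k, show s - t + k * P.L = s + k * P.L - t by ring]
  exact P.norm_γ_sub_le _ _

/-- Injectivity of `γ` modulo `L`, made uniform by compactness of a period. -/
lemma exists_cdist_lt (P : Target) {ε : ℝ} (hε : 0 < ε) :
    ∃ η, 0 < η ∧ ∀ s t, ‖P.γ s - P.γ t‖ < η → P.cdist s t < ε := by
  by_contra! hcon
  have hK : IsCompact {z : ℝ × ℝ | z ∈ Icc 0 P.L ×ˢ Icc 0 P.L ∧ ε ≤ P.cdist z.1 z.2} :=
    (isCompact_Icc.prod isCompact_Icc).inter_right (isClosed_le continuous_const continuous_cdist)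
  have red : ∀ s t, ε ≤ P.cdist s t → ∃ z ∈ {z : ℝ × ℝ | z ∈ Icc 0 P.L ×ˢ Icc 0 P.L ∧
      ε ≤ P.cdist z.1 z.2}, ‖P.γ z.1 - P.γ z.2‖ = ‖P.γ s - P.γ t‖ := by
    intro s t hst
    obtain ⟨k, hk⟩ := P.exists_add_zsmul_mem_Ico 0 s
    obtain ⟨j, hj⟩ := P.exists_add_zsmul_mem_Ico 0 t
    rw [zero_add] at hk hj
    refine ⟨(s + k * P.L, t + j * P.L), ⟨⟨⟨hk.1, hk.2.le⟩, hj.1, hj.2.le⟩, ?_⟩, ?_⟩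
    · rwa [cdist_add_left, cdist_add_right]
    · rw [γ_add_zsmul, γ_add_zsmul]
  obtain ⟨s, t, -, hst⟩ := hcon 1 one_pos
  obtain ⟨z, hz, -⟩ := red s t hst
  have hc : Continuous fun z : ℝ × ℝ => ‖P.γ z.1 - P.γ z.2‖ :=
    ((P.continuous_γ.comp continuous_fst).sub (P.continuous_γ.comp continuous_snd)).norm
  obtain ⟨w, hw, hm⟩ := hK.exists_isMinOn ⟨z, hz⟩ hc.continuousOn
  have hpos : 0 < ‖P.γ w.1 - P.γ w.2‖ := by
    refine norm_pos_iff.2 (sub_ne_zero.2 fun heq => ?_)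
    obtain ⟨k, hk⟩ := P.γ_eq_iff.1 heq
    have h1 := P.cdist_le_abs w.1 w.1
    rw [sub_self, abs_zero] at h1
    have h2 := hw.2
    rw [hk, cdist_add_right] at h2
    linarith
  obtain ⟨s, t, h1, h2⟩ := hcon _ hpos
  obtain ⟨z, hz, hzn⟩ := red s t h2
  have h3 : ‖P.γ w.1 - P.γ w.2‖ ≤ ‖P.γ z.1 - P.γ z.2‖ := hm hz
  linarith

lemma tendsto_V {ν : ℝ} (hν : 0 < ν) (hν1 : ν ≤ 1) {s : ℝ} {x : Plane} (hx : x ∉ P.region)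
    {z : ℕ → ℝ × Plane} (hz : Tendsto z atTop (𝓝 (s, x))) :
    Tendsto (fun n => P.V ν (z n).1 (z n).2) atTop (𝓝 (P.V ν s x)) := by
  have h1 : ContinuousAt (fun z : ℝ × Plane => P.V ν z.1 z.2) (s, x) :=
    (P.continuousOn_V hν hν1).continuousAt (P.isOpen_outside.mem_nhds hx)
  exact h1.tendsto.comp hz

lemma tendsto_cdist_mid {ν : ℝ} (hν : 0 < ν) (hν1 : ν ≤ 1) {s : ℝ} {x : Plane} (hx : x ∉ P.region)
    {z : ℕ → ℝ × Plane} (hz : Tendsto z atTop (𝓝 (s, x))) :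
    Tendsto (fun n => P.cdist (z n).1 (P.mid ν (z n).2)) atTop (𝓝 (P.cdist s (P.mid ν x))) := by
  have h1 : ContinuousAt (fun z : ℝ × Plane => P.cdist z.1 (P.mid ν z.2)) (s, x) :=
    (P.continuousOn_cdist_mid hν hν1).continuousAt (P.isOpen_outside.mem_nhds hx)
  exact h1.tendsto.comp hz

end Target

namespace Target

variable {P : Target}

/-! ### Admissibility of the feedback laws -/

lemma mem_leftRegion_add_L {ν s : ℝ} {x : Plane} :
    x ∈ P.leftRegion ν (s + P.L) ↔ x ∈ P.leftRegion ν s := by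
  have h1 : ∀ a, P.arc a (s + P.L) = P.arc a s := fun a => by
    simpa using P.arc_add_right a s 1
  have h2 : ∀ a, P.arc (s + P.L) a = P.arc s a := fun a => by
    simpa using P.arc_add_left s a 1
  simp only [leftRegion, segment, JLstar, JRstar, JL, JR, mem_ofPred_eq, h1, h2]

/-- The slack in `c` lets a faster intruder use the law for a smaller speed ratio. -/
lemma isIntruderLaw_uStar {ν c : ℝ} (hν : 0 < ν) (hc : ν ≤ c) : P.IsIntruderLaw c (P.uStar ν) := by
  have key : ∀ u : Plane, ‖(ν / ‖u‖) • u‖ ≤ c := fun u => by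
    rw [norm_smul, Real.norm_of_nonneg (by positivity)]
    rcases eq_or_ne ‖u‖ 0 with h | h
    · rw [h, mul_zero]; exact hν.le.trans hc
    · rwa [div_mul_cancel₀ _ h]
  refine ⟨fun s x => ?_, fun s x => ?_⟩
  · rw [uStar]; split_ifs <;> exact key _
  · by_cases h : x ∈ P.leftRegion ν s
    · rw [uStar, uStar, if_pos h, if_pos (mem_leftRegion_add_L.2 h)]
    · rw [uStar, uStar, if_neg h, if_neg (mt mem_leftRegion_add_L.1 h)]

lemma isDefenderLaw_ωStar (P : Target) (ν : ℝ) : P.IsDefenderLaw (P.ωStar ν) := by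
  refine ⟨fun s x => ?_, fun s x => ?_⟩
  · rw [ωStar]; split_ifs <;> simp
  · by_cases h : x ∈ P.leftRegion ν s
    · rw [ωStar, ωStar, if_pos h, if_pos (mem_leftRegion_add_L.2 h)]
    · rw [ωStar, ωStar, if_neg h, if_neg (mt mem_leftRegion_add_L.1 h)]

lemma notMem_of_infDist_pos {x : Plane} (h : 0 < Metric.infDist x P.region) : x ∉ P.region :=
  fun hx => h.ne' (Metric.infDist_zero_of_mem hx)

/-! ### Motions under the intruder's law -/

section

variable {ν : ℝ} (hν : 0 < ν) (hν1 : ν ≤ 1)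
include hν hν1

/-- The loss `2 δ` does not accumulate: it occurs only in the second alternative of `intruder_step`,
and there it is measured from `L / 2 - rad`, which is at least the initial `V` because `rad` has not
grown. -/
lemma intruder_invariant {δ t : ℝ} {τ : ℕ → ℝ} {s : ℝ → ℝ} {x : ℝ → Plane}
    (hτ : IsSampling δ τ) (hs : IsIntruderStepMotion (P.uStar ν) τ s x)
    (hm : ∀ r ∈ Icc 0 t, ν * δ < Metric.infDist (x r) P.region) (hδ : δ ≤ P.L / 8) :
    ∀ i, τ i ≤ t → P.rad ν (x (τ i)) ≤ P.rad ν (x 0) ∧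
      P.V ν (s 0) (x 0) - 2 * δ ≤ P.V ν (s (τ i)) (x (τ i)) ∧
      (1 + ν) * Metric.infDist (x (τ i)) P.region ≤
        (1 + ν) * Metric.infDist (x 0) P.region - ν * (1 - ν) * τ i ∧
      Metric.infDist (x (τ i)) P.region ≤ Metric.infDist (x 0) P.region *
        Real.exp (-(ν / (Metric.diam P.region + Metric.infDist (x 0) P.region)) * τ i) := by
  have hδ0 := hτ.pos
  set M := Metric.diam P.region + Metric.infDist (x 0) P.region with hM
  intro i
  induction i with
  | zero =>
    intro _
    rw [hτ.1]
    refine ⟨le_rfl, by linarith, by simp, by simp⟩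
  | succ i ih =>
    intro hi
    obtain ⟨hlt, hle⟩ := hτ.2.1 i
    obtain ⟨h1, h2, h3, h4⟩ := ih (hlt.le.trans hi)
    have hmi := hm (τ i) ⟨hτ.nonneg i, hlt.le.trans hi⟩
    have hm0 := hm 0 ⟨le_rfl, (hτ.nonneg _).trans hi⟩
    have hx := notMem_of_infDist_pos ((mul_pos hν hδ0).trans hmi)
    have hx0 := notMem_of_infDist_pos ((mul_pos hν hδ0).trans hm0)
    set h := τ (i + 1) - τ i with hh
    have h0 : 0 ≤ h := sub_nonneg.2 hlt.le
    have hhδ : h ≤ δ := by linarith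
    have hmh : ν * h < Metric.infDist (x (τ i)) P.region :=
      (mul_le_mul_of_nonneg_left hhδ hν.le).trans_lt hmi
    have hxs : x (τ (i + 1)) = x (τ i) + h • P.uStar ν (s (τ i)) (x (τ i)) :=
      hs.2 i _ ⟨hlt.le, le_rfl⟩
    have hss := hs.1 (hτ.nonneg i) (hτ.nonneg (i + 1))
    rw [one_mul, Real.norm_eq_abs, ← hh, abs_of_nonneg h0] at hss
    obtain ⟨-, e2, e3⟩ := intruder_step hx hν hν1 h0 hmh (hhδ.trans hδ) hss
    obtain ⟨e4, e5⟩ := infDist_intruder_step (s := s (τ i)) hx hν h0 hmh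
    rw [← hxs] at e2 e3 e4 e5
    have hρ0 := Target.infDist_pos hx0
    have hρi := Target.infDist_pos hx
    have hdiam : 0 ≤ Metric.diam P.region := Metric.diam_nonneg
    have hMpos : 0 < M := by linarith
    refine ⟨e2.trans h1, ?_, ?_, ?_⟩
    · rcases e3 with e3 | e3
      · exact h2.trans e3
      · refine le_trans ?_ e3
        have := P.cdist_le_half (s 0) (P.mid ν (x 0))
        rw [V_eq hx0 hν hν1]
        linarith [e2.trans h1]
    · have : ν * (1 - ν) * τ (i + 1) = ν * (1 - ν) * τ i + ν * (1 - ν) * h := by rw [hh]; ring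
      linarith
    · have hMb : ∀ q, ‖P.γ q - x (τ i)‖ ≤ M := by
        intro q
        obtain ⟨p, hp, hpx⟩ := P.isCompact_region.exists_infDist_eq_dist
          (P.interior_nonempty.mono interior_subset) (x (τ i))
        have a1 := Metric.dist_le_diam_of_mem P.isCompact_region.isBounded (P.γ_mem q) hp
        have a2 := dist_triangle (P.γ q) p (x (τ i))
        have a3 : Metric.infDist (x (τ i)) P.region ≤ Metric.infDist (x 0) P.region := by
          refine h4.trans (mul_le_of_le_one_right hρ0.le (Real.exp_le_one_iff.2 ?_))
          have := mul_nonneg (div_nonneg hν.le hMpos.le) (hτ.nonneg i)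
          linarith
        rw [dist_comm p, ← hpx] at a2
        rw [← dist_eq_norm]
        linarith
      refine (e5 M hMb).trans ?_
      have h6 : 1 - ν * h / M ≤ Real.exp (-(ν / M) * h) := by
        have := Real.add_one_le_exp (-(ν / M) * h)
        have e : ν * h / M = ν / M * h := by ring
        linarith
      calc (1 - ν * h / M) * Metric.infDist (x (τ i)) P.region
          ≤ Real.exp (-(ν / M) * h) * (Metric.infDist (x 0) P.region *
            Real.exp (-(ν / M) * τ i)) :=
            mul_le_mul h6 h4 hρi.le (Real.exp_pos _).le
        _ = Metric.infDist (x 0) P.region * Real.exp (-(ν / M) * τ (i + 1)) := by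
            have : -(ν / M) * τ (i + 1) = -(ν / M) * h + -(ν / M) * τ i := by rw [hh]; ring
            rw [this, Real.exp_add]; ring

lemma intruder_motion_bounds {s₀ : ℝ} {x₀ : Plane} {s : ℝ → ℝ} {x : ℝ → Plane}
    (hmot : IsIntruderMotion (P.uStar ν) s₀ x₀ s x) {t : ℝ} (ht : 0 ≤ t)
    (hx : ∀ r ∈ Icc 0 t, x r ∉ P.region) :
    P.V ν s₀ x₀ ≤ P.V ν (s t) (x t) ∧
      (1 + ν) * Metric.infDist (x t) P.region ≤
        (1 + ν) * Metric.infDist x₀ P.region - ν * (1 - ν) * t ∧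
      Metric.infDist (x t) P.region ≤ Metric.infDist x₀ P.region *
        Real.exp (-(ν / (Metric.diam P.region + Metric.infDist x₀ P.region)) * t) := by
  obtain ⟨δ, τ, sn, xn, ha, hstep⟩ := hmot.exists_approx (isIntruderLaw_uStar hν le_rfl).1
  obtain ⟨i, hi, -, hτ, hz⟩ := ha.exists_last ht
  have hinv := ((ha.eventually_margin ht hx).and (ha.tendsto_δ.eventually
    (gt_mem_nhds (show (0 : ℝ) < P.L / 8 by linarith [P.L_pos])))).mono fun n hn =>
      intruder_invariant hν hν1 (ha.sampling n) (hstep n) hn.1 hn.2.le (i n) (hi n)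
  simp only [ha.init_s, ha.init_x] at hinv
  have hxl : Tendsto (fun n => xn n (τ n (i n))) atTop (𝓝 (x t)) :=
    (continuous_snd.tendsto _).comp hz
  have hρ := ((Metric.continuous_infDist_pt P.region).tendsto (x t)).comp hxl
  refine ⟨?_, ?_, ?_⟩
  · have h1 : Tendsto (fun n => P.V ν s₀ x₀ - 2 * δ n) atTop (𝓝 (P.V ν s₀ x₀)) := by
      simpa using tendsto_const_nhds.sub (ha.tendsto_δ.const_mul 2)
    exact le_of_tendsto_of_tendsto h1 (tendsto_V hν hν1 (hx t ⟨ht, le_rfl⟩) hz)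
      (hinv.mono fun n hn => hn.2.1)
  · exact le_of_tendsto_of_tendsto (hρ.const_mul (1 + ν))
      (tendsto_const_nhds.sub (hτ.const_mul (ν * (1 - ν)))) (hinv.mono fun n hn => hn.2.2.1)
  · refine le_of_tendsto_of_tendsto hρ ?_ (hinv.mono fun n hn => hn.2.2.2)
    exact ((Real.continuous_exp.tendsto _).comp (hτ.const_mul _)).const_mul _

theorem intruder_motion {s₀ : ℝ} {x₀ : Plane} (hx₀ : x₀ ∉ P.region) (hV : 0 < P.V ν s₀ x₀)
    {s : ℝ → ℝ} {x : ℝ → Plane} (hmot : IsIntruderMotion (P.uStar ν) s₀ x₀ s x) :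
    (ν < 1 → P.Scores s x) ∧ (P.Scores s x ∨
      ((∀ t, 0 ≤ t → x t ∉ P.region ∧ P.V ν s₀ x₀ ≤ P.V ν (s t) (x t)) ∧
        Tendsto (fun t => Metric.infDist (x t) P.region) atTop (𝓝 0))) := by
  obtain ⟨δ, τ, sn, xn, ha, -⟩ := hmot.exists_approx (isIntruderLaw_uStar hν le_rfl).1
  have h0 : x 0 ∉ P.region := by rwa [ha.x_zero]
  by_cases hit : ∃ t, 0 ≤ t ∧ x t ∈ P.region
  · obtain ⟨t, ht, hxt⟩ := hit
    obtain ⟨r, hr0, -, hxr, hout⟩ := exists_first_time ha.speedLE_x.continuousOn h0 ht hxt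
    have hsc : P.Scores s x := by
      refine ⟨r, hr0.le, hxr, fun u hu heq => ?_⟩
      rcases hu.2.lt_or_eq with hur | rfl
      · exact hout u hu.1 hur (heq ▸ P.γ_mem _)
      -- If the intruder were captured on arrival at time `u`, then at time `u - κ` both players
      -- would be close to a visible point `q`. `V_le_cdist_add` then bounds `V` by three terms,
      -- each at most a quarter of its initial value.
      obtain ⟨η, hη, hcd⟩ := P.exists_cdist_lt (show 0 < P.V ν s₀ x₀ / 4 by linarith)
      set κ := min (u / 2) (min (η / 3) (ν * (P.V ν s₀ x₀ / 4))) with hκ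
      have hκ0 : 0 < κ := by positivity
      have hκ1 : κ ≤ u / 2 := min_le_left _ _
      have hκ2 : κ ≤ η / 3 := (min_le_right _ _).trans (min_le_left _ _)
      have hκ3 : κ ≤ ν * (P.V ν s₀ x₀ / 4) := (min_le_right _ _).trans (min_le_right _ _)
      have hb := (intruder_motion_bounds hν hν1 hmot (t := u - κ) (by linarith)
        fun q hq => hout q hq.1 (by linarith [hq.2])).1
      have hxk := hout (u - κ) (by linarith) (by linarith)
      have e1 := ha.speedLE_s (show 0 ≤ u by linarith) (show 0 ≤ u - κ by linarith)
      have e2 := ha.speedLE_x (show 0 ≤ u by linarith) (show 0 ≤ u - κ by linarith)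
      rw [sub_sub_cancel_left, abs_neg, abs_of_pos hκ0] at e1 e2
      rw [Real.norm_eq_abs, one_mul] at e1
      have e3 : ‖x (u - κ) - x u‖ ≤ κ := e2.trans (mul_le_of_le_one_left hκ0.le hν1)
      obtain ⟨q, hq, hqn⟩ := exists_visible_nearest hxk
      have e4 : ‖P.γ q - x (u - κ)‖ ≤ κ := by
        rw [hqn]
        exact (Metric.infDist_le_dist_of_mem hxr).trans (by rwa [dist_eq_norm])
      have e5 : P.cdist (s u) q < P.V ν s₀ x₀ / 4 := by
        refine hcd _ _ ?_
        rw [← heq]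
        have := norm_sub_le_norm_sub_add_norm_sub (x u) (x (u - κ)) (P.γ q)
        rw [norm_sub_rev (x u) (x (u - κ)), norm_sub_rev (x (u - κ)) (P.γ q)] at this
        linarith
      have e6 := V_le_cdist_add hxk hν hν1 hq (s (u - κ))
      have e7 := P.cdist_triangle (s (u - κ)) (s u) q
      have e8 := P.cdist_le_abs (s (u - κ)) (s u)
      have e9 : ‖P.γ q - x (u - κ)‖ / ν ≤ P.V ν s₀ x₀ / 4 := by
        rw [div_le_iff₀ hν]; linarith
      have e10 : κ ≤ P.V ν s₀ x₀ / 4 :=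
        hκ3.trans (mul_le_of_le_one_left (by linarith) hν1)
      linarith
    exact ⟨fun _ => hsc, Or.inl hsc⟩
  · push Not at hit
    have hb := fun t ht => intruder_motion_bounds hν hν1 hmot (t := t) ht fun r hr => hit r hr.1
    have hρ := Target.infDist_pos hx₀
    refine ⟨fun hlt => ?_, Or.inr ⟨fun t ht => ⟨hit t ht, (hb t ht).1⟩, ?_⟩⟩
    · exfalso
      have hc : 0 < ν * (1 - ν) := mul_pos hν (by linarith)
      -- At this time the linear bound would make the distance to the target nonpositive.
      have h1 := (hb _ (div_nonneg (mul_nonneg (by linarith : 0 ≤ 1 + ν) hρ.le) hc.le)).2.1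
      rw [mul_div_cancel₀ _ hc.ne', sub_self] at h1
      have h2 := Target.infDist_pos (hit _ (div_nonneg (mul_nonneg (by linarith : 0 ≤ 1 + ν) hρ.le)
        hc.le))
      nlinarith
    · have hM : 0 < ν / (Metric.diam P.region + Metric.infDist x₀ P.region) :=
        div_pos hν (by linarith [Metric.diam_nonneg (s := P.region)])
      refine squeeze_zero' (Eventually.of_forall fun _ => Metric.infDist_nonneg)
        (g := fun t => Metric.infDist x₀ P.region *
          Real.exp (-(ν / (Metric.diam P.region + Metric.infDist x₀ P.region)) * t))
        (by filter_upwards [eventually_ge_atTop 0] with t ht using (hb t ht).2.2) ?_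
      rw [← mul_zero (Metric.infDist x₀ P.region)]
      refine (Real.tendsto_exp_atBot.comp ?_).const_mul _
      exact tendsto_id.const_mul_atTop_of_neg (by linarith)

/-! ### Motions under the defender's law -/

/-- Each step bounds the new value by a maximum with `2 δ`, so the errors do not add up. -/
lemma defender_invariant {δ t : ℝ} {τ : ℕ → ℝ} {s : ℝ → ℝ} {x : ℝ → Plane}
    (hτ : IsSampling δ τ) (hs : IsDefenderStepMotion ν (P.ωStar ν) τ s x)
    (hm : ∀ r ∈ Icc 0 t, ν * δ < Metric.infDist (x r) P.region) :
    ∀ i, τ i ≤ t → P.V ν (s (τ i)) (x (τ i)) ≤ max (P.V ν (s 0) (x 0)) (2 * δ) ∧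
      (∀ j ≤ i, P.cdist (s (τ i)) (P.mid ν (x (τ i))) ≤
        max (P.cdist (s (τ j)) (P.mid ν (x (τ j)))) (2 * δ)) ∧
      (P.cdist (s (τ i)) (P.mid ν (x (τ i))) ≤ 2 * δ ∨
        P.Approaching ν ((1 - ν) * τ i) (s (τ i)) (x (τ i))) := by
  have hδ0 := hτ.pos
  intro i
  induction i with
  | zero =>
    intro h0
    have hx := notMem_of_infDist_pos ((mul_pos hν hδ0).trans (hm (τ 0) ⟨hτ.nonneg 0, h0⟩))
    refine ⟨by rw [hτ.1]; exact le_max_left _ _, fun j hj => ?_, ?_⟩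
    · rw [Nat.le_zero.1 hj]; exact le_max_left _ _
    · rcases approaching_or hx hν hν1 (s (τ 0)) with h | h
      · left; linarith
      · right
        have h2 : (1 - ν) * τ 0 = 0 := by rw [hτ.1, mul_zero]
        rwa [h2]
  | succ i ih =>
    intro hi
    obtain ⟨hlt, hle⟩ := hτ.2.1 i
    obtain ⟨h1, h2, h3⟩ := ih (hlt.le.trans hi)
    have hmi := hm (τ i) ⟨hτ.nonneg i, hlt.le.trans hi⟩
    set h := τ (i + 1) - τ i with hh
    have h0 : 0 ≤ h := sub_nonneg.2 hlt.le
    have hhδ : h ≤ δ := by linarith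
    have hss : s (τ (i + 1)) = s (τ i) + h * P.ωStar ν (s (τ i)) (x (τ i)) :=
      hs.2 i _ ⟨hlt.le, le_rfl⟩
    have hxx := hs.1 (hτ.nonneg i) (hτ.nonneg (i + 1))
    rw [← hh, abs_of_nonneg h0] at hxx
    have hd : Disjoint (_root_.segment ℝ (x (τ i)) (x (τ (i + 1)))) P.region :=
      disjoint_segment_of_norm_lt
        ((hxx.trans (mul_le_mul_of_nonneg_left hhδ hν.le)).trans_lt hmi)
    rw [norm_sub_rev] at hxx
    obtain ⟨e1, e2⟩ := V_defender_step hν hν1 hxx hd (s (τ i))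
    rw [← hss] at e1 e2
    have e1' : P.cdist (s (τ (i + 1))) (P.mid ν (x (τ (i + 1)))) ≤
        max (P.cdist (s (τ i)) (P.mid ν (x (τ i)))) (2 * δ) :=
      e1.trans (max_le_max le_rfl (by linarith))
    refine ⟨e2.trans (max_le h1 (le_max_of_le_right (by linarith))), fun j hj => ?_, ?_⟩
    · rcases Nat.le_succ_iff.1 hj with hj | rfl
      · exact e1'.trans (max_le (h2 j hj) (le_max_right _ _))
      · exact le_max_left _ _
    · rcases h3 with h3 | h3
      · exact Or.inl (e1'.trans (max_le h3 le_rfl))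
      · rcases h3.step hν hν1 hxx hd with h4 | h4
        · left; rw [hss]; linarith
        · right
          rw [hss]
          convert h4 using 1
          rw [hh]; ring

lemma defender_motion_bounds {s₀ : ℝ} {x₀ : Plane} {s : ℝ → ℝ} {x : ℝ → Plane}
    (hmot : IsDefenderMotion ν (P.ωStar ν) s₀ x₀ s x) {t : ℝ} (ht : 0 ≤ t)
    (hx : ∀ r ∈ Icc 0 t, x r ∉ P.region) :
    P.V ν (s t) (x t) ≤ max (P.V ν s₀ x₀) 0 ∧
      (∀ t₀ ∈ Icc 0 t, P.cdist (s t) (P.mid ν (x t)) ≤ P.cdist (s t₀) (P.mid ν (x t₀))) ∧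
      (5 / 2 * P.L < (1 - ν) * t → P.cdist (s t) (P.mid ν (x t)) = 0) := by
  obtain ⟨δ, τ, sn, xn, ha, hstep⟩ := hmot.exists_approx (P.isDefenderLaw_ωStar ν).1
  obtain ⟨i, hi, hi', hτ, hz⟩ := ha.exists_last ht
  have hinv := (ha.eventually_margin ht hx).mono fun n hn =>
    And.intro hn (defender_invariant hν hν1 (ha.sampling n) (hstep n) hn (i n) (hi n))
  simp only [ha.init_s, ha.init_x] at hinv
  have hxt := hx t ⟨ht, le_rfl⟩
  have hδ2 : Tendsto (fun n => 2 * δ n) atTop (𝓝 0) := by simpa using ha.tendsto_δ.const_mul 2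
  have hcd := tendsto_cdist_mid hν hν1 hxt hz
  refine ⟨?_, fun t₀ ht₀ => ?_, fun hlt => ?_⟩
  · exact le_of_tendsto_of_tendsto (tendsto_V hν hν1 hxt hz) (tendsto_const_nhds.max hδ2)
      (hinv.mono fun n hn => hn.2.1)
  · obtain ⟨j, hj, -, -, hzj⟩ := ha.exists_last ht₀.1
    have h1 := (tendsto_cdist_mid hν hν1 (hx t₀ ht₀) hzj).max hδ2
    rw [max_eq_left (P.cdist_nonneg _ _)] at h1
    refine le_of_tendsto_of_tendsto hcd h1 (hinv.mono fun n hn => hn.2.2.1 _ ?_)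
    have : τ n (j n) < τ n (i n + 1) := ((hj n).trans ht₀.2).trans_lt (hi' n)
    exact Nat.lt_succ_iff.1 ((ha.sampling n).strictMono.lt_iff_lt.1 this)
  · refine le_antisymm (le_of_tendsto_of_tendsto hcd hδ2 ?_) (P.cdist_nonneg _ _)
    filter_upwards [hinv, (hτ.const_mul (1 - ν)).eventually (lt_mem_nhds hlt)] with n hn hn'
    rcases hn.2.2.2 with h | h
    · exact h
    · have hxn := notMem_of_infDist_pos ((mul_pos hν (ha.sampling n).pos).trans
        (hn.1 (τ n (i n)) ⟨(ha.sampling n).nonneg _, hi n⟩))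
      exact absurd (h.le hxn hν hν1) hn'.not_ge

theorem defender_afferent {s₀ : ℝ} {x₀ : Plane} {s : ℝ → ℝ} {x : ℝ → Plane}
    (hmot : IsDefenderMotion ν (P.ωStar ν) s₀ x₀ s x) {t₀ t : ℝ} (ht₀ : 0 ≤ t₀) (ht : t₀ ≤ t)
    (hx : ∀ r ∈ Icc 0 t, x r ∉ P.region) (h : x t₀ ∈ P.afferent ν (s t₀)) :
    x t ∈ P.afferent ν (s t) := by
  rw [mem_afferent_iff (hx _ ⟨ht₀, ht⟩) hν hν1] at h
  rw [mem_afferent_iff (hx _ ⟨ht₀.trans ht, le_rfl⟩) hν hν1]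
  refine le_antisymm ?_ (P.cdist_nonneg _ _)
  rw [← h]
  exact (defender_motion_bounds hν hν1 hmot (ht₀.trans ht) hx).2.1 t₀ ⟨ht₀, ht⟩

theorem defender_motion {s₀ : ℝ} {x₀ : Plane} (hx₀ : x₀ ∉ P.region) (hV : P.V ν s₀ x₀ ≤ 0)
    {s : ℝ → ℝ} {x : ℝ → Plane} (hmot : IsDefenderMotion ν (P.ωStar ν) s₀ x₀ s x) :
    ¬ P.Scores s x ∧ (ν < 1 → (∃ t, 0 ≤ t ∧ x t = P.γ (s t)) ∨
      ∃ t₁, 0 ≤ t₁ ∧ ∀ t, t₁ ≤ t → x t ∈ P.afferent ν (s t)) := by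
  obtain ⟨δ, τ, sn, xn, ha, -⟩ := hmot.exists_approx (P.isDefenderLaw_ωStar ν).1
  have h0 : x 0 ∉ P.region := by rwa [ha.x_zero]
  have hcap : ∀ t, 0 ≤ t → x t ∈ P.region → ∃ r ∈ Icc 0 t, x r = P.γ (s r) := by
    intro t ht hxt
    obtain ⟨r, hr0, hrt, hxr, hout⟩ := exists_first_time ha.speedLE_x.continuousOn h0 ht hxt
    refine ⟨r, ⟨hr0.le, hrt⟩, ?_⟩
    -- Before the arrival, `V ≤ 0` keeps the defender within a fixed multiple of the intruder's
    -- distance to the target; by continuity the two players meet on arrival.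
    have hbound : ∀ u, 0 ≤ u → u < r →
        ‖x u - P.γ (s u)‖ ≤ (1 + 2 / ν) * Metric.infDist (x u) P.region := by
      intro u hu hur
      have hxu := hout u hu hur
      have h1 := (defender_motion_bounds hν hν1 hmot hu
        fun q hq => hout q hq.1 (hq.2.trans_lt hur)).1
      rw [max_eq_right hV] at h1
      obtain ⟨q, hq, hqn⟩ := exists_visible_nearest hxu
      have h2 := cdist_le_of_V_nonpos hxu hν hν1 hq h1
      have h3 := P.norm_γ_sub_le_cdist (s u) q
      have h4 := norm_sub_le_norm_sub_add_norm_sub (x u) (P.γ q) (P.γ (s u))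
      rw [norm_sub_rev (x u) (P.γ q), hqn, norm_sub_rev (P.γ q)] at h4
      rw [hqn] at h2
      have : (1 + 2 / ν) * Metric.infDist (x u) P.region =
        Metric.infDist (x u) P.region + 2 * (Metric.infDist (x u) P.region / ν) := by ring
      linarith
    have hsub : Iio r ∩ Ici 0 ∈ 𝓝[<] r :=
      inter_mem self_mem_nhdsWithin (nhdsWithin_le_nhds (Ici_mem_nhds hr0))
    have hxc : Tendsto x (𝓝[<] r) (𝓝 (x r)) :=
      (ha.speedLE_x.continuousOn.continuousAt (Ici_mem_nhds hr0)).tendsto.mono_left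
        nhdsWithin_le_nhds
    have hsc : Tendsto s (𝓝[<] r) (𝓝 (s r)) :=
      (ha.speedLE_s.continuousOn.continuousAt (Ici_mem_nhds hr0)).tendsto.mono_left
        nhdsWithin_le_nhds
    have e1 := (hxc.sub ((P.continuous_γ.tendsto _).comp hsc)).norm
    have e2 := (((Metric.continuous_infDist_pt P.region).tendsto _).comp hxc).const_mul (1 + 2 / ν)
    have e3 := le_of_tendsto_of_tendsto e1 e2 (by
      filter_upwards [hsub] with u hu
      exact hbound u hu.2 hu.1)
    rw [Metric.infDist_zero_of_mem hxr, mul_zero] at e3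
    exact sub_eq_zero.1 (norm_le_zero_iff.1 e3)
  refine ⟨?_, fun hlt => ?_⟩
  · rintro ⟨t, ht, hxt, hfree⟩
    obtain ⟨r, hr, heq⟩ := hcap t ht hxt
    exact hfree r hr heq
  · by_cases hit : ∃ t, 0 ≤ t ∧ x t ∈ P.region
    · obtain ⟨t, ht, hxt⟩ := hit
      obtain ⟨r, hr, heq⟩ := hcap t ht hxt
      exact Or.inl ⟨r, hr.1, heq⟩
    · push Not at hit
      right
      have hν' : 0 < 1 - ν := by linarith
      -- Any time beyond `5 / 2 * L / (1 - ν)` suffices.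
      refine ⟨3 * P.L / (1 - ν), by have := P.L_pos; positivity, fun t ht => ?_⟩
      have ht0 : 0 ≤ t := le_trans (by have := P.L_pos; positivity) ht
      rw [mem_afferent_iff (hit t ht0) hν hν1]
      refine (defender_motion_bounds hν hν1 hmot ht0 fun r hr => hit r hr.1).2.2 ?_
      rw [div_le_iff₀ hν'] at ht
      linarith [P.L_pos]

end

end Target

/-! ### Compactness of motions -/

/-- Arzelà–Ascoli: a common speed limit and initial value give equicontinuity and pointwise
compactness. Composition with `max t 0` extends the functions to all of `ℝ`. -/
lemma exists_subseq_tendstoLocallyUniformlyOn {E : Type*} [NormedAddCommGroup E] [ProperSpace E]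
    {c : ℝ} {f : ℕ → ℝ → E} {e : E} (hf : ∀ n, SpeedLE c (f n)) (h0 : ∀ n, f n 0 = e) :
    ∃ (φ : ℕ → ℕ) (g : ℝ → E), StrictMono φ ∧
      TendstoLocallyUniformlyOn (fun n => f (φ n)) g atTop (Ici 0) := by
  set K := Real.toNNReal c
  have hl : ∀ n, LipschitzWith K fun t => f n (max t 0) := fun n =>
    LipschitzWith.of_dist_le_mul fun t t' => by
      rw [dist_eq_norm]
      refine (hf n (le_max_right t' 0) (le_max_right t 0)).trans ?_
      exact mul_le_mul (Real.le_coe_toNNReal c) (abs_max_sub_max_le_abs t t' 0) (abs_nonneg _)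
        K.coe_nonneg
  let F : ℕ → C(ℝ, E) := fun n => ⟨fun t => f n (max t 0), (hl n).continuous⟩
  let S : Set C(ℝ, E) := {g | g 0 = e ∧ LipschitzWith K g}
  have hS : ContinuousMap.toFun '' S = {g : ℝ → E | g 0 = e ∧ LipschitzWith K g} := by
    ext g
    constructor
    · rintro ⟨g, hg, rfl⟩; exact hg
    · intro hg; exact ⟨⟨g, hg.2.continuous⟩, hg, rfl⟩
  have hcl : IsClosed {g : ℝ → E | g 0 = e ∧ LipschitzWith K g} := by
    have h1 : {g : ℝ → E | g 0 = e ∧ LipschitzWith K g} =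
        {g | g 0 = e} ∩ ⋂ t, ⋂ t', {g | dist (g t) (g t') ≤ K * dist t t'} := by
      ext g
      simp only [lipschitzWith_iff_dist_le_mul, mem_ofPred_eq, mem_inter_iff, mem_iInter]
    rw [h1]
    refine (isClosed_eq (continuous_apply 0) continuous_const).inter
      (isClosed_iInter fun t => isClosed_iInter fun t' => isClosed_le ?_ continuous_const)
    exact (continuous_apply t).dist (continuous_apply t')
  have hK : IsCompact S := by
    refine ArzelaAscoli.isCompact_of_equicontinuous S ?_ ?_
    · rw [hS]
      refine (isCompact_univ_pi fun t : ℝ =>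
        isCompact_closedBall e (K * |t|)).of_isClosed_subset hcl ?_
      rintro g ⟨hg0, hg⟩ t -
      rw [Metric.mem_closedBall, ← hg0]
      simpa using hg.dist_le_mul t 0
    · exact (LipschitzWith.uniformEquicontinuous _ K fun g : S => g.2.2).equicontinuous
  obtain ⟨g, -, φ, hφ, hg⟩ := hK.tendsto_subseq (x := F) fun n => ⟨by simp [F, h0], hl n⟩
  refine ⟨φ, g, hφ, ?_⟩
  have h1 := (ContinuousMap.tendsto_iff_tendstoLocallyUniformly.1 hg).tendstoLocallyUniformlyOn
    (s := Ici 0)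
  refine h1.congr fun n t ht => ?_
  simp [F, max_eq_left (mem_Ici.1 ht)]

/-- The positions at the sampling times when both players use feedback laws. -/
noncomputable def jointSeq (U : ℝ → Plane → Plane) (W : ℝ → Plane → ℝ) (δ : ℝ) (z : ℝ × Plane) :
    ℕ → ℝ × Plane
  | 0 => z
  | n + 1 => ((jointSeq U W δ z n).1 + δ * W (jointSeq U W δ z n).1 (jointSeq U W δ z n).2,
      (jointSeq U W δ z n).2 + δ • U (jointSeq U W δ z n).1 (jointSeq U W δ z n).2)

lemma isSampling_mul {δ : ℝ} (hδ : 0 < δ) : IsSampling δ fun i => i * δ := by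
  refine ⟨by simp, fun i => ⟨?_, ?_⟩, tendsto_natCast_atTop_atTop.atTop_mul_const hδ⟩ <;>
  · push_cast; linarith

lemma exists_joint_step {U : ℝ → Plane → Plane} {W : ℝ → Plane → ℝ} {ν δ : ℝ} (hδ : 0 < δ)
    (hU : ∀ s x, ‖U s x‖ ≤ ν) (hW : ∀ s x, |W s x| ≤ 1) (z : ℝ × Plane) :
    ∃ s x, s 0 = z.1 ∧ x 0 = z.2 ∧ IsIntruderStepMotion U (fun i => i * δ) s x ∧
      IsDefenderStepMotion ν W (fun i => i * δ) s x := by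
  set q := jointSeq U W δ z with hq
  let i : ℝ → ℕ := fun t => ⌊t / δ⌋₊
  let s : ℝ → ℝ := fun t => (q (i t)).1 + (t - i t * δ) * W (q (i t)).1 (q (i t)).2
  let x : ℝ → Plane := fun t => (q (i t)).2 + (t - i t * δ) • U (q (i t)).1 (q (i t)).2
  have hi : ∀ n : ℕ, ∀ t ∈ Ico (n * δ) ((n + 1 : ℕ) * δ), i t = n := by
    intro n t ht
    refine (Nat.floor_eq_iff (div_nonneg ((by positivity : 0 ≤ n * δ).trans ht.1) hδ.le)).2 ?_
    rw [le_div_iff₀ hδ, div_lt_iff₀ hδ]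
    exact ⟨ht.1, by simpa using ht.2⟩
  have hn : ∀ n : ℕ, s (n * δ) = (q n).1 ∧ x (n * δ) = (q n).2 := by
    intro n
    have := hi n (n * δ) ⟨le_rfl, by push_cast; linarith⟩
    simp only [s, x, this, sub_self, zero_mul, zero_smul, add_zero, and_self]
  have hst : ∀ n : ℕ, ∀ t ∈ Icc (n * δ) ((n + 1 : ℕ) * δ),
      s t = s (n * δ) + (t - n * δ) * W (s (n * δ)) (x (n * δ)) ∧
      x t = x (n * δ) + (t - n * δ) • U (s (n * δ)) (x (n * δ)) := by
    intro n t ht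
    rw [(hn n).1, (hn n).2]
    rcases ht.2.lt_or_eq with h | rfl
    · have := hi n t ⟨ht.1, h⟩
      simp only [s, x, this, and_self]
    · rw [(hn (n + 1)).1, (hn (n + 1)).2]
      have : ((n + 1 : ℕ) : ℝ) * δ - n * δ = δ := by push_cast; ring
      rw [this]
      exact ⟨rfl, rfl⟩
  have hτ := isSampling_mul hδ
  have h0 := hn 0
  rw [Nat.cast_zero, zero_mul] at h0
  refine ⟨s, x, h0.1, h0.2, ⟨?_, fun n t ht => (hst n t ht).2⟩, ⟨?_, fun n t ht => (hst n t ht).1⟩⟩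
  · refine hτ.speedLE fun n t ht t' ht' hle => ?_
    rw [(hst n t ht).1, (hst n t' ht').1, add_sub_add_left_eq_sub, ← sub_mul,
      sub_sub_sub_cancel_right, norm_mul, Real.norm_of_nonneg (sub_nonneg.2 hle), mul_comm]
    exact mul_le_mul_of_nonneg_right (hW _ _) (sub_nonneg.2 hle)
  · refine hτ.speedLE fun n t ht t' ht' hle => ?_
    rw [(hst n t ht).2, (hst n t' ht').2, add_sub_add_left_eq_sub, ← sub_smul,
      sub_sub_sub_cancel_right, norm_smul, Real.norm_of_nonneg (sub_nonneg.2 hle), mul_comm]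
    exact mul_le_mul_of_nonneg_right (hU _ _) (sub_nonneg.2 hle)

/-- Any two feedback laws can be played against each other. -/
lemma exists_joint_motion {U : ℝ → Plane → Plane} {W : ℝ → Plane → ℝ} {ν : ℝ}
    (hU : ∀ s x, ‖U s x‖ ≤ ν) (hW : ∀ s x, |W s x| ≤ 1) (z : ℝ × Plane) :
    ∃ s x, IsIntruderMotion U z.1 z.2 s x ∧ IsDefenderMotion ν W z.1 z.2 s x := by
  have hδ : ∀ n : ℕ, (0 : ℝ) < 1 / (n + 1) := fun n => Nat.one_div_pos_of_nat
  choose s x hs0 hx0 hI hD using fun n => exists_joint_step (hδ n) hU hW z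
  have hsp : ∀ n, SpeedLE (max 1 ν) fun t => (s n t, x n t) := fun n t ht t' ht' => by
    rw [Prod.mk_sub_mk, Prod.norm_mk]
    refine max_le (((hI n).1 ht ht').trans ?_) (((hD n).1 ht ht').trans ?_)
    · exact mul_le_mul_of_nonneg_right (le_max_left _ _) (abs_nonneg _)
    · exact mul_le_mul_of_nonneg_right (le_max_right _ _) (abs_nonneg _)
  obtain ⟨φ, g, hφ, hg⟩ := exists_subseq_tendstoLocallyUniformlyOn hsp (e := z)
    fun n => by rw [hs0, hx0]
  have h1 : TendstoLocallyUniformlyOn (fun n => s (φ n)) (fun t => (g t).1) atTop (Ici 0) :=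
    uniformContinuous_fst.comp_tendstoLocallyUniformlyOn hg
  have h2 : TendstoLocallyUniformlyOn (fun n => x (φ n)) (fun t => (g t).2) atTop (Ici 0) :=
    uniformContinuous_snd.comp_tendstoLocallyUniformlyOn hg
  have hδt : Tendsto (fun n => 1 / ((φ n : ℝ) + 1)) atTop (𝓝 0) :=
    tendsto_one_div_add_atTop_nhds_zero_nat.comp hφ.tendsto_atTop
  exact ⟨_, _,
    ⟨_, _, _, _, hδt, fun n => ⟨isSampling_mul (hδ _), hI _, hs0 _, hx0 _⟩, h1, h2⟩,
    ⟨_, _, _, _, hδt, fun n => ⟨isSampling_mul (hδ _), hD _, hs0 _, hx0 _⟩, h1, h2⟩⟩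

namespace Target

variable {P : Target}

/-! ### The winning regions -/

/-- Playing the two winning laws against each other would produce a motion along which the intruder
both scores and does not. -/
lemma disjoint_winning (P : Target) (ν : ℝ) :
    Disjoint (P.intruderWinning ν) (P.defenderWinning ν) := by
  rw [Set.disjoint_left]
  rintro z ⟨-, U, hU, h1⟩ ⟨-, W, hW, h2⟩
  obtain ⟨s, x, hI, hD⟩ := exists_joint_motion hU.1 hW.1 z
  exact h2 s x hD (h1 s x hI)

section

variable {ν : ℝ} (hν : 0 < ν) (hν1 : ν ≤ 1)
include hν hν1

lemma mem_defenderWinning {z : ℝ × Plane} (hz : z.2 ∉ P.region) (hV : P.V ν z.1 z.2 ≤ 0) :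
    z ∈ P.defenderWinning ν :=
  ⟨hz, P.ωStar ν, P.isDefenderLaw_ωStar ν, fun _ _ h => (defender_motion hν hν1 hz hV h).1⟩

lemma mem_intruderWinning {z : ℝ × Plane} (hz : z.2 ∉ P.region) (hV : 0 < P.V ν z.1 z.2) :
    z ∈ P.intruderWinning ν := by
  have key : ∀ ν' : ℝ, 0 < ν' → ν' < 1 → ν' ≤ ν → 0 < P.V ν' z.1 z.2 → z ∈ P.intruderWinning ν :=
    fun ν' h0 h1 hle hV' => ⟨hz, P.uStar ν', isIntruderLaw_uStar h0 hle,
      fun _ _ h => (intruder_motion h0 h1.le hz hV' h).1 h1⟩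
  rcases hν1.lt_or_eq with h | rfl
  · exact key ν hν h le_rfl hV
  -- For `ν = 1` the law `uStar 1` is only shown to score or to approach the target asymptotically,
  -- so a ratio `ν' < 1` is used. For `ν' = (C + 1) / (C + 1 + v)` the loss `C (1 / ν' - 1) = C v /
  -- (C + 1)` is less than `v`.
  set C := 2 * (‖P.γ (P.qL 1 z.2) - z.2‖ + ‖P.γ (P.qR 1 z.2) - z.2‖) with hC
  have hC0 : 0 ≤ C := by positivity
  set v := P.V 1 z.1 z.2
  have hpos : 0 < C + 1 + v := by linarith
  have h0 : 0 < (C + 1) / (C + 1 + v) := by positivity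
  have h1 : (C + 1) / (C + 1 + v) < 1 := by rw [div_lt_one hpos]; linarith
  refine key _ h0 h1 h1.le ?_
  have h2 := (abs_le.1 (abs_V_sub_V_one_le hz h0 h1.le z.1)).1
  rw [← hC, one_div_div, div_sub_one (by linarith), add_sub_cancel_left, mul_div_assoc'] at h2
  have h3 : C * v / (C + 1) < v := by rw [div_lt_iff₀ (by linarith)]; nlinarith
  linarith

theorem intruderWinning_eq : P.intruderWinning ν = {z | z.2 ∉ P.region ∧ 0 < P.V ν z.1 z.2} := by
  ext z
  refine ⟨fun hz => ⟨hz.1, ?_⟩, fun hz => mem_intruderWinning hν hν1 hz.1 hz.2⟩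
  by_contra! hV
  exact Set.disjoint_left.1 (P.disjoint_winning ν) hz (mem_defenderWinning hν hν1 hz.1 hV)

theorem defenderWinning_eq : P.defenderWinning ν = {z | z.2 ∉ P.region ∧ P.V ν z.1 z.2 ≤ 0} := by
  ext z
  refine ⟨fun hz => ⟨hz.1, ?_⟩, fun hz => mem_defenderWinning hν hν1 hz.1 hz.2⟩
  by_contra! hV
  exact Set.disjoint_left.1 (P.disjoint_winning ν) (mem_intruderWinning hν hν1 hz.1 hV) hz

/-! ### The barrier -/

/-- If the defender is opposite to the midpoint, a small step of the intruder towards the left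
breaching point shrinks the interval of safe positions: for the right breaching point the step
is a detour. -/
lemma exists_rad_lt {x : Plane} (hx : x ∉ P.region) {h : ℝ} (h0 : 0 < h)
    (hh : 3 * (ν * h) < Metric.infDist x P.region) (hL : 4 * h < P.L) :
    ∃ y, y ∉ P.region ∧ ‖x - y‖ ≤ h ∧ P.rad ν y < P.rad ν x ∧
      ∃ k : ℤ, |P.mid ν y - P.mid ν x + k * P.L| ≤ h := by
  have hνh : 0 < ν * h := mul_pos hν h0
  have hh' : ν * h < Metric.infDist x P.region := by linarith
  obtain ⟨-, -, hn1, hdis1, -⟩ := toward_facts hx hν h0.le hh' (P.qL ν x)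
  obtain ⟨-, -, hn2, hdis2, -⟩ := toward_facts hx hν h0.le hh' (P.qR ν x)
  obtain ⟨k, hk1, hk2⟩ := toward_left hx hν hν1 h0.le hh'
  obtain ⟨j, hj1, hj2⟩ := toward_right hx hν hν1 h0.le hh'
  have hA := P.norm_γ_sub_pos hx (P.qL ν x)
  have hB := P.norm_γ_sub_pos hx (P.qR ν x)
  set A := P.γ (P.qL ν x) with hAdef
  set B := P.γ (P.qR ν x) with hBdef
  set y := x + (ν * h / ‖A - x‖) • (A - x) with hy
  set z := x + (ν * h / ‖B - x‖) • (B - x) with hz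
  have hyT := (notMem_of_disjoint hdis1).2
  have hzT := (notMem_of_disjoint hdis2).2
  have hne : (y - x) + (z - x) ≠ 0 := by
    intro he
    rw [hy, hz, add_sub_cancel_left, add_sub_cancel_left] at he
    set a := ν * h / ‖A - x‖
    set b := ν * h / ‖B - x‖
    have ha : 0 < a := by positivity
    have hb : 0 < b := by positivity
    have hxe : x = (a / (a + b)) • A + (b / (a + b)) • B := by
      have h1 : (a + b) • x = a • A + b • B := by
        rw [← sub_eq_zero, ← neg_eq_zero, ← he]; module
      rw [div_eq_inv_mul, div_eq_inv_mul, mul_smul, mul_smul, ← smul_add, ← h1,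
        inv_smul_smul₀ (by positivity)]
    refine hx ?_
    rw [hxe]
    exact P.convex_region (P.γ_mem _) (P.γ_mem _) (by positivity) (by positivity)
      (by rw [← add_div, div_self (by positivity)])
  -- The steps to `y` and `z` have equal length and are not opposite, since `x` is not on the chord
  -- from `A` to `B`. So `hi` at `y` exceeds its value at `z`, which is `hi x - h` up to a shift, by
  -- less than `2 h`, while `lo` at `y` has risen by the full `h`.
  have hyz : ‖y - z‖ < 2 * (ν * h) := by
    have h1 := parallelogram_law_with_norm ℝ (y - x) (z - x)
    rw [sub_sub_sub_cancel_right, norm_sub_rev y x, norm_sub_rev z x, hn1, hn2] at h1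
    have h2 := norm_pos_iff.2 hne
    nlinarith [norm_nonneg (y - z)]
  have hdis3 : Disjoint (_root_.segment ℝ y z) P.region := by
    refine disjoint_segment_of_norm_lt ?_
    have h1 := Metric.infDist_le_infDist_add_dist (s := P.region) (x := x) (y := y)
    rw [dist_eq_norm, hn1] at h1
    rw [norm_sub_rev]
    linarith
  obtain ⟨i, hi⟩ := exists_abs_sub_le hyT hzT hdis3
  have hi2 := (hi ν hν hν1).2
  have hyz' : ‖y - z‖ / ν < 2 * h := by rw [div_lt_iff₀ hν]; linarith
  rw [abs_le] at hk2 hi2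
  have hkij : k + i - j = 0 := by
    have h1 : |((k + i - j : ℤ) : ℝ) * P.L| < 1 * P.L := by
      push_cast
      rw [abs_lt]
      constructor <;> linarith [hk2.1, hk2.2, hi2.1, hi2.2]
    rw [abs_mul, abs_of_pos P.L_pos] at h1
    exact Int.abs_lt_one_iff.1 (by exact_mod_cast lt_of_mul_lt_mul_right h1 P.L_pos.le)
  have hj' : (j : ℝ) = k + i := by exact_mod_cast (by omega : j = k + i)
  rw [hj'] at hj1
  refine ⟨y, hyT, ?_, ?_, k, ?_⟩
  · rw [hn1]; exact mul_le_of_le_one_left h0.le hν1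
  · rw [rad, rad]; linarith [hi2.1]
  · rw [mid, mid, abs_le]
    constructor <;> linarith [hk2.1, hk2.2]

lemma mem_closure_of_V_eq_zero {z : ℝ × Plane} (hz : z.2 ∉ P.region) (hV : P.V ν z.1 z.2 = 0) :
    z ∈ closure {z : ℝ × Plane | z.2 ∉ P.region ∧ 0 < P.V ν z.1 z.2} := by
  obtain ⟨s, x⟩ := z
  simp only at hz hV
  rw [Metric.mem_closure_iff]
  intro ε hε
  have hLp := P.L_pos
  have hV' := hV
  rw [V_eq hz hν hν1] at hV'
  -- Unless the defender is opposite to `mid`, moving it away from `mid` raises `V`. If it is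
  -- opposite, the intruder moves so as to shrink `rad`, and the defender is displaced to stay
  -- opposite.
  rcases (P.cdist_le_half s (P.mid ν x)).lt_or_eq with hlt | heq
  · set e := min (ε / 2) (P.L / 2 - P.cdist s (P.mid ν x)) with he
    have he0 : 0 < e := lt_min (by linarith) (by linarith)
    have he1 : e ≤ ε / 2 := min_le_left _ _
    have he2 : e ≤ P.L / 2 - P.cdist s (P.mid ν x) := min_le_right _ _
    have key : ∃ s', |s - s'| = e ∧ P.cdist s' (P.mid ν x) = P.cdist s (P.mid ν x) + e := by
      obtain ⟨j, hj, -⟩ := P.exists_cdist_eq s (P.mid ν x)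
      rcases le_total 0 (s - P.mid ν x + j * P.L) with h | h
      · rw [abs_of_nonneg h] at hj
        have e1 : |s + e - P.mid ν x + j * P.L| = P.cdist s (P.mid ν x) + e := by
          rw [abs_of_nonneg] <;> linarith
        exact ⟨s + e, by rw [sub_add_cancel_left, abs_neg, abs_of_pos he0],
          by rw [cdist_eq_abs (k := j) (by rw [e1]; linarith), e1]⟩
      · rw [abs_of_nonpos h] at hj
        have e1 : |s - e - P.mid ν x + j * P.L| = P.cdist s (P.mid ν x) + e := by
          rw [abs_of_nonpos] <;> linarith
        exact ⟨s - e, by rw [sub_sub_cancel, abs_of_pos he0],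
          by rw [cdist_eq_abs (k := j) (by rw [e1]; linarith), e1]⟩
    obtain ⟨s', h1, h2⟩ := key
    refine ⟨(s', x), ⟨hz, ?_⟩, ?_⟩
    · simp only
      rw [V_eq hz hν hν1, h2]; linarith
    · rw [Prod.dist_eq, dist_self, Real.dist_eq, h1]
      exact max_lt (by linarith) hε
  · have hρ := Target.infDist_pos hz
    set h := min (ε / 2) (min (P.L / 8) (Metric.infDist x P.region / (4 * ν))) with hh
    have h0 : 0 < h := by positivity
    have h1 : h ≤ ε / 2 := min_le_left _ _
    have h2 : h ≤ P.L / 8 := (min_le_right _ _).trans (min_le_left _ _)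
    have h3 : h ≤ Metric.infDist x P.region / (4 * ν) := (min_le_right _ _).trans (min_le_right _ _)
    rw [le_div_iff₀ (by positivity)] at h3
    obtain ⟨y, hy, hxy, hr, k, hk⟩ := exists_rad_lt hν hν1 hz h0 (by nlinarith) (by linarith)
    refine ⟨(s + (P.mid ν y - P.mid ν x + k * P.L), y), ⟨hy, ?_⟩, ?_⟩
    · have e1 : P.cdist (s + (P.mid ν y - P.mid ν x + k * P.L)) (P.mid ν y) = P.L / 2 := by
        rw [← heq, ← cdist_add_left s _ k, cdist, cdist]
        congr 2; ring
      simp only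
      rw [V_eq hy hν hν1, e1]; linarith
    · rw [Prod.dist_eq, Real.dist_eq, dist_eq_norm]
      refine max_lt ?_ (by linarith)
      rw [sub_add_cancel_left, abs_neg]
      linarith

theorem barrier_eq : P.barrier ν = {z | z.2 ∉ P.region ∧ P.V ν z.1 z.2 = 0} := by
  ext z
  rw [barrier, mem_ofPred_eq, intruderWinning_eq hν hν1, defenderWinning_eq hν hν1]
  constructor
  · rintro ⟨hz, h1, h2⟩
    have hc : ContinuousAt (fun z : ℝ × Plane => P.V ν z.1 z.2) z :=
      (P.continuousOn_V hν hν1).continuousAt (P.isOpen_outside.mem_nhds hz)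
    rw [mem_closure_iff_frequently] at h1 h2
    refine ⟨hz, le_antisymm (not_lt.1 fun hlt => ?_) (not_lt.1 fun hlt => ?_)⟩
    · obtain ⟨w, hw, hw'⟩ := (h2.and_eventually (hc.eventually (lt_mem_nhds hlt))).exists
      exact hw.2.not_gt hw'
    · obtain ⟨w, hw, hw'⟩ := (h1.and_eventually (hc.eventually (gt_mem_nhds hlt))).exists
      exact hw.2.not_gt hw'
  · rintro ⟨hz, hV⟩
    exact ⟨hz, mem_closure_of_V_eq_zero hν hν1 hz hV, subset_closure ⟨hz, hV.le⟩⟩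

end

end Target

end PerimeterDefense

theorem mainTheorem1 (P : PerimeterDefense.Target) (ν : ℝ) (hν : 0 < ν) (hν1 : ν ≤ 1) :
    -- the breaching points exist, and they are unique if `ν < 1`
    (∀ x ∉ P.region,
      (P.sL ν x ∈ Ico 0 P.L ∧ P.IsLeftBreachingPoint ν x (P.sL ν x)) ∧
      (P.sR ν x ∈ Ico 0 P.L ∧ P.IsRightBreachingPoint ν x (P.sR ν x))) ∧
    (ν < 1 → ∀ x ∉ P.region,
      (∃! s, s ∈ Ico 0 P.L ∧ P.IsLeftBreachingPoint ν x s) ∧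
      (∃! s, s ∈ Ico 0 P.L ∧ P.IsRightBreachingPoint ν x s)) ∧
    -- the approach angles at the breaching points, where the perimeter is differentiable
    (∀ x ∉ P.region, ∀ v : PerimeterDefense.Plane,
      (HasDerivAt P.γ v (P.sL ν x) →
        P.approachAngle x (P.sL ν x) v = Real.arccos ν) ∧
      (HasDerivAt P.γ v (P.sR ν x) →
        P.approachAngle x (P.sR ν x) v = Real.pi - Real.arccos ν)) ∧
    -- the approach angles before and after a vertex
    (∀ x ∉ P.region, ∀ v w : PerimeterDefense.Plane,
      (P.sL ν x ∈ interior (P.visible x) →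
        HasDerivWithinAt P.γ v (Iic (P.sL ν x)) (P.sL ν x) →
        HasDerivWithinAt P.γ w (Ici (P.sL ν x)) (P.sL ν x) →
        P.approachAngle x (P.sL ν x) w ≤ Real.arccos ν ∧
        Real.arccos ν ≤ P.approachAngle x (P.sL ν x) v) ∧
      (P.sR ν x ∈ interior (P.visible x) →
        HasDerivWithinAt P.γ v (Iic (P.sR ν x)) (P.sR ν x) →
        HasDerivWithinAt P.γ w (Ici (P.sR ν x)) (P.sR ν x) →
        P.approachAngle x (P.sR ν x) w ≤ Real.pi - Real.arccos ν ∧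
        Real.pi - Real.arccos ν ≤ P.approachAngle x (P.sR ν x) v)) ∧
    -- the test for the left region
    (∀ (sD : ℝ), ∀ x ∉ P.region, P.arc (P.sR ν x) (P.sL ν x) ≤ P.L / 2 →
      (x ∈ P.leftRegion ν sD ↔ P.LeftTest ν sD x)) ∧
    -- `uStar` and `ωStar` are admissible
    P.IsIntruderLaw ν (P.uStar ν) ∧
    P.IsDefenderLaw (P.ωStar ν) ∧
    -- if `V > 0`, the intruder wins with `uStar`
    (∀ (s₀ : ℝ), ∀ x₀ ∉ P.region, 0 < P.V ν s₀ x₀ →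
      ∀ s x, PerimeterDefense.IsIntruderMotion (P.uStar ν) s₀ x₀ s x →
        (ν < 1 → P.Scores s x) ∧
        (P.Scores s x ∨
          ((∀ t, 0 ≤ t → x t ∉ P.region ∧ P.V ν s₀ x₀ ≤ P.V ν (s t) (x t)) ∧
            Tendsto (fun t => Metric.infDist (x t) P.region) atTop (𝓝 0)))) ∧
    -- otherwise the defender wins with `ωStar`, by capture or on the afferent surface
    (∀ (s₀ : ℝ), ∀ x₀ ∉ P.region, P.V ν s₀ x₀ ≤ 0 →
      ∀ s x, PerimeterDefense.IsDefenderMotion ν (P.ωStar ν) s₀ x₀ s x →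
        ¬ P.Scores s x ∧
        (ν < 1 → (∃ t, 0 ≤ t ∧ x t = P.γ (s t)) ∨
          ∃ t₁, 0 ≤ t₁ ∧ ∀ t, t₁ ≤ t → x t ∈ P.afferent ν (s t))) ∧
    -- with `ωStar` the defender keeps the intruder on the afferent surface
    (∀ (s₀ : ℝ), ∀ x₀ ∉ P.region,
      ∀ s x, PerimeterDefense.IsDefenderMotion ν (P.ωStar ν) s₀ x₀ s x →
        ∀ t₀ t, 0 ≤ t₀ → t₀ ≤ t → (∀ r ∈ Icc 0 t, x r ∉ P.region) →
          x t₀ ∈ P.afferent ν (s t₀) → x t ∈ P.afferent ν (s t)) ∧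
    -- the winning regions and the barrier
    P.intruderWinning ν = {z | z.2 ∉ P.region ∧ 0 < P.V ν z.1 z.2} ∧
    P.defenderWinning ν = {z | z.2 ∉ P.region ∧ P.V ν z.1 z.2 ≤ 0} ∧
    P.barrier ν = {z | z.2 ∉ P.region ∧ P.V ν z.1 z.2 = 0} := by
  refine ⟨fun x hx => ⟨PerimeterDefense.Target.sL_spec hx ν, PerimeterDefense.Target.sR_spec hx ν⟩,
    fun hlt x hx => ⟨?_, ?_⟩, fun x hx v => ⟨fun hv => ?_, fun hv => ?_⟩,
    fun x hx v w => ⟨fun hi hv hw => ?_, fun hi hv hw => ?_⟩,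
    fun sD x hx hle => PerimeterDefense.Target.mem_leftRegion_iff_leftTest hx hν hν1 sD hle,
    PerimeterDefense.Target.isIntruderLaw_uStar hν le_rfl,
    P.isDefenderLaw_ωStar ν,
    fun s₀ x₀ hx₀ hV s x h => PerimeterDefense.Target.intruder_motion hν hν1 hx₀ hV h,
    fun s₀ x₀ hx₀ hV s x h => PerimeterDefense.Target.defender_motion hν hν1 hx₀ hV h,
    fun s₀ x₀ _ s x h t₀ t ht₀ ht hx haff =>
      PerimeterDefense.Target.defender_afferent hν hν1 h ht₀ ht hx haff,
    PerimeterDefense.Target.intruderWinning_eq hν hν1,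
    PerimeterDefense.Target.defenderWinning_eq hν hν1,
    PerimeterDefense.Target.barrier_eq hν hν1⟩
  · exact ⟨_, PerimeterDefense.Target.sL_spec hx ν, fun t ht =>
      PerimeterDefense.Target.eq_of_mem_Ico ht.1 (PerimeterDefense.Target.sL_spec hx ν).1
        (ht.2.eq hx hν hlt (PerimeterDefense.Target.sL_spec hx ν).2)⟩
  · exact ⟨_, PerimeterDefense.Target.sR_spec hx ν, fun t ht =>
      PerimeterDefense.Target.eq_of_mem_Ico ht.1 (PerimeterDefense.Target.sR_spec hx ν).1
        (ht.2.eq hx hν hlt (PerimeterDefense.Target.sR_spec hx ν).2)⟩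
  · exact (PerimeterDefense.Target.sL_spec hx ν).2.angle_eq hx hν hν1 hv
  · exact (PerimeterDefense.Target.sR_spec hx ν).2.angle_eq hx hν hν1 hv
  · exact (PerimeterDefense.Target.sL_spec hx ν).2.angles_of_interior hx hν hi hv hw
  · exact (PerimeterDefense.Target.sR_spec hx ν).2.angles_of_interior hx hν hi hv hw
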